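/- Consider the one-dimensional defocusing nonlinear Schrödinger equation $$ i\partial_t u = -\partial_x^2 u + V(x,t)\,u + |u|^{p-1}u ,\qquad t\ge 0,\ x\in\mathbb R,\quad p>1, \tag{1}$$ with $V$ real-valued, measurable in $(x,t)$, differentiable in $x$, and $$ \sup_{t\ge0,\,x}\langle x\rangle^{\sigma}|V(x,t)|\le K,\qquad \sup_{t\ge0,\,x}\langle x\rangle^{\sigma+1}|\partial_xV(x,t)|\le K,\qquad \langle x\rangle=(1+x^2)^{1/2}. $$ A solution means a distributional solution $u\in C([0,\infty);H^1(\mathbb R))$, with $u_0=u(0)$. Let $F:\mathbb R\to\mathbb R$ be smooth and nondecreasing, with $F=0$ on $(-\infty,a]$ and $F$ constant on $[b,\infty)$, where $0<a<b$. Write $F(|x|\ge t^\beta)=F(|x|/t^\beta)$, let $\gamma=\frac{1}{2i}(\operatorname{sgn}(x)\partial_x+\partial_x\operatorname{sgn}(x))$, $B(t)=F(|x|\ge t^\beta)\,\gamma\,F(|x|\ge t^\beta)$, and $\langle B\rangle_t=\langle Bu(t),u(t)\rangle_{L^2}$. Below, at time $s$, the functions $F$ and $F'$ are evaluated at $|x|/s^\beta$.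 Then there is a bounded measurable function $G:\mathbb R\to\mathbb R$, supported in $[a,b]$ and depending only on $F$, such that the following holds. (i) Let $0<\beta<1$ and $\beta(\sigma+1)>1$. There is a constant $C$ depending only on $F,\beta,\sigma,K$ such that for every $p>1$, every such $V$, every solution $u$ of (1), and all $0<t\le T$, $$\begin{aligned}\langle B(T)\rangle_T-\langle B(t)\rangle_t={}&\int_t^T\Big(4s^{-\beta}\big\|\gamma\sqrt{F'F}\,u(s)\big\|_{L^2}^2+2s^{-\beta}\,\frac{p-1}{p+1}\int F'F\,|u(s)|^{p+1}\,dx\Big)ds\\&+\int_t^T s^{-3\beta}\int G\big(|x|/s^\beta\big)|u(x,s)|^2\,dx\,ds+E,\end{aligned}$$ with $E$ real and $$|E|\le C\big(t^{1-\beta(\sigma+1)}+t^{\beta-1}\big)\|u_0\|_{L^2}^2 .$$ All the terms are well defined: for $s>0$ and $f=F u(s)$ or $f=\sqrt{F'F}\,u(s)$, both $f$ and $\operatorname{sgn}(x)f$ lie in $H^1$ (so $\gamma f\in L^2$), $F'F|u(s)|^{p+1}$ is integrable in $x$, and the time integrands are integrable on $[t,T]$. (ii) If $\sigma>2$, $\beta\in(1/3,1)$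 and $\sup_{t\ge0}\|u(t)\|_{H^1}<\infty$, then both positive terms $$ 2s^{-\beta}\big\|\gamma\sqrt{F'F}\,u(s)\big\|_{L^2}^2\qquad\text{and}\qquad s^{-\beta}\,\frac{p-1}{p+1}\int F'F\,|u(s)|^{p+1}\,dx $$ are integrable over $s\in[1,\infty)$. -/

import Mathlib

open MeasureTheory Filter Topology Set
open scoped ContDiff

noncomputable section

namespace NLSMorawetz

/-! ### Weak derivatives and the Sobolev space `H¹(ℝ)` -/

/-- Smooth compactly supported complex-valued test functions on the line. -/
def IsTest (φ : ℝ → ℂ) : Prop := ContDiff ℝ ∞ φ ∧ HasCompactSupport φ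

/-- `g` is a weak (distributional) derivative of `f`, both being locally integrable. -/
def HasWeakDeriv (f g : ℝ → ℂ) : Prop :=
  LocallyIntegrable f ∧ LocallyIntegrable g ∧
    ∀ φ : ℝ → ℂ, IsTest φ → ∫ x, f x * deriv φ x = -∫ x, g x * φ x

open Classical in
/-- The weak derivative `∂ₓ f`, determined up to null sets; `0` if there is none. -/
def weakDeriv (f : ℝ → ℂ) : ℝ → ℂ :=
  if h : ∃ g, HasWeakDeriv f g then h.choose else 0

theorem HasWeakDeriv.weakDeriv {f g : ℝ → ℂ} (h : HasWeakDeriv f g) :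
    HasWeakDeriv f (weakDeriv f) := by
  have h' : ∃ g, HasWeakDeriv f g := ⟨g, h⟩
  rw [NLSMorawetz.weakDeriv, dif_pos h']
  exact h'.choose_spec

theorem HasWeakDeriv.ae_unique {f g₁ g₂ : ℝ → ℂ} (h₁ : HasWeakDeriv f g₁)
    (h₂ : HasWeakDeriv f g₂) : g₁ =ᵐ[volume] g₂ := by
  refine ae_eq_of_integral_contDiff_smul_eq h₁.2.1 h₂.2.1 fun g hg hs => ?_
  have ht : IsTest fun x => (g x : ℂ) :=
    ⟨Complex.ofRealCLM.contDiff.comp hg, hs.comp_left Complex.ofReal_zero⟩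
  have e : -∫ x, g₁ x * (g x : ℂ) = -∫ x, g₂ x * (g x : ℂ) :=
    (h₁.2.2 _ ht).symm.trans (h₂.2.2 _ ht)
  simpa [Complex.real_smul, mul_comm] using e

/-- `f ∈ H¹(ℝ)`: `f` and its weak derivative are square integrable. -/
def MemH1 (f : ℝ → ℂ) : Prop :=
  MemLp f 2 ∧ ∃ g, HasWeakDeriv f g ∧ MemLp g 2

/-- `‖f‖²` in `L²(ℝ)`, for square integrable `f`. -/
def l2NormSq (f : ℝ → ℂ) : ℝ := ∫ x, ‖f x‖ ^ 2

/-- The norm of `H¹(ℝ)`, for `f ∈ H¹(ℝ)`. -/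
def h1Norm (f : ℝ → ℂ) : ℝ := √(l2NormSq f + l2NormSq (weakDeriv f))

/-! ### The equation `i ∂ₜ u = -∂ₓ² u + V(x,t) u + |u|^(p-1) u` -/

/-- The Japanese bracket `⟨x⟩ = (1 + x²)^(1/2)`. -/
def jBra (x : ℝ) : ℝ := √(1 + x ^ 2)

/-- A real time-dependent potential (written `V t x`), measurable in `(t, x)`, differentiable
in `x`, with `⟨x⟩^σ |V| ≤ K` and `⟨x⟩^(σ+1) |∂ₓ V| ≤ K` uniformly in time. -/
structure IsLocalizedPotential (σ K : ℝ) (V : ℝ → ℝ → ℝ) : Prop where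
  measurable : Measurable (Function.uncurry V)
  differentiable : ∀ t, 0 ≤ t → Differentiable ℝ (V t)
  bound : ∀ t, 0 ≤ t → ∀ x, jBra x ^ σ * |V t x| ≤ K
  deriv_bound : ∀ t, 0 ≤ t → ∀ x, jBra x ^ (σ + 1) * |deriv (V t) x| ≤ K

/-- Global energy-class solutions: `u ∈ C([0,∞); H¹(ℝ))`, and the equation holds
in the sense of distributions in `x`, integrated in time from the initial time `0`. -/
structure IsEnergySolution (p : ℝ) (V : ℝ → ℝ → ℝ) (u : ℝ → ℝ → ℂ) : Prop where
  memH1 : ∀ t, 0 ≤ t → MemH1 (u t)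
  continuous : ∀ t, 0 ≤ t →
    Tendsto (fun s => h1Norm fun x => u s x - u t x) (𝓝[Ici 0] t) (𝓝 0)
  equation : ∀ φ : ℝ → ℂ, IsTest φ → ∀ t, 0 ≤ t →
    Complex.I * ((∫ x, u t x * φ x) - ∫ x, u 0 x * φ x) =
      ∫ s in (0 : ℝ)..t,
        (-(∫ x, u s x * deriv (deriv φ) x) + (∫ x, (V s x : ℂ) * u s x * φ x)
          + ∫ x, ((‖u s x‖ ^ (p - 1) : ℝ) : ℂ) * u s x * φ x)

/-- The bounded energy hypothesis `sup_t ‖u(t)‖_{H¹} < ∞`. -/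
def HasBoundedEnergy (u : ℝ → ℝ → ℂ) : Prop := ∃ M, ∀ t, 0 ≤ t → h1Norm (u t) ≤ M

/-! ### Propagation observables -/

/-- The operator `γ = (sgn(x) ∂ₓ + ∂ₓ sgn(x)) / (2i)`. -/
def gammaOp (f : ℝ → ℂ) : ℝ → ℂ := fun x =>
  ((Real.sign x : ℂ) * weakDeriv f x + weakDeriv (fun y => (Real.sign y : ℂ) * f y) x)
    / (2 * Complex.I)

/-- The functions on which `γ` acts as an `L²`-valued operator: `f` and `sgn · f` lie in `H¹`. -/
def MemGammaDomain (f : ℝ → ℂ) : Prop :=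
  MemH1 f ∧ MemH1 fun y => (Real.sign y : ℂ) * f y

/-- A smooth exterior cutoff profile: nondecreasing, `0` on `(-∞, a]` and constant on `[b, ∞)`,
with `0 < a < b`. -/
structure IsExteriorCutoff (F : ℝ → ℝ) (a b : ℝ) : Prop where
  smooth : ContDiff ℝ ∞ F
  mono : Monotone F
  pos : 0 < a
  lt : a < b
  zero : ∀ y, y ≤ a → F y = 0
  const : ∀ y, b ≤ y → F y = F b

/-- Multiplication by `Φ(|x| / t^β)`; for a cutoff `Φ = F` this is `F(|x| ≥ t^β)`. -/
def mulCut (Φ : ℝ → ℝ) (β t : ℝ) (f : ℝ → ℂ) : ℝ → ℂ := fun x =>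
  (Φ (|x| / t ^ β) : ℂ) * f x

/-- The observable `B(t) = F(|x| ≥ t^β) γ F(|x| ≥ t^β)`. -/
def extMorawetz (F : ℝ → ℝ) (β t : ℝ) (f : ℝ → ℂ) : ℝ → ℂ :=
  mulCut F β t (gammaOp (mulCut F β t f))

/-- The expectation `⟨B⟩ = ⟨B f, f⟩` in `L²(ℝ)`. -/
def expectation (B : (ℝ → ℂ) → ℝ → ℂ) (f : ℝ → ℂ) : ℂ :=
  ∫ x, B f x * (starRingEnd ℂ) (f x)

/-- The profile `√(F' F)`. -/
def sqrtFF (F : ℝ → ℝ) : ℝ → ℝ := fun y => √(deriv F y * F y)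

/-- The linear Morawetz term `‖γ √(F'F) f‖²` at time `s`, with `F'F` evaluated at `|x| / s^β`. -/
def linTerm (F : ℝ → ℝ) (β s : ℝ) (f : ℝ → ℂ) : ℝ :=
  l2NormSq (gammaOp (mulCut (sqrtFF F) β s f))

/-- The density `F'F |f|^(p+1)` at time `s`, with `F'F` evaluated at `|x| / s^β`. -/
def nonlinDensity (F : ℝ → ℝ) (p β s : ℝ) (f : ℝ → ℂ) : ℝ → ℝ := fun x =>
  deriv F (|x| / s ^ β) * F (|x| / s ^ β) * ‖f x‖ ^ (p + 1)

/-- The nonlinear Morawetz term `∫ F'F |f|^(p+1) dx` at time `s`. -/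
def nonlinTerm (F : ℝ → ℝ) (p β s : ℝ) (f : ℝ → ℂ) : ℝ :=
  ∫ x, nonlinDensity F p β s f x

/-- The localized mass `⟨G(|x| / s^β)⟩ = ∫ G(|x| / s^β) |f|² dx` at time `s`. -/
def locMass (G : ℝ → ℝ) (β s : ℝ) (f : ℝ → ℂ) : ℝ :=
  ∫ x, G (|x| / s ^ β) * ‖f x‖ ^ 2

end NLSMorawetz

end

/-! Write `L = s ^ β`, `H = F'F` and `w(x) = sgn(x) F(|x|/L)²`. Since `γ` acts on the cut-off
function as `-i` times one ordinary derivative, and the zero-order part cancels by symmetry, the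
expectation of the observable is `Im ∫ w u_x ū` (`expectation_extMorawetz`). The theorem is then a
Morawetz (virial) computation with the moving vector field `w` (`Evolution.morawetz_law`), whose
rate has four parts (`IsEnergySolution.rate_eq`).

Kinetic part: `2⟨w_x u_x, u_x⟩ + Re⟨w_xx u_x, u⟩`. Completing the square by expanding `‖γ √H u‖²`
(`linTerm_eq`) turns it into `4 L⁻¹ ‖γ √H u‖²` plus a mass term of size `L⁻³` with profile `G = H''
- 4 ((√H)')²`. Here `√H` is only Lipschitz, but a nonnegative function with bounded second
derivative has `(H')² ≤ C H` (`sq_deriv_le_of_nonneg`), so `G` is bounded.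

Nonlinear part: integration by parts for `|u|^(p+1)` leaves the factor `1 - 2/(p+1) = (p-1)/(p+1)`.

Potential part: the terms with `V` combine to `-∫ w V_x |u|²`. On the support of `w` one has `|x| ≥
a s^β`, so this is `O(s^(-β(σ+1)))` times the conserved mass, and its integral is `O(t^(1-β(σ+1)))`.

Moving part: `Im⟨w_s u_x, u⟩` contains an uncontrolled derivative of `u`. It equals a mass flux:
`w_s = 2 Φ_x`, with `Φ` equal to `-β s^(β-1)` times the even extension of a primitive of `yF'F`. By
the local mass law (`Evolution.mass_law`) it is `d/ds ∫ Φ |u|²` minus `∫ Φ_s |u|²`, where `Φ =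
O(s^(β-1))` and `Φ_s = O(s^(β-2))`. Boundary terms and integral are both `O(t^(β-1))`, so the error
involves the `L²` norm alone.

Solutions have only `H¹` regularity, so both laws are proved for spatial mollifications of `u`,
which are smooth in `x` and Lipschitz in time, and then passed to the limit by `L²` convergence and
dominated convergence in time.

For part (ii) bounded energy bounds the expectations, `3β > 1` makes the mass term integrable, and
nonnegativity gives integrability of each positive term. -/

noncomputable section

namespace NLSMorawetz

/-! ### Convergence in `L²(ℝ)` -/

section L2

variable {ι : Type*} {l : Filter ι}

/-- `P i → Q` in `L²(ℝ)` along the filter `l`. -/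
structure L2Tendsto (l : Filter ι) (P : ι → ℝ → ℂ) (Q : ℝ → ℂ) : Prop where
  memLp : ∀ i, MemLp (P i) 2
  memLp_lim : MemLp Q 2
  tendsto : Tendsto (fun i => eLpNorm (fun x => P i x - Q x) 2) l (𝓝 0)

theorem L2Tendsto.const {Q : ℝ → ℂ} (hQ : MemLp Q 2) : L2Tendsto l (fun _ => Q) Q :=
  ⟨fun _ => hQ, hQ, by simpa using! tendsto_const_nhds⟩

theorem L2Tendsto.add {P P' : ι → ℝ → ℂ} {Q Q' : ℝ → ℂ} (h : L2Tendsto l P Q)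
    (h' : L2Tendsto l P' Q') :
    L2Tendsto l (fun i x => P i x + P' i x) (fun x => Q x + Q' x) where
  memLp i := (h.memLp i).add (h'.memLp i)
  memLp_lim := h.memLp_lim.add h'.memLp_lim
  tendsto := by
    have := h.tendsto.add h'.tendsto
    rw [add_zero] at this
    refine tendsto_of_tendsto_of_tendsto_of_le_of_le tendsto_const_nhds this
      (fun _ => zero_le) fun i => ?_
    refine le_trans (le_of_eq ?_) (eLpNorm_add_le (((h.memLp i).sub h.memLp_lim).1)
      (((h'.memLp i).sub h'.memLp_lim).1) (by norm_num))
    congr 1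
    ext x
    simp only [Pi.add_apply]
    ring

/-- Comparison principle through which `L²` convergence passes to images under Lipschitz maps, in
particular conjugation and the power nonlinearity on bounded sets. -/
theorem L2Tendsto.of_norm_le {P P' : ι → ℝ → ℂ} {Q Q' : ℝ → ℂ} (h : L2Tendsto l P Q)
    (hP' : ∀ i, AEStronglyMeasurable (P' i)) (hQ' : MemLp Q' 2) (C : ℝ)
    (hle : ∀ i, ∀ᵐ x, ‖P' i x - Q' x‖ ≤ C * ‖P i x - Q x‖) : L2Tendsto l P' Q' := by
  have h1 : ∀ i, MemLp (fun x => P' i x - Q' x) 2 := fun i =>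
    ((h.memLp i).sub h.memLp_lim).of_le_mul ((hP' i).sub hQ'.1) (hle i)
  refine ⟨fun i => ?_, hQ', ?_⟩
  · have := (h1 i).add hQ'
    refine (memLp_congr_ae (ae_of_all _ fun x => ?_)).1 this
    simp
  · have h2 : Tendsto (fun i => ENNReal.ofReal C * eLpNorm (fun x => P i x - Q x) 2) l (𝓝 0) := by
      have := ENNReal.Tendsto.const_mul (a := ENNReal.ofReal C) h.tendsto
        (Or.inr ENNReal.ofReal_ne_top)
      simpa using this
    exact tendsto_of_tendsto_of_tendsto_of_le_of_le tendsto_const_nhds h2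
      (fun _ => zero_le) fun i => eLpNorm_le_mul_eLpNorm_of_ae_le_mul (hle i) 2

theorem L2Tendsto.star {P : ι → ℝ → ℂ} {Q : ℝ → ℂ} (h : L2Tendsto l P Q) :
    L2Tendsto l (fun i x => (starRingEnd ℂ) (P i x)) (fun x => (starRingEnd ℂ) (Q x)) :=
  h.of_norm_le (fun i => Complex.continuous_conj.comp_aestronglyMeasurable (h.memLp i).1)
    h.memLp_lim.star 1 fun i => ae_of_all _ fun x => by
      rw [← map_sub, RCLike.norm_conj, one_mul]

theorem memLp_bdd_mul {m : ℝ → ℂ} {M : ℝ} {Q : ℝ → ℂ} (hQ : MemLp Q 2)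
    (hm : AEStronglyMeasurable m) (hM : ∀ x, ‖m x‖ ≤ M) : MemLp (fun x => m x * Q x) 2 :=
  hQ.of_le_mul (hm.mul hQ.1) (c := M) (ae_of_all _ fun x => by
    rw [norm_mul]; exact mul_le_mul_of_nonneg_right (hM x) (norm_nonneg _))

/-- The multipliers converge only pointwise, so the difference is split as `m i (P i - Q) + (m i -
m₀) Q`. The uniform bound handles the first summand, dominated convergence with majorant `2M|Q|` the
second. Countable generation of `l` reduces the latter to sequences. -/
theorem L2Tendsto.bdd_mul [l.IsCountablyGenerated] {P : ι → ℝ → ℂ} {Q : ℝ → ℂ}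
    (h : L2Tendsto l P Q) {m : ι → ℝ → ℂ} {m₀ : ℝ → ℂ} {M : ℝ}
    (hm : ∀ i, AEStronglyMeasurable (m i)) (hm0 : AEStronglyMeasurable m₀)
    (hM : ∀ i x, ‖m i x‖ ≤ M) (hM0 : ∀ x, ‖m₀ x‖ ≤ M)
    (hlim : ∀ᵐ x, Tendsto (fun i => m i x) l (𝓝 (m₀ x))) :
    L2Tendsto l (fun i x => m i x * P i x) (fun x => m₀ x * Q x) := by
  refine ⟨fun i => memLp_bdd_mul (h.memLp i) (hm i) (hM i), memLp_bdd_mul h.memLp_lim hm0 hM0, ?_⟩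
  have h1 : Tendsto (fun i => ENNReal.ofReal M * eLpNorm (fun x => P i x - Q x) 2) l (𝓝 0) := by
    have := ENNReal.Tendsto.const_mul (a := ENNReal.ofReal M) h.tendsto
      (Or.inr ENNReal.ofReal_ne_top)
    simpa using this
  have hmeas : ∀ i, AEStronglyMeasurable (fun x => (m i x - m₀ x) * Q x) := fun i =>
    ((hm i).sub hm0).mul h.memLp_lim.1
  have h2 : Tendsto (fun i => eLpNorm (fun x => (m i x - m₀ x) * Q x) 2) l (𝓝 0) := by
    have e : ∀ i, eLpNorm (fun x => (m i x - m₀ x) * Q x) 2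
        = (∫⁻ x, ‖(m i x - m₀ x) * Q x‖ₑ ^ (2:ℝ)) ^ (1 / 2 : ℝ) := fun i => by
      rw [eLpNorm_eq_lintegral_rpow_enorm_toReal (by norm_num) (by norm_num)]
      norm_num
    have h3 : Tendsto (fun i => ∫⁻ x, ‖(m i x - m₀ x) * Q x‖ₑ ^ (2:ℝ)) l (𝓝 (∫⁻ _x : ℝ, 0)) := by
      refine tendsto_of_seq_tendsto fun v hv => tendsto_lintegral_of_dominated_convergence'
        (fun x => (ENNReal.ofReal (2 * M) * ‖Q x‖ₑ) ^ (2:ℝ)) ?_ ?_ ?_ ?_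
      · exact fun i => ((hmeas (v i)).enorm.pow_const 2)
      · refine fun i => ae_of_all _ fun x => ?_
        refine ENNReal.rpow_le_rpow ?_ zero_le_two
        rw [enorm_mul]
        gcongr
        rw [← ofReal_norm]
        refine ENNReal.ofReal_le_ofReal ((norm_sub_le _ _).trans ?_)
        linarith [hM (v i) x, hM0 x]
      · have hQ := h.memLp_lim.2
        rw [eLpNorm_lt_top_iff_lintegral_rpow_enorm_lt_top (by norm_num) (by norm_num)] at hQ
        simp_rw [ENNReal.mul_rpow_of_nonneg _ _ (zero_le_two : (0:ℝ) ≤ 2)]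
        rw [lintegral_const_mul' _ _ (by finiteness)]
        exact ENNReal.mul_ne_top (by finiteness) (by simpa using hQ.ne)
      · filter_upwards [hlim] with x hx
        have h4 : Tendsto (fun i => ‖(m i x - m₀ x) * Q x‖) l (𝓝 0) := by
          have := ((hx.sub_const (m₀ x)).mul_const (Q x)).norm
          simpa using this
        have h5 : Tendsto (fun i => ‖(m i x - m₀ x) * Q x‖ₑ) l (𝓝 0) := by
          have := ENNReal.tendsto_ofReal h4
          simpa [ofReal_norm] using this
        have := (ENNReal.continuous_rpow_const (y := 2)).tendsto 0 |>.comp h5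
        exact (by simpa [Function.comp_def] using this :
            Tendsto (fun i => ‖(m i x - m₀ x) * Q x‖ₑ ^ (2:ℝ)) l (𝓝 0)).comp hv
    simp_rw [e]
    have := (ENNReal.continuous_rpow_const (y := 1/2)).tendsto _ |>.comp h3
    simpa [Function.comp_def] using this
  have := h1.add h2
  rw [add_zero] at this
  refine tendsto_of_tendsto_of_tendsto_of_le_of_le tendsto_const_nhds this
    (fun _ => zero_le) fun i => ?_
  have h6 : eLpNorm (fun x => m i x * (P i x - Q x)) 2
      ≤ ENNReal.ofReal M * eLpNorm (fun x => P i x - Q x) 2 :=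
    eLpNorm_le_mul_eLpNorm_of_ae_le_mul (ae_of_all _ fun x => by
      rw [norm_mul]; exact mul_le_mul_of_nonneg_right (hM i x) (norm_nonneg _)) 2
  refine le_trans (le_of_eq ?_) ((eLpNorm_add_le ((hm i).mul ((h.memLp i).sub h.memLp_lim).1)
      (hmeas i) (by norm_num)).trans (add_le_add_left h6 _))
  congr 1
  ext x
  simp only [Pi.add_apply, Pi.mul_apply, Pi.sub_apply]
  ring

/-- The norm of `L²(ℝ)`. -/
def l2n (f : ℝ → ℂ) : ℝ := (eLpNorm f 2).toReal

theorem l2n_nonneg (f : ℝ → ℂ) : 0 ≤ l2n f := ENNReal.toReal_nonneg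

theorem l2NormSq_eq {f : ℝ → ℂ} (hf : MemLp f 2) : l2NormSq f = l2n f ^ 2 := by
  have h0 : 0 ≤ ∫ x, ‖f x‖ ^ 2 := integral_nonneg fun x => by positivity
  rw [l2n, l2NormSq, hf.eLpNorm_eq_integral_rpow_norm (by norm_num) (by norm_num)]
  simp only [ENNReal.toReal_ofNat, Real.rpow_ofNat]
  rw [ENNReal.toReal_ofReal (by positivity), ← Real.rpow_natCast, ← Real.rpow_mul h0]
  norm_num

theorem integrable_mul_of_memLp {f g : ℝ → ℂ} (hf : MemLp f 2) (hg : MemLp g 2) :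
    Integrable (fun x => f x * g x) := by
  rw [← memLp_one_iff_integrable]
  exact MemLp.mul' hg hf

theorem integral_norm_mul_le {f g : ℝ → ℂ} (hf : MemLp f 2) (hg : MemLp g 2) :
    ∫ x, ‖f x * g x‖ ≤ l2n f * l2n g := by
  have h1 := eLpNorm_smul_le_mul_eLpNorm (p := 2) (q := 2) (r := 1) hg.1 hf.1
  rw [integral_norm_eq_lintegral_enorm (f := fun x => f x * g x) (hf.1.mul hg.1), ← eLpNorm_one_eq_lintegral_enorm, l2n, l2n,
    ← ENNReal.toReal_mul]
  exact ENNReal.toReal_mono (ENNReal.mul_ne_top hf.2.ne hg.2.ne) h1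

theorem integrable_bdd_mul_mul {m f g : ℝ → ℂ} {M : ℝ} (hf : MemLp f 2) (hg : MemLp g 2)
    (hm : AEStronglyMeasurable m) (hM : ∀ x, ‖m x‖ ≤ M) :
    Integrable (fun x => m x * f x * g x) :=
  integrable_mul_of_memLp (memLp_bdd_mul hf hm hM) hg

theorem integral_norm_bdd_mul_mul_le {m f g : ℝ → ℂ} {M : ℝ} (hf : MemLp f 2) (hg : MemLp g 2)
    (hm : AEStronglyMeasurable m) (hM : ∀ x, ‖m x‖ ≤ M) :
    ∫ x, ‖m x * f x * g x‖ ≤ M * (l2n f * l2n g) := by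
  calc ∫ x, ‖m x * f x * g x‖ ≤ ∫ x, M * ‖f x * g x‖ := by
        refine integral_mono (integrable_bdd_mul_mul hf hg hm hM).norm
          ((integrable_mul_of_memLp hf hg).norm.const_mul M) fun x => ?_
        simp only [mul_assoc, norm_mul (m x)]
        exact mul_le_mul_of_nonneg_right (hM x) (norm_nonneg _)
    _ ≤ _ := by
        rw [integral_const_mul]
        exact mul_le_mul_of_nonneg_left (integral_norm_mul_le hf hg)
          ((norm_nonneg _).trans (hM 0))

theorem norm_integral_bdd_mul_mul_le {m f g : ℝ → ℂ} {M : ℝ} (hf : MemLp f 2) (hg : MemLp g 2)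
    (hm : AEStronglyMeasurable m) (hM : ∀ x, ‖m x‖ ≤ M) :
    ‖∫ x, m x * f x * g x‖ ≤ M * (l2n f * l2n g) :=
  (norm_integral_le_integral_norm _).trans (integral_norm_bdd_mul_mul_le hf hg hm hM)

theorem L2Tendsto.tendsto_l2n {P : ι → ℝ → ℂ} {Q : ℝ → ℂ} (h : L2Tendsto l P Q) :
    Tendsto (fun i => l2n (P i)) l (𝓝 (l2n Q)) := by
  have h1 : Tendsto (fun i => l2n (fun x => P i x - Q x)) l (𝓝 0) := by
    have := (ENNReal.tendsto_toReal ENNReal.zero_ne_top).comp h.tendsto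
    simpa [Function.comp_def, l2n] using this
  rw [tendsto_iff_norm_sub_tendsto_zero]
  refine squeeze_zero (fun _ => norm_nonneg _) (fun i => ?_) h1
  have hd := (h.memLp i).sub h.memLp_lim
  rw [Real.norm_eq_abs, abs_le]
  have key : ∀ f g : ℝ → ℂ, MemLp f 2 → MemLp g 2 → l2n (f + g) ≤ l2n f + l2n g := by
    intro f g hf hg
    rw [l2n, l2n, l2n, ← ENNReal.toReal_add hf.2.ne hg.2.ne]
    exact ENNReal.toReal_mono (by simp [hf.2.ne, hg.2.ne]) (eLpNorm_add_le hf.1 hg.1 (by norm_num))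
  have a1 := key _ _ hd h.memLp_lim
  have a2 := key _ _ hd.neg (h.memLp i)
  have e1 : P i - Q + Q = P i := by simp
  have e2 : -(P i - Q) + P i = Q := by simp
  have e3 : l2n (-(P i - Q)) = l2n (P i - Q) := by rw [l2n, l2n, eLpNorm_neg]
  rw [e1] at a1
  rw [e2, e3] at a2
  change -l2n (P i - Q) ≤ _ ∧ _ ≤ l2n (P i - Q)
  constructor <;> linarith

theorem L2Tendsto.tendsto_integral_mul {P P' : ι → ℝ → ℂ} {Q Q' : ℝ → ℂ} (h : L2Tendsto l P Q)
    (h' : L2Tendsto l P' Q') :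
    Tendsto (fun i => ∫ x, P i x * P' i x) l (𝓝 (∫ x, Q x * Q' x)) := by
  have h1 : Tendsto (fun i => l2n (fun x => P i x - Q x)) l (𝓝 0) := by
    have := (ENNReal.tendsto_toReal ENNReal.zero_ne_top).comp h.tendsto
    simpa [Function.comp_def, l2n] using this
  have h1' : Tendsto (fun i => l2n (fun x => P' i x - Q' x)) l (𝓝 0) := by
    have := (ENNReal.tendsto_toReal ENNReal.zero_ne_top).comp h'.tendsto
    simpa [Function.comp_def, l2n] using this
  rw [tendsto_iff_norm_sub_tendsto_zero]
  have h2 := ((h1.mul h'.tendsto_l2n).add (h1'.const_mul (l2n Q)))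
  rw [zero_mul, mul_zero, add_zero] at h2
  refine squeeze_zero (fun _ => norm_nonneg _) (fun i => ?_) h2
  have i1 := (h.memLp i).sub h.memLp_lim
  have i2 := (h'.memLp i).sub h'.memLp_lim
  have e : (∫ x, P i x * P' i x) - ∫ x, Q x * Q' x
      = (∫ x, (P i - Q) x * P' i x) + ∫ x, Q x * (P' i - Q') x := by
    rw [← integral_sub (integrable_mul_of_memLp (h.memLp i) (h'.memLp i))
      (integrable_mul_of_memLp h.memLp_lim h'.memLp_lim),
      ← integral_add (integrable_mul_of_memLp i1 (h'.memLp i))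
      (integrable_mul_of_memLp h.memLp_lim i2)]
    congr 1
    ext x
    simp only [Pi.sub_apply]
    ring
  rw [e]
  refine (norm_add_le _ _).trans (add_le_add ?_ ?_)
  · exact (norm_integral_le_integral_norm _).trans (integral_norm_mul_le i1 (h'.memLp i))
  · exact (norm_integral_le_integral_norm _).trans (integral_norm_mul_le h.memLp_lim i2)

end L2

/-! ### Mollification -/

theorem IsTest.deriv {k : ℝ → ℂ} (hk : IsTest k) : IsTest (deriv k) :=
  ⟨hk.1.deriv', hk.2.deriv⟩

theorem IsTest.comp_sub {k : ℝ → ℂ} (hk : IsTest k) (x : ℝ) : IsTest fun y => k (x - y) :=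
  ⟨hk.1.comp (contDiff_const.sub contDiff_id), hk.2.comp_homeomorph (Homeomorph.subLeft x)⟩

theorem IsTest.continuous {k : ℝ → ℂ} (hk : IsTest k) : Continuous k := hk.1.continuous

theorem IsTest.hasDerivAt {k : ℝ → ℂ} (hk : IsTest k) (x : ℝ) :
    HasDerivAt k (_root_.deriv k x) x :=
  (hk.1.differentiable (by simp) x).hasDerivAt

theorem IsTest.integrable {k : ℝ → ℂ} (hk : IsTest k) : Integrable k :=
  hk.continuous.integrable_of_hasCompactSupport hk.2

theorem IsTest.memLp {k : ℝ → ℂ} (hk : IsTest k) : MemLp k 2 :=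
  hk.continuous.memLp_of_hasCompactSupport hk.2

theorem deriv_comp_const_sub' (k : ℝ → ℂ) (x : ℝ) :
    deriv (fun y => k (x - y)) = fun y => -deriv k (x - y) := by
  ext y
  rw [deriv_comp_const_sub]

theorem MemLp.locallyIntegrable_two {f : ℝ → ℂ} (hf : MemLp f 2) : LocallyIntegrable f :=
  hf.locallyIntegrable (by norm_num)

/-- The convolution of `f` with the kernel `k`. -/
def mol (k f : ℝ → ℂ) (x : ℝ) : ℂ := ∫ y, f y * k (x - y)

theorem mol_eq_convolution (k f : ℝ → ℂ) :
    mol k f = convolution f k (ContinuousLinearMap.mul ℝ ℂ) volume := rfl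

theorem hasDerivAt_mol {k f : ℝ → ℂ} (hk : IsTest k) (hf : LocallyIntegrable f) (x : ℝ) :
    HasDerivAt (mol k f) (mol (deriv k) f x) x := by
  rw [mol_eq_convolution, mol_eq_convolution]
  exact hk.2.hasDerivAt_convolution_right _ hf (hk.1.of_le (by simp)) x

theorem continuous_mol {k f : ℝ → ℂ} (hk : IsTest k) (hf : LocallyIntegrable f) :
    Continuous (mol k f) :=
  continuous_iff_continuousAt.2 fun x => (hasDerivAt_mol hk hf x).continuousAt

/-- The weak derivative is tested against `y ↦ k (x - y)`; the sign from the reflection cancels the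
sign in the definition. -/
theorem mol_deriv {k f g : ℝ → ℂ} (hk : IsTest k) (h : HasWeakDeriv f g) :
    mol (deriv k) f = mol k g := by
  ext x
  have := h.2.2 _ (hk.comp_sub x)
  rw [deriv_comp_const_sub'] at this
  simp only [mul_neg, integral_neg, neg_inj] at this
  exact this

/-- Young's inequality. -/
theorem eLpNorm_mol_le {k f : ℝ → ℂ} (hk : IsTest k) (hf : MemLp f 2) :
    eLpNorm (mol k f) 2 ≤ (∫⁻ x, ‖k x‖ₑ) * eLpNorm f 2 := by
  have e : ∀ g : ℝ → ℂ, eLpNorm g 2 = (∫⁻ x, ‖g x‖ₑ ^ (2:ℝ)) ^ (1 / 2 : ℝ) := fun g => by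
    rw [eLpNorm_eq_lintegral_rpow_enorm_toReal (by norm_num) (by norm_num)]
    norm_num
  have hkm : Measurable fun x => ‖k x‖ₑ := hk.continuous.measurable.enorm
  have hfm : AEMeasurable (fun x => ‖f x‖ₑ) := hf.1.enorm
  have hkI : ∀ x, ∫⁻ y, ‖k (x - y)‖ₑ = ∫⁻ y, ‖k y‖ₑ := fun x =>
    lintegral_sub_left_eq_self (fun y => ‖k y‖ₑ) x
  have hkx : ∀ x, Measurable fun y => ‖k (x - y)‖ₑ := fun x =>
    hkm.comp (measurable_const.sub measurable_id)
  have pt : ∀ x, ‖mol k f x‖ₑ ^ (2:ℝ)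
      ≤ (∫⁻ y, ‖k y‖ₑ) * ∫⁻ y, ‖k (x - y)‖ₑ * ‖f y‖ₑ ^ (2:ℝ) := by
    intro x
    -- Splitting the kernel into two square roots lets Cauchy–Schwarz produce one factor `∫|k|`;
    -- Tonelli supplies the second.
    have h1 : ‖mol k f x‖ₑ ≤ ∫⁻ y, ‖k (x - y)‖ₑ ^ (1/2:ℝ) * (‖k (x - y)‖ₑ ^ (1/2:ℝ) * ‖f y‖ₑ) := by
      refine (enorm_integral_le_lintegral_enorm _).trans (le_of_eq (lintegral_congr fun y => ?_))
      rw [enorm_mul, ← mul_assoc, ← ENNReal.rpow_add_of_nonneg _ _ (by norm_num) (by norm_num)]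
      norm_num [mul_comm]
    have h2 := ENNReal.lintegral_mul_le_Lp_mul_Lq volume (Real.HolderConjugate.two_two)
      ((hkx x).pow_const (1/2:ℝ)).aemeasurable
      (((hkx x).pow_const (1/2:ℝ)).aemeasurable.mul hfm)
    simp only [Pi.mul_apply] at h2
    have h3 := ENNReal.rpow_le_rpow (h1.trans h2) (zero_le_two : (0:ℝ) ≤ 2)
    refine h3.trans (le_of_eq ?_)
    rw [ENNReal.mul_rpow_of_nonneg _ _ zero_le_two, ← ENNReal.rpow_mul, ← ENNReal.rpow_mul]
    simp_rw [ENNReal.mul_rpow_of_nonneg _ _ (zero_le_two : (0:ℝ) ≤ 2), ← ENNReal.rpow_mul]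
    norm_num
    rw [hkI]
  rw [e, e]
  have h4 : ∫⁻ x, ‖mol k f x‖ₑ ^ (2:ℝ) ≤ (∫⁻ y, ‖k y‖ₑ) ^ (2:ℝ) * ∫⁻ y, ‖f y‖ₑ ^ (2:ℝ) := by
    calc _ ≤ ∫⁻ x, (∫⁻ y, ‖k y‖ₑ) * ∫⁻ y, ‖k (x - y)‖ₑ * ‖f y‖ₑ ^ (2:ℝ) := lintegral_mono pt
      _ = (∫⁻ y, ‖k y‖ₑ) * ∫⁻ x, ∫⁻ y, ‖k (x - y)‖ₑ * ‖f y‖ₑ ^ (2:ℝ) := by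
          rw [lintegral_const_mul' _ _ hk.integrable.2.ne]
      _ = (∫⁻ y, ‖k y‖ₑ) * ∫⁻ y, ∫⁻ x, ‖k (x - y)‖ₑ * ‖f y‖ₑ ^ (2:ℝ) := by
          rw [lintegral_lintegral_swap]
          refine AEMeasurable.mul ?_ ?_
          · exact (hkm.comp (measurable_fst.sub measurable_snd)).aemeasurable
          · exact (hfm.pow_const 2).comp_snd
      _ = (∫⁻ y, ‖k y‖ₑ) * ∫⁻ y, (∫⁻ x, ‖k x‖ₑ) * ‖f y‖ₑ ^ (2:ℝ) := by
          congr 1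
          refine lintegral_congr fun y => ?_
          have hm : Measurable fun x => ‖k (x - y)‖ₑ := hkm.comp (measurable_id.sub_const y)
          rw [lintegral_mul_const _ hm]
          congr 1
          exact lintegral_sub_right_eq_self (fun y => ‖k y‖ₑ) y
      _ = _ := by
          rw [lintegral_const_mul' _ _ hk.integrable.2.ne, ← mul_assoc]
          congr 1
          rw [ENNReal.rpow_two, sq]
  refine (ENNReal.rpow_le_rpow h4 (by norm_num : (0:ℝ) ≤ 1/2)).trans (le_of_eq ?_)
  rw [ENNReal.mul_rpow_of_nonneg _ _ (by norm_num), ← ENNReal.rpow_mul]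
  norm_num

theorem memLp_mol {k f : ℝ → ℂ} (hk : IsTest k) (hf : MemLp f 2) : MemLp (mol k f) 2 :=
  ⟨(continuous_mol hk (MemLp.locallyIntegrable_two hf)).aestronglyMeasurable,
    (eLpNorm_mol_le hk hf).trans_lt (ENNReal.mul_lt_top hk.integrable.2 hf.2)⟩

theorem l2n_mol_le {k f : ℝ → ℂ} (hk : IsTest k) (hf : MemLp f 2) :
    l2n (mol k f) ≤ (∫⁻ x, ‖k x‖ₑ).toReal * l2n f := by
  rw [l2n, l2n, ← ENNReal.toReal_mul]
  exact ENNReal.toReal_mono (ENNReal.mul_ne_top hk.integrable.2.ne hf.2.ne) (eLpNorm_mol_le hk hf)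

/-- Bump functions of radius `2 / (n + 1)`. -/
def bump (n : ℕ) : ContDiffBump (0 : ℝ) where
  rIn := 1 / (n + 1)
  rOut := 2 / (n + 1)
  rIn_pos := by positivity
  rIn_lt_rOut := by gcongr; norm_num

/-- A sequence of mollifying kernels. -/
def rho (n : ℕ) : ℝ → ℂ := fun x => ((bump n).normed volume x : ℂ)

theorem isTest_rho (n : ℕ) : IsTest (rho n) :=
  ⟨Complex.ofRealCLM.contDiff.comp (bump n).contDiff_normed,
    (bump n).hasCompactSupport_normed.comp_left Complex.ofReal_zero⟩

theorem lintegral_enorm_rho (n : ℕ) : ∫⁻ x, ‖rho n x‖ₑ = 1 := by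
  have h1 : ∀ x, ‖rho n x‖ₑ = ENNReal.ofReal ((bump n).normed volume x) := fun x => by
    rw [rho, ← ofReal_norm, Complex.norm_real, Real.norm_of_nonneg ((bump n).nonneg_normed x)]
  simp_rw [h1]
  rw [← ofReal_integral_eq_lintegral_ofReal (bump n).integrable_normed
    (ae_of_all _ fun x => (bump n).nonneg_normed x), (bump n).integral_normed, ENNReal.ofReal_one]

theorem eLpNorm_mol_rho_le {f : ℝ → ℂ} (hf : MemLp f 2) (n : ℕ) :
    eLpNorm (mol (rho n) f) 2 ≤ eLpNorm f 2 := by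
  simpa [lintegral_enorm_rho] using eLpNorm_mol_le (isTest_rho n) hf

theorem l2n_mol_rho_le {f : ℝ → ℂ} (hf : MemLp f 2) (n : ℕ) :
    l2n (mol (rho n) f) ≤ l2n f :=
  ENNReal.toReal_mono hf.2.ne (eLpNorm_mol_rho_le hf n)

theorem mol_rho_eq (f : ℝ → ℂ) (n : ℕ) :
    mol (rho n) f = convolution ((bump n).normed volume) f (ContinuousLinearMap.lsmul ℝ ℝ) volume := by
  ext x
  rw [convolution_eq_swap, mol]
  refine integral_congr_ae (ae_of_all _ fun y => ?_)
  simp [rho, mul_comm]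

theorem ae_tendsto_mol_rho {f : ℝ → ℂ} (hf : LocallyIntegrable f) :
    ∀ᵐ x, Tendsto (fun n => mol (rho n) f x) atTop (𝓝 (f x)) := by
  simp_rw [mol_rho_eq]
  -- The value 2 is the ratio of the outer to the inner radius of `bump n`, constant in `n`.
  refine ContDiffBump.ae_convolution_tendsto_right_of_locallyIntegrable (K := 2) ?_ ?_ hf
  · have := tendsto_one_div_add_atTop_nhds_zero_nat (𝕜 := ℝ) |>.const_mul 2
    rw [mul_zero] at this
    refine this.congr fun n => ?_
    simp [bump, div_eq_mul_inv]
  · refine Eventually.of_forall fun n => le_of_eq ?_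
    simp [bump, div_eq_mul_inv]

/-- Almost everywhere convergence and a bound on the norms give convergence in `L²`. -/
theorem L2Tendsto.of_ae_of_le {P : ℕ → ℝ → ℂ} {Q : ℝ → ℂ} (hP : ∀ n, MemLp (P n) 2)
    (hQ : MemLp Q 2) (hae : ∀ᵐ x, Tendsto (fun n => P n x) atTop (𝓝 (Q x)))
    (hle : ∀ n, eLpNorm (P n) 2 ≤ eLpNorm Q 2) : L2Tendsto atTop P Q := by
  have e : ∀ g : ℝ → ℂ, eLpNorm g 2 = (∫⁻ x, ‖g x‖ₑ ^ (2:ℝ)) ^ (1 / 2 : ℝ) := fun g => by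
    rw [eLpNorm_eq_lintegral_rpow_enorm_toReal (by norm_num) (by norm_num)]
    norm_num
  refine ⟨hP, hQ, ?_⟩
  set I : (ℝ → ℂ) → ENNReal := fun g => ∫⁻ x, ‖g x‖ₑ ^ (2:ℝ) with hI
  have hfin : ∀ g : ℝ → ℂ, MemLp g 2 → I g ≠ ⊤ := fun g hg => by
    have := hg.2
    rw [eLpNorm_lt_top_iff_lintegral_rpow_enorm_lt_top (by norm_num) (by norm_num)] at this
    simpa [hI] using this.ne
  have hle' : ∀ n, I (P n) ≤ I Q := fun n => by
    have := hle n
    rw [e, e] at this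
    exact (ENNReal.rpow_le_rpow_iff (by norm_num)).1 this
  -- The parallelogram law bounds `‖P n - Q‖²` by `4‖Q‖² - ‖P n + Q‖²`, and Fatou applied to `P n +
  -- Q → 2Q` makes the right side tend to zero. No dominating function is needed.
  have par : ∀ n, I (fun x => P n x - Q x) + I (fun x => P n x + Q x)
      = 2 * I (P n) + 2 * I Q := by
    intro n
    have m1 : AEMeasurable fun x => ‖P n x - Q x‖ₑ ^ (2:ℝ) := ((hP n).1.sub hQ.1).enorm.pow_const (2:ℝ)
    have m2 := ((hP n).1).enorm.pow_const (2:ℝ)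
    simp only [hI]
    rw [← lintegral_add_left' m1, ← lintegral_const_mul' _ _ (by simp),
      ← lintegral_const_mul' _ _ (by simp), ← lintegral_add_left' (m2.const_mul 2)]
    refine lintegral_congr fun x => ?_
    have h2 : ∀ z : ℂ, ‖z‖ₑ ^ (2:ℝ) = ENNReal.ofReal (‖z‖ ^ 2) := fun z => by
      rw [← ofReal_norm, ENNReal.rpow_two, ENNReal.ofReal_pow (norm_nonneg _)]
    rw [h2, h2, h2, h2, ← ENNReal.ofReal_add (by positivity) (by positivity)]
    have h3 : (2 : ENNReal) = ENNReal.ofReal 2 := by simp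
    rw [h3, ← ENNReal.ofReal_mul (by norm_num), ← ENNReal.ofReal_mul (by norm_num),
      ← ENNReal.ofReal_add (by positivity) (by positivity)]
    congr 1
    have := parallelogram_law_with_norm ℝ (P n x) (Q x)
    linarith
  have fatou : 4 * I Q ≤ liminf (fun n => I (fun x => P n x + Q x)) atTop := by
    have h1 := lintegral_liminf_le' (μ := volume) (u := atTop) (f := fun n x => ‖P n x + Q x‖ₑ ^ (2:ℝ))
      fun n => ((hP n).1.add hQ.1).enorm.pow_const (2:ℝ)
    refine le_trans (le_of_eq ?_) h1
    simp only [hI]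
    rw [← lintegral_const_mul' _ _ (by simp)]
    refine lintegral_congr_ae ?_
    filter_upwards [hae] with x hx
    have h2 : Tendsto (fun n => ‖P n x + Q x‖ₑ ^ (2:ℝ)) atTop (𝓝 (‖Q x + Q x‖ₑ ^ (2:ℝ))) :=
      (ENNReal.continuous_rpow_const.tendsto _).comp
        ((continuous_enorm.tendsto _).comp (hx.add_const (Q x)))
    rw [h2.liminf_eq, ← two_mul, enorm_mul, ENNReal.mul_rpow_of_nonneg _ _ zero_le_two]
    congr 1
    rw [← ofReal_norm]
    norm_num
  have hb : ∀ n, I (fun x => P n x - Q x) ≤ 4 * I Q - I (fun x => P n x + Q x) := by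
    intro n
    refine ENNReal.le_sub_of_add_le_right (hfin _ ((hP n).add hQ)) ?_
    rw [par n]
    calc 2 * I (P n) + 2 * I Q ≤ 2 * I Q + 2 * I Q := by gcongr; exact hle' n
      _ = 4 * I Q := by ring
  have hlim : Tendsto (fun n => I (fun x => P n x - Q x)) atTop (𝓝 0) := by
    rw [ENNReal.tendsto_nhds_zero]
    intro ε hε
    have hI4 : 4 * I Q ≠ ⊤ := ENNReal.mul_ne_top (by simp) (hfin _ hQ)
    by_cases h0 : 4 * I Q = 0
    · exact Eventually.of_forall fun n => (hb n).trans (by simp [h0])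
    have : 4 * I Q - ε < liminf (fun n => I (fun x => P n x + Q x)) atTop :=
      (ENNReal.sub_lt_self hI4 h0 hε.ne').trans_le fatou
    filter_upwards [eventually_lt_of_lt_liminf this] with n hn
    refine (hb n).trans ?_
    rw [tsub_le_iff_left]
    exact tsub_le_iff_right.1 hn.le
  simp_rw [e]
  have := (ENNReal.continuous_rpow_const (y := 1/2)).tendsto _ |>.comp hlim
  simpa [Function.comp_def, hI] using this

theorem l2Tendsto_mol_rho {f : ℝ → ℂ} (hf : MemLp f 2) :
    L2Tendsto atTop (fun n => mol (rho n) f) f :=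
  L2Tendsto.of_ae_of_le (fun n => memLp_mol (isTest_rho n) hf) hf
    (ae_tendsto_mol_rho (MemLp.locallyIntegrable_two hf)) (eLpNorm_mol_rho_le hf)

/-! ### Calculus in `H¹(ℝ)` -/

/-- `u ∈ H¹(ℝ)` with weak derivative `ux`. -/
structure IsH1 (u ux : ℝ → ℂ) : Prop where
  weak : HasWeakDeriv u ux
  memLp : MemLp u 2
  memLp' : MemLp ux 2

theorem IsH1.memH1 {u ux : ℝ → ℂ} (h : IsH1 u ux) : MemH1 u := ⟨h.memLp, ux, h.weak, h.memLp'⟩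

theorem IsH1.weakDeriv_ae {u ux : ℝ → ℂ} (h : IsH1 u ux) : weakDeriv u =ᵐ[volume] ux :=
  h.weak.weakDeriv.ae_unique h.weak

theorem MemH1.isH1 {u : ℝ → ℂ} (h : MemH1 u) : IsH1 u (weakDeriv u) := by
  obtain ⟨h1, g, h2, h3⟩ := h
  exact ⟨h2.weakDeriv, h1, (memLp_congr_ae (h2.weakDeriv.ae_unique h2)).2 h3⟩

theorem IsH1.hasDerivAt_mol {u ux : ℝ → ℂ} (h : IsH1 u ux) {k : ℝ → ℂ} (hk : IsTest k) (x : ℝ) :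
    HasDerivAt (mol k u) (mol k ux x) x := by
  rw [← mol_deriv hk h.weak]
  exact NLSMorawetz.hasDerivAt_mol hk h.weak.1 x

theorem aestronglyMeasurable_of_hasDerivAt {m m' : ℝ → ℂ} (hm : ∀ x, HasDerivAt m (m' x) x) :
    AEStronglyMeasurable m' := by
  have : m' = deriv m := funext fun x => (hm x).deriv.symm
  rw [this]
  exact (measurable_deriv m).aestronglyMeasurable

theorem aestronglyMeasurable_of_hasDerivAt' {m m' : ℝ → ℂ} (hm : ∀ x, HasDerivAt m (m' x) x) :
    AEStronglyMeasurable m :=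
  (continuous_iff_continuousAt.2 fun x => (hm x).continuousAt).aestronglyMeasurable

/-- Integration by parts in `H¹(ℝ)` against a bounded multiplier with bounded derivative. -/
theorem IsH1.integral_by_parts {u ux v vx : ℝ → ℂ} (hu : IsH1 u ux) (hv : IsH1 v vx)
    {m m' : ℝ → ℂ} {M : ℝ} (hm : ∀ x, HasDerivAt m (m' x) x) (hM : ∀ x, ‖m x‖ ≤ M)
    (hM' : ∀ x, ‖m' x‖ ≤ M) :
    (∫ x, m' x * u x * v x) + (∫ x, m x * ux x * v x) + ∫ x, m x * u x * vx x = 0 := by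
  have mm := aestronglyMeasurable_of_hasDerivAt' hm
  have mm' := aestronglyMeasurable_of_hasDerivAt hm
  set U := fun n => mol (rho n) u
  set Ux := fun n => mol (rho n) ux
  set W := fun n => mol (rho n) v
  set Wx := fun n => mol (rho n) vx
  have hU : L2Tendsto atTop U u := l2Tendsto_mol_rho hu.memLp
  have hUx : L2Tendsto atTop Ux ux := l2Tendsto_mol_rho hu.memLp'
  have hW : L2Tendsto atTop W v := l2Tendsto_mol_rho hv.memLp
  have hWx : L2Tendsto atTop Wx vx := l2Tendsto_mol_rho hv.memLp'
  have lim : ∀ {P : ℕ → ℝ → ℂ} {Q : ℝ → ℂ} {c : ℝ → ℂ}, L2Tendsto atTop P Q →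
      AEStronglyMeasurable c → (∀ x, ‖c x‖ ≤ M) →
      L2Tendsto atTop (fun n x => c x * P n x) (fun x => c x * Q x) := fun hP hc hcM =>
    hP.bdd_mul (fun _ => hc) hc (fun _ => hcM) hcM (ae_of_all _ fun _ => tendsto_const_nhds)
  have l1 := (((lim hU mm' hM').tendsto_integral_mul hW).add
    ((lim hUx mm hM).tendsto_integral_mul hW)).add ((lim hU mm hM).tendsto_integral_mul hWx)
  -- For the mollified functions the sum is the integral of the derivative of the integrable product
  -- `m U W`, hence zero for every `n`.
  refine tendsto_nhds_unique l1 (tendsto_const_nhds.congr fun n => ?_)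
  have i1 := integrable_bdd_mul_mul (hU.memLp n) (hW.memLp n) mm' hM'
  have i2 := integrable_bdd_mul_mul (hUx.memLp n) (hW.memLp n) mm hM
  have i3 := integrable_bdd_mul_mul (hU.memLp n) (hWx.memLp n) mm hM
  have i0 := integrable_bdd_mul_mul (hU.memLp n) (hW.memLp n) mm hM
  have i12 : Integrable fun x => m' x * U n x * W n x + m x * Ux n x * W n x := i1.add i2
  rw [← integral_add i1 i2, ← integral_add i12 i3]
  refine (integral_eq_zero_of_hasDerivAt_of_integrable (fun x => ?_) (i12.add i3) i0).symm
  have := ((hm x).mul (hu.hasDerivAt_mol (isTest_rho n) x)).mul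
    (hv.hasDerivAt_mol (isTest_rho n) x)
  refine this.congr_deriv ?_
  simp only [Pi.add_apply, Pi.mul_apply]
  ring

theorem IsH1.of_hasDerivAt {g g' : ℝ → ℂ} (hg : ∀ x, HasDerivAt g (g' x) x) (h : MemLp g 2)
    (h' : MemLp g' 2) : IsH1 g g' := by
  refine ⟨⟨MemLp.locallyIntegrable_two h, MemLp.locallyIntegrable_two h', fun φ hφ => ?_⟩, h, h'⟩
  exact integral_mul_deriv_eq_deriv_mul_of_integrable (fun x _ => hg x)
    (fun x _ => hφ.hasDerivAt x) (integrable_mul_of_memLp h hφ.deriv.memLp)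
    (integrable_mul_of_memLp h' hφ.memLp) (integrable_mul_of_memLp h hφ.memLp)

theorem IsTest.isH1 {φ : ℝ → ℂ} (hφ : IsTest φ) : IsH1 φ (_root_.deriv φ) :=
  IsH1.of_hasDerivAt hφ.hasDerivAt hφ.memLp hφ.deriv.memLp

theorem MemLp.conj {f : ℝ → ℂ} (hf : MemLp f 2) : MemLp (fun x => (starRingEnd ℂ) (f x)) 2 :=
  hf.star

theorem IsTest.conj {φ : ℝ → ℂ} (hφ : IsTest φ) : IsTest fun x => (starRingEnd ℂ) (φ x) :=
  ⟨Complex.conjCLE.contDiff.comp hφ.1, hφ.2.comp_left (map_zero _)⟩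

theorem hasDerivAt_conj {f : ℝ → ℂ} {f' : ℂ} {x : ℝ} (h : HasDerivAt f f' x) :
    HasDerivAt (fun x => (starRingEnd ℂ) (f x)) ((starRingEnd ℂ) f') x :=
  h.star

theorem IsH1.conj {u ux : ℝ → ℂ} (h : IsH1 u ux) :
    IsH1 (fun x => (starRingEnd ℂ) (u x)) (fun x => (starRingEnd ℂ) (ux x)) := by
  have h1 := MemLp.conj h.memLp
  have h2 := MemLp.conj h.memLp'
  refine ⟨⟨MemLp.locallyIntegrable_two h1, MemLp.locallyIntegrable_two h2, fun φ hφ => ?_⟩, h1, h2⟩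
  have e := congrArg (starRingEnd ℂ) (h.weak.2.2 _ hφ.conj)
  rw [map_neg, ← integral_conj, ← integral_conj] at e
  simp only [map_mul, Complex.conj_conj] at e
  rw [← e]
  refine integral_congr_ae (ae_of_all _ fun x => ?_)
  simp only
  rw [(hasDerivAt_conj (hφ.hasDerivAt x)).deriv, Complex.conj_conj]

theorem IsH1.sub {u ux v vx : ℝ → ℂ} (h : IsH1 u ux) (h' : IsH1 v vx) :
    IsH1 (fun x => u x - v x) (fun x => ux x - vx x) := by
  have h1 := h.memLp.sub h'.memLp
  have h2 := h.memLp'.sub h'.memLp'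
  refine ⟨⟨MemLp.locallyIntegrable_two h1, MemLp.locallyIntegrable_two h2, fun φ hφ => ?_⟩, h1, h2⟩
  simp_rw [sub_mul]
  rw [integral_sub (integrable_mul_of_memLp h.memLp hφ.deriv.memLp)
    (integrable_mul_of_memLp h'.memLp hφ.deriv.memLp), integral_sub
    (integrable_mul_of_memLp h.memLp' hφ.memLp) (integrable_mul_of_memLp h'.memLp' hφ.memLp),
    h.weak.2.2 φ hφ, h'.weak.2.2 φ hφ]
  ring

/-- The product rule for weak derivatives. -/
theorem IsH1.mul {u ux : ℝ → ℂ} (hu : IsH1 u ux) {m m' : ℝ → ℂ} {M : ℝ}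
    (hm : ∀ x, HasDerivAt m (m' x) x) (hM : ∀ x, ‖m x‖ ≤ M) (hM' : ∀ x, ‖m' x‖ ≤ M) :
    IsH1 (fun x => m x * u x) (fun x => m' x * u x + m x * ux x) := by
  have mm := aestronglyMeasurable_of_hasDerivAt' hm
  have mm' := aestronglyMeasurable_of_hasDerivAt hm
  have h1 := memLp_bdd_mul hu.memLp mm hM
  have h2 := (memLp_bdd_mul hu.memLp mm' hM').add (memLp_bdd_mul hu.memLp' mm hM)
  refine ⟨⟨MemLp.locallyIntegrable_two h1, MemLp.locallyIntegrable_two h2, fun φ hφ => ?_⟩, h1, h2⟩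
  have := hu.integral_by_parts hφ.isH1 hm hM hM'
  have e : ∫ x, (m' x * u x + m x * ux x) * φ x
      = (∫ x, m' x * u x * φ x) + ∫ x, m x * ux x * φ x := by
    rw [← integral_add (integrable_bdd_mul_mul hu.memLp hφ.memLp mm' hM')
      (integrable_bdd_mul_mul hu.memLp' hφ.memLp mm hM)]
    refine integral_congr_ae (ae_of_all _ fun x => ?_)
    ring
  rw [e]
  linear_combination this

/-- The weak derivative is a closed operator in `L²`. This is how multipliers that are merely
Lipschitz, such as `√(F'F)`, become admissible. -/
theorem IsH1.of_tendsto {P P' : ℕ → ℝ → ℂ} {Q Q' : ℝ → ℂ} (h : L2Tendsto atTop P Q)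
    (h' : L2Tendsto atTop P' Q') (hP : ∀ n, IsH1 (P n) (P' n)) : IsH1 Q Q' := by
  refine ⟨⟨MemLp.locallyIntegrable_two h.memLp_lim, MemLp.locallyIntegrable_two h'.memLp_lim,
    fun φ hφ => ?_⟩, h.memLp_lim, h'.memLp_lim⟩
  have l1 := h.tendsto_integral_mul (L2Tendsto.const (l := atTop) hφ.deriv.memLp)
  have l2 := (h'.tendsto_integral_mul (L2Tendsto.const (l := atTop) hφ.memLp)).neg
  exact tendsto_nhds_unique l1 (l2.congr fun n => ((hP n).weak.2.2 φ hφ).symm)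

/-- The one-dimensional Sobolev embedding for differentiable functions. -/
theorem norm_le_of_hasDerivAt {g g' : ℝ → ℂ} (hg : ∀ x, HasDerivAt g (g' x) x) (h : MemLp g 2)
    (h' : MemLp g' 2) (x : ℝ) : ‖g x‖ ≤ l2n g + l2n g' := by
  -- The derivative of `|g|²` is integrated from `-∞`, which gives `|g|² ≤ 2‖g‖‖g'‖ ≤ (‖g‖ +
  -- ‖g'‖)²`.
  set q : ℝ → ℂ := fun x => g x * (starRingEnd ℂ) (g x) with hq
  set q' : ℝ → ℂ := fun x => g' x * (starRingEnd ℂ) (g x) + g x * (starRingEnd ℂ) (g' x) with hq'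
  have hd : ∀ x, HasDerivAt q (q' x) x := fun x => (hg x).mul (hasDerivAt_conj (hg x))
  have i1 := integrable_mul_of_memLp h' (MemLp.conj h)
  have i2 := integrable_mul_of_memLp h (MemLp.conj h')
  have iq : Integrable q := integrable_mul_of_memLp h (MemLp.conj h)
  have iq' : Integrable q' := i1.add i2
  have hbot := tendsto_zero_of_hasDerivAt_of_integrableOn_Iic (a := x) (fun y _ => hd y)
    iq'.integrableOn iq.integrableOn
  have e := integral_Iic_of_hasDerivAt_of_tendsto' (a := x) (fun y _ => hd y) iq'.integrableOn hbot
  have hconj : ∀ f : ℝ → ℂ, l2n (fun x => (starRingEnd ℂ) (f x)) = l2n f := fun f => by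
    rw [l2n, l2n]
    congr 1
    exact eLpNorm_congr_norm_ae (ae_of_all _ fun x => RCLike.norm_conj _)
  have hb : ‖q x‖ ≤ 2 * (l2n g * l2n g') := by
    rw [sub_zero] at e
    rw [← e]
    calc _ ≤ ∫ y in Iic x, ‖q' y‖ := norm_integral_le_integral_norm _
      _ ≤ ∫ y, ‖q' y‖ := setIntegral_le_integral iq'.norm (ae_of_all _ fun _ => norm_nonneg _)
      _ ≤ ∫ y, (‖g' y * (starRingEnd ℂ) (g y)‖ + ‖g y * (starRingEnd ℂ) (g' y)‖) :=
          integral_mono iq'.norm (i1.norm.add i2.norm) fun y => norm_add_le _ _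
      _ ≤ l2n g' * l2n g + l2n g * l2n g' := by
          rw [integral_add i1.norm i2.norm]
          refine add_le_add ?_ ?_
          · simpa [hconj] using integral_norm_mul_le h' (MemLp.conj h)
          · simpa [hconj] using integral_norm_mul_le h (MemLp.conj h')
      _ = _ := by ring
  have hn : ‖q x‖ = ‖g x‖ ^ 2 := by simp [hq, sq]
  rw [hn] at hb
  refine abs_le_of_sq_le_sq' ?_ (add_nonneg (l2n_nonneg _) (l2n_nonneg _)) |>.2
  nlinarith [sq_nonneg (l2n g), sq_nonneg (l2n g')]

/-- The bound is uniform in `n` because mollification contracts `L²`. All mollifications thus stay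
in a fixed ball, where the nonlinearity is Lipschitz. -/
theorem IsH1.norm_mol_le {u ux : ℝ → ℂ} (h : IsH1 u ux) (n : ℕ) (x : ℝ) :
    ‖mol (rho n) u x‖ ≤ l2n u + l2n ux :=
  (norm_le_of_hasDerivAt (h.hasDerivAt_mol (isTest_rho n)) (memLp_mol (isTest_rho n) h.memLp)
    (memLp_mol (isTest_rho n) h.memLp') x).trans
    (add_le_add (l2n_mol_rho_le h.memLp n) (l2n_mol_rho_le h.memLp' n))

theorem IsH1.norm_le {u ux : ℝ → ℂ} (h : IsH1 u ux) : ∀ᵐ x, ‖u x‖ ≤ l2n u + l2n ux := by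
  filter_upwards [ae_tendsto_mol_rho h.weak.1] with x hx
  exact le_of_tendsto hx.norm (Eventually.of_forall fun n => h.norm_mol_le n x)

/-! ### The nonlinearity -/

/-- The power nonlinearity `|z|^(p-1) z`. -/
def pw (p : ℝ) (z : ℂ) : ℂ := ((‖z‖ ^ (p - 1) : ℝ) : ℂ) * z

theorem continuous_pw {p : ℝ} (hp : 1 < p) : Continuous (pw p) :=
  (Complex.continuous_ofReal.comp
    (continuous_norm.rpow_const fun _ => Or.inr (by linarith))).mul continuous_id

/-- For `|w| ≤ |z|` the difference is `|z|^(p-1) (z - w)` plus `(|z|^(p-1) - |w|^(p-1)) w`. The last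
term is estimated by convexity of `r ^ p` (Bernoulli's inequality, the tangent line at `|z|`).
Estimating the product with `w`, and not the bracket alone, covers `p < 2`, where `r^(p-1)` is not
Lipschitz at zero. -/
theorem norm_pw_sub_le {p R : ℝ} (hp : 1 < p) {z w : ℂ} (hz : ‖z‖ ≤ R) (hw : ‖w‖ ≤ R) :
    ‖pw p z - pw p w‖ ≤ (p + 1) * R ^ (p - 1) * ‖z - w‖ := by
  wlog h : ‖w‖ ≤ ‖z‖ generalizing z w
  · rw [norm_sub_rev, norm_sub_rev z]
    exact this hw hz (le_of_not_ge h)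
  rcases (norm_nonneg z).eq_or_lt with h0 | h0
  · have hz0 : z = 0 := norm_eq_zero.1 h0.symm
    have hw0 : w = 0 := norm_le_zero_iff.1 (h.trans h0.symm.le)
    simp [hz0, hw0]
  set a := ‖z‖
  set b := ‖w‖
  have hb : 0 ≤ b := norm_nonneg w
  have hab : a - b ≤ ‖z - w‖ := norm_sub_norm_le z w
  have e : pw p z - pw p w = ((a ^ (p - 1) : ℝ) : ℂ) * (z - w)
      + ((a ^ (p - 1) - b ^ (p - 1) : ℝ) : ℂ) * w := by
    simp only [pw, a, b]
    push_cast
    ring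
  have hpow : b ^ (p - 1) ≤ a ^ (p - 1) := Real.rpow_le_rpow hb h (by linarith)
  have hanon : 0 ≤ a ^ (p - 1) := Real.rpow_nonneg h0.le _
  have tangent : (a ^ (p - 1) - b ^ (p - 1)) * b ≤ p * a ^ (p - 1) * (a - b) := by
    have h1 : b ^ (p - 1) * b = b ^ p := by
      rcases hb.eq_or_lt with h2 | h2
      · rw [← h2, Real.zero_rpow (by linarith), Real.zero_rpow (by linarith), mul_zero]
      · rw [← Real.rpow_add_one h2.ne']; ring_nf
    have h2 : a ^ (p - 1) * a = a ^ p := by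
      rw [← Real.rpow_add_one h0.ne']; ring_nf
    have h3 := one_add_mul_self_le_rpow_one_add (s := b / a - 1) (p := p)
      (by have : 0 ≤ b / a := by positivity
          linarith) hp.le
    rw [add_sub_cancel, Real.div_rpow hb h0.le, le_div_iff₀ (by positivity)] at h3
    have h4 : (1 + p * (b / a - 1)) * a ^ p = a ^ p + p * a ^ (p - 1) * (b - a) := by
      rw [← h2]
      field_simp
    rw [h4] at h3
    have h5 : a ^ (p - 1) * b ≤ a ^ p := by
      rw [← h2]; exact mul_le_mul_of_nonneg_left h hanon
    nlinarith
  rw [e]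
  refine (norm_add_le _ _).trans ?_
  rw [norm_mul, norm_mul, Complex.norm_real, Complex.norm_real, Real.norm_of_nonneg hanon,
    Real.norm_of_nonneg (sub_nonneg.2 hpow)]
  have hR : a ^ (p - 1) ≤ R ^ (p - 1) := Real.rpow_le_rpow h0.le hz (by linarith)
  have t2 : p * a ^ (p - 1) * (a - b) ≤ p * a ^ (p - 1) * ‖z - w‖ :=
    mul_le_mul_of_nonneg_left hab (by positivity)
  calc _ ≤ a ^ (p - 1) * ‖z - w‖ + p * a ^ (p - 1) * ‖z - w‖ := by linarith
    _ = (p + 1) * a ^ (p - 1) * ‖z - w‖ := by ring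
    _ ≤ _ := by gcongr

theorem pw_zero {p : ℝ} : pw p 0 = 0 := by simp [pw]

theorem memLp_pw {p R : ℝ} (hp : 1 < p) {u : ℝ → ℂ} (hu : MemLp u 2) (hR : ∀ᵐ x, ‖u x‖ ≤ R) :
    MemLp (fun x => pw p (u x)) 2 := by
  refine hu.of_le_mul ((continuous_pw hp).comp_aestronglyMeasurable hu.1)
    (c := (p + 1) * R ^ (p - 1)) ?_
  filter_upwards [hR] with x hx
  simpa [pw_zero] using norm_pw_sub_le hp hx (w := 0) (by simpa using (norm_nonneg _).trans hx)

theorem L2Tendsto.pw {ι : Type*} {l : Filter ι} {p R : ℝ} (hp : 1 < p) {P : ι → ℝ → ℂ}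
    {Q : ℝ → ℂ} (h : L2Tendsto l P Q) (hP : ∀ i, ∀ᵐ x, ‖P i x‖ ≤ R) (hQ : ∀ᵐ x, ‖Q x‖ ≤ R) :
    L2Tendsto l (fun i x => pw p (P i x)) (fun x => pw p (Q x)) := by
  refine h.of_norm_le (fun i => (continuous_pw hp).comp_aestronglyMeasurable (h.memLp i).1)
    (memLp_pw hp h.memLp_lim hQ) ((p + 1) * R ^ (p - 1)) fun i => ?_
  filter_upwards [hP i, hQ] with x h1 h2
  exact norm_pw_sub_le hp h1 h2

theorem pw_mul_conj {p : ℝ} (hp : 1 < p) (z : ℂ) :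
    pw p z * (starRingEnd ℂ) z = ((‖z‖ ^ (p + 1) : ℝ) : ℂ) := by
  rw [pw, mul_assoc, Complex.mul_conj, Complex.normSq_eq_norm_sq, ← Complex.ofReal_mul]
  congr 1
  rcases (norm_nonneg z).eq_or_lt with h | h
  · rw [← h, Real.zero_rpow (by linarith), Real.zero_rpow (by linarith), zero_mul]
  · rw [← Real.rpow_natCast, ← Real.rpow_add h]
    congr 1
    push_cast
    ring

/-- The norm is not differentiable at zeros of `g`, so the power is written as `(|g|²)^((p+1)/2)`,
whose exponent is at least 1. -/
theorem hasDerivAt_norm_rpow_comp {p : ℝ} (hp : 1 < p) {g : ℝ → ℂ} {g' : ℂ} {x : ℝ}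
    (hg : HasDerivAt g g' x) :
    HasDerivAt (fun x => ‖g x‖ ^ (p + 1))
      ((p + 1) * (pw p (g x) * (starRingEnd ℂ) g').re) x := by
  have h1 : HasDerivAt (fun x => ‖g x‖ ^ 2) (2 * inner ℝ (g x) g') x := hg.norm_sq
  have h2 := h1.rpow_const (p := (p + 1) / 2) (Or.inr (by linarith))
  have e : (fun x => (‖g x‖ ^ 2) ^ ((p + 1) / 2)) = fun x => ‖g x‖ ^ (p + 1) := by
    ext y
    rw [← Real.rpow_natCast, ← Real.rpow_mul (norm_nonneg _)]
    congr 1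
    push_cast
    ring
  rw [e] at h2
  refine h2.congr_deriv ?_
  have e2 : (‖g x‖ ^ 2) ^ ((p + 1) / 2 - 1) = ‖g x‖ ^ (p - 1) := by
    rw [← Real.rpow_natCast, ← Real.rpow_mul (norm_nonneg _)]
    congr 1
    push_cast
    ring
  have e3 : (pw p (g x) * (starRingEnd ℂ) g').re
      = ‖g x‖ ^ (p - 1) * (g x * (starRingEnd ℂ) g').re := by
    rw [pw, mul_assoc, Complex.re_ofReal_mul]
  rw [e2, e3, Complex.inner]
  simp only [Complex.mul_re, Complex.conj_re, Complex.conj_im]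
  ring

/-- Integration by parts for the power nonlinearity. -/
theorem IsH1.integral_by_parts_pw {u ux : ℝ → ℂ} (hu : IsH1 u ux) {p : ℝ} (hp : 1 < p)
    {m m' : ℝ → ℝ} {M : ℝ} (hm : ∀ x, HasDerivAt m (m' x) x) (hM : ∀ x, |m x| ≤ M)
    (hM' : ∀ x, |m' x| ≤ M) :
    (∫ x, (m' x : ℂ) * pw p (u x) * (starRingEnd ℂ) (u x)).re
      = -((p + 1) * (∫ x, (m x : ℂ) * pw p (u x) * (starRingEnd ℂ) (ux x)).re) := by
  have hmc : ∀ x, HasDerivAt (fun x => (m x : ℂ)) (m' x : ℂ) x := fun x => (hm x).ofReal_comp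
  have mm := aestronglyMeasurable_of_hasDerivAt' hmc
  have mm' := aestronglyMeasurable_of_hasDerivAt hmc
  have hMc : ∀ x, ‖(m x : ℂ)‖ ≤ M := fun x => by rw [Complex.norm_real]; exact hM x
  have hMc' : ∀ x, ‖(m' x : ℂ)‖ ≤ M := fun x => by rw [Complex.norm_real]; exact hM' x
  set U := fun n => mol (rho n) u
  set Ux := fun n => mol (rho n) ux
  have hU : L2Tendsto atTop U u := l2Tendsto_mol_rho hu.memLp
  have hUx : L2Tendsto atTop Ux ux := l2Tendsto_mol_rho hu.memLp'
  have hN : L2Tendsto atTop (fun n x => NLSMorawetz.pw p (U n x)) (fun x => pw p (u x)) :=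
    hU.pw hp (R := l2n u + l2n ux) (fun n => ae_of_all _ (hu.norm_mol_le n)) hu.norm_le
  have lim : ∀ {P : ℕ → ℝ → ℂ} {Q : ℝ → ℂ} {c : ℝ → ℂ}, L2Tendsto atTop P Q →
      AEStronglyMeasurable c → (∀ x, ‖c x‖ ≤ M) →
      L2Tendsto atTop (fun n x => c x * P n x) (fun x => c x * Q x) := fun hP hc hcM =>
    hP.bdd_mul (fun _ => hc) hc (fun _ => hcM) hcM (ae_of_all _ fun _ => tendsto_const_nhds)
  have l1 := (Complex.continuous_re.tendsto _).comp
    ((lim hN mm' hMc').tendsto_integral_mul hU.star)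
  have l2 := ((Complex.continuous_re.tendsto _).comp
    ((lim hN mm hMc).tendsto_integral_mul hUx.star)).const_mul (p + 1) |>.neg
  refine tendsto_nhds_unique l1 (l2.congr fun n => ?_)
  have i1 := integrable_bdd_mul_mul (hN.memLp n) (hU.star.memLp n) mm' hMc'
  have i2 := integrable_bdd_mul_mul (hN.memLp n) (hUx.star.memLp n) mm hMc
  have i0 := integrable_bdd_mul_mul (hN.memLp n) (hU.star.memLp n) mm hMc
  have e1 : ∀ x, ((m' x : ℂ) * pw p (U n x) * (starRingEnd ℂ) (U n x)).re
      = m' x * ‖U n x‖ ^ (p + 1) := fun x => by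
    rw [mul_assoc, pw_mul_conj hp, ← Complex.ofReal_mul, Complex.ofReal_re]
  have e0 : ∀ x, ((m x : ℂ) * pw p (U n x) * (starRingEnd ℂ) (U n x)).re
      = m x * ‖U n x‖ ^ (p + 1) := fun x => by
    rw [mul_assoc, pw_mul_conj hp, ← Complex.ofReal_mul, Complex.ofReal_re]
  have e2 : ∀ x, ((m x : ℂ) * pw p (U n x) * (starRingEnd ℂ) (Ux n x)).re
      = m x * (pw p (U n x) * (starRingEnd ℂ) (Ux n x)).re := fun x => by
    rw [mul_assoc, Complex.re_ofReal_mul]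
  have j1 := i1.re
  have j2 := i2.re
  have j0 := i0.re
  have r1 := integral_re i1
  have r2 := integral_re i2
  simp only [RCLike.re_to_complex] at j1 j2 j0 r1 r2
  simp only [Function.comp_apply]
  rw [← r1, ← r2]
  simp_rw [e1] at j1 ⊢
  simp_rw [e2] at j2 ⊢
  simp_rw [e0] at j0
  have j2' := j2.const_mul (p + 1)
  -- At fixed `n` the identity is the vanishing integral of the derivative of `m |U|^(p+1)`.
  have := integral_eq_zero_of_hasDerivAt_of_integrable (f := fun x => m x * ‖U n x‖ ^ (p + 1))
    (fun x => ((hm x).mul (hasDerivAt_norm_rpow_comp hp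
      (hu.hasDerivAt_mol (isTest_rho n) x))).congr_deriv (g' := m' x * ‖U n x‖ ^ (p + 1)
        + (p + 1) * (m x * (pw p (U n x) * (starRingEnd ℂ) (Ux n x)).re)) (by
          simp only [U, Ux]; ring)) (j1.add j2') j0
  rw [integral_add j1 j2', integral_const_mul] at this
  linarith

/-! ### Weighted sesquilinear forms -/

/-- The form `∫ m f ḡ` with a real weight `m`. -/
def bil (m : ℝ → ℝ) (f g : ℝ → ℂ) : ℂ := ∫ x, (m x : ℂ) * f x * (starRingEnd ℂ) (g x)

/-- A bounded measurable weight. -/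
structure BddWeight (m : ℝ → ℝ) (M : ℝ) : Prop where
  meas : Measurable m
  bound : ∀ x, |m x| ≤ M

theorem BddWeight.aesm {m : ℝ → ℝ} {M : ℝ} (h : BddWeight m M) :
    AEStronglyMeasurable fun x => (m x : ℂ) :=
  (Complex.measurable_ofReal.comp h.meas).aestronglyMeasurable

theorem BddWeight.norm_le {m : ℝ → ℝ} {M : ℝ} (h : BddWeight m M) (x : ℝ) : ‖(m x : ℂ)‖ ≤ M := by
  rw [Complex.norm_real]; exact h.bound x

theorem BddWeight.integrable {m : ℝ → ℝ} {M : ℝ} (h : BddWeight m M) {f g : ℝ → ℂ}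
    (hf : MemLp f 2) (hg : MemLp g 2) :
    Integrable fun x => (m x : ℂ) * f x * (starRingEnd ℂ) (g x) :=
  integrable_bdd_mul_mul hf (MemLp.conj hg) h.aesm h.norm_le

theorem l2n_conj (f : ℝ → ℂ) : l2n (fun x => (starRingEnd ℂ) (f x)) = l2n f := by
  rw [l2n, l2n]
  congr 1
  exact eLpNorm_congr_norm_ae (ae_of_all _ fun x => RCLike.norm_conj _)

theorem BddWeight.norm_bil_le {m : ℝ → ℝ} {M : ℝ} (h : BddWeight m M) {f g : ℝ → ℂ}
    (hf : MemLp f 2) (hg : MemLp g 2) : ‖bil m f g‖ ≤ M * (l2n f * l2n g) := by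
  simpa [l2n_conj, bil] using norm_integral_bdd_mul_mul_le hf (MemLp.conj hg) h.aesm h.norm_le

theorem conj_bil (m : ℝ → ℝ) (f g : ℝ → ℂ) : (starRingEnd ℂ) (bil m f g) = bil m g f := by
  rw [bil, bil, ← integral_conj]
  refine integral_congr_ae (ae_of_all _ fun x => ?_)
  simp only [map_mul, Complex.conj_ofReal, Complex.conj_conj]
  ring

theorem bil_re_symm (m : ℝ → ℝ) (f g : ℝ → ℂ) : (bil m f g).re = (bil m g f).re := by
  rw [← conj_bil, Complex.conj_re]

theorem bil_im_symm (m : ℝ → ℝ) (f g : ℝ → ℂ) : (bil m f g).im = -(bil m g f).im := by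
  rw [← conj_bil, Complex.conj_im]

theorem BddWeight.bil_add_left {m : ℝ → ℝ} {M : ℝ} (h : BddWeight m M) {f f' g : ℝ → ℂ}
    (hf : MemLp f 2) (hf' : MemLp f' 2) (hg : MemLp g 2) :
    bil m (fun x => f x + f' x) g = bil m f g + bil m f' g := by
  rw [bil, bil, bil, ← integral_add (h.integrable hf hg) (h.integrable hf' hg)]
  refine integral_congr_ae (ae_of_all _ fun x => ?_)
  ring

theorem bil_const_mul_left (m : ℝ → ℝ) (c : ℂ) (f g : ℝ → ℂ) :
    bil m (fun x => c * f x) g = c * bil m f g := by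
  rw [bil, bil, ← integral_const_mul]
  refine integral_congr_ae (ae_of_all _ fun x => ?_)
  ring

theorem bil_const_mul_weight (c : ℝ) (m : ℝ → ℝ) (f g : ℝ → ℂ) :
    bil (fun x => c * m x) f g = c * bil m f g := by
  rw [bil, bil, ← integral_const_mul]
  refine integral_congr_ae (ae_of_all _ fun x => ?_)
  push_cast
  ring

theorem bil_add_weight {m m' : ℝ → ℝ} {M M' : ℝ} (h : BddWeight m M) (h' : BddWeight m' M')
    {f g : ℝ → ℂ} (hf : MemLp f 2) (hg : MemLp g 2) :
    bil (fun x => m x + m' x) f g = bil m f g + bil m' f g := by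
  rw [bil, bil, bil, ← integral_add (h.integrable hf hg) (h'.integrable hf hg)]
  refine integral_congr_ae (ae_of_all _ fun x => ?_)
  push_cast
  ring

theorem bil_self (m : ℝ → ℝ) (f : ℝ → ℂ) : bil m f f = ((∫ x, m x * ‖f x‖ ^ 2 : ℝ) : ℂ) := by
  rw [bil, ← integral_complex_ofReal]
  refine integral_congr_ae (ae_of_all _ fun x => ?_)
  simp only
  rw [mul_assoc, Complex.mul_conj, Complex.normSq_eq_norm_sq]
  push_cast
  ring

theorem bil_self_im (m : ℝ → ℝ) (f : ℝ → ℂ) : (bil m f f).im = 0 := by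
  rw [bil_self, Complex.ofReal_im]

theorem bil_self_re (m : ℝ → ℝ) (f : ℝ → ℂ) : (bil m f f).re = ∫ x, m x * ‖f x‖ ^ 2 := by
  rw [bil_self, Complex.ofReal_re]

theorem bil_mul_left (m n : ℝ → ℝ) (f g : ℝ → ℂ) :
    bil m (fun x => (n x : ℂ) * f x) g = bil (fun x => m x * n x) f g := by
  refine integral_congr_ae (ae_of_all _ fun x => ?_)
  push_cast
  ring

/-- Weights converging boundedly and pointwise, against `L²`-convergent sequences. -/
theorem tendsto_bil {ι : Type*} {l : Filter ι} [l.IsCountablyGenerated] {m : ι → ℝ → ℝ}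
    {m₀ : ℝ → ℝ} {M : ℝ} {P P' : ι → ℝ → ℂ} {Q Q' : ℝ → ℂ} (hm : ∀ i, BddWeight (m i) M)
    (hm0 : BddWeight m₀ M) (hlim : ∀ᵐ x, Tendsto (fun i => m i x) l (𝓝 (m₀ x)))
    (h : L2Tendsto l P Q) (h' : L2Tendsto l P' Q') :
    Tendsto (fun i => bil (m i) (P i) (P' i)) l (𝓝 (bil m₀ Q Q')) :=
  (h.bdd_mul (fun i => (hm i).aesm) hm0.aesm (fun i => (hm i).norm_le) hm0.norm_le
    (hlim.mono fun _ hx => (Complex.continuous_ofReal.tendsto _).comp hx)).tendsto_integral_mul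
    h'.star

theorem tendsto_bil_const {ι : Type*} {l : Filter ι} [l.IsCountablyGenerated] {m : ℝ → ℝ} {M : ℝ}
    {P P' : ι → ℝ → ℂ} {Q Q' : ℝ → ℂ} (hm : BddWeight m M)
    (h : L2Tendsto l P Q) (h' : L2Tendsto l P' Q') :
    Tendsto (fun i => bil m (P i) (P' i)) l (𝓝 (bil m Q Q')) :=
  tendsto_bil (fun _ => hm) hm (ae_of_all _ fun _ => tendsto_const_nhds) h h'

/-- A bounded differentiable weight with bounded derivative. -/
structure C1Weight (m m' : ℝ → ℝ) (M : ℝ) : Prop where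
  hasDerivAt : ∀ x, HasDerivAt m (m' x) x
  bound : ∀ x, |m x| ≤ M
  bound' : ∀ x, |m' x| ≤ M

theorem C1Weight.weight {m m' : ℝ → ℝ} {M : ℝ} (h : C1Weight m m' M) : BddWeight m M :=
  ⟨(continuous_iff_continuousAt.2 fun x => (h.hasDerivAt x).continuousAt).measurable, h.bound⟩

theorem C1Weight.weight' {m m' : ℝ → ℝ} {M : ℝ} (h : C1Weight m m' M) : BddWeight m' M := by
  refine ⟨?_, h.bound'⟩
  have : m' = deriv m := funext fun x => (h.hasDerivAt x).deriv.symm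
  rw [this]
  exact measurable_deriv m

theorem C1Weight.integral_by_parts {m m' : ℝ → ℝ} {M : ℝ} (h : C1Weight m m' M)
    {u ux v vx : ℝ → ℂ} (hu : IsH1 u ux) (hv : IsH1 v vx) :
    bil m' u v + bil m ux v + bil m u vx = 0 :=
  hu.integral_by_parts hv.conj (m := fun x => (m x : ℂ)) (m' := fun x => (m' x : ℂ))
    (fun x => (h.hasDerivAt x).ofReal_comp) h.weight.norm_le h.weight'.norm_le

/-- The weighted form of `(|u|²)' = 2 Re (u_x ū)`. It trades the real part of a first-order form for
a mass term with the differentiated weight. -/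
theorem C1Weight.bil_self_deriv {m m' : ℝ → ℝ} {M : ℝ} (h : C1Weight m m' M)
    {u ux : ℝ → ℂ} (hu : IsH1 u ux) : (bil m' u u).re = -2 * (bil m ux u).re := by
  have e := congrArg Complex.re (h.integral_by_parts hu hu)
  simp only [Complex.add_re, Complex.zero_re] at e
  rw [bil_re_symm m u ux] at e
  linarith

theorem C1Weight.isH1_mul {m m' : ℝ → ℝ} {M : ℝ} (h : C1Weight m m' M)
    {u ux : ℝ → ℂ} (hu : IsH1 u ux) :
    IsH1 (fun x => (m x : ℂ) * u x) (fun x => (m' x : ℂ) * u x + (m x : ℂ) * ux x) :=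
  hu.mul (fun x => (h.hasDerivAt x).ofReal_comp) h.weight.norm_le h.weight'.norm_le

theorem C1Weight.bil_pw {m m' : ℝ → ℝ} {M : ℝ} (h : C1Weight m m' M)
    {u ux : ℝ → ℂ} (hu : IsH1 u ux) {p : ℝ} (hp : 1 < p) :
    (bil m' (fun x => pw p (u x)) u).re = -((p + 1) * (bil m (fun x => pw p (u x)) ux).re) :=
  hu.integral_by_parts_pw hp h.hasDerivAt h.bound h.bound'

theorem bil_pw_self {p : ℝ} (hp : 1 < p) (m : ℝ → ℝ) (u : ℝ → ℂ) :
    bil m (fun x => pw p (u x)) u = ((∫ x, m x * ‖u x‖ ^ (p + 1) : ℝ) : ℂ) := by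
  rw [bil, ← integral_complex_ofReal]
  refine integral_congr_ae (ae_of_all _ fun x => ?_)
  simp only
  rw [mul_assoc, pw_mul_conj hp]
  push_cast
  ring

/-! ### Radial profiles -/

/-- The even extension of a profile on the half line. -/
def evenP (P : ℝ → ℝ) (y : ℝ) : ℝ := P y + P (-y)

/-- The odd extension of a profile on the half line. -/
def oddP (P : ℝ → ℝ) (y : ℝ) : ℝ := P y - P (-y)

/-- A function vanishing on the left half line. -/
def IsProfile (P : ℝ → ℝ) : Prop := ∀ y, y ≤ 0 → P y = 0

/-- Neither `|x|` nor `sgn x` is smooth at the origin. A profile that vanishes on the left half line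
removes the singularity: cutoffs in `|x|` become even extensions and multiplication by the sign
exchanges even and odd extensions, with no loss of smoothness. -/
theorem IsProfile.abs {P : ℝ → ℝ} (h : IsProfile P) {L : ℝ} (hL : 0 < L) (x : ℝ) :
    P (|x| / L) = evenP P (x / L) := by
  rcases lt_trichotomy x 0 with hx | hx | hx
  · rw [evenP, h (x / L) (div_nonpos_of_nonpos_of_nonneg hx.le hL.le), abs_of_neg hx, neg_div,
      zero_add]
  · simp [hx, evenP, h 0 le_rfl]
  · rw [evenP, abs_of_pos hx, h (-(x / L)) (by have := div_pos hx hL; linarith), add_zero]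

theorem IsProfile.sign_mul_even {P : ℝ → ℝ} (h : IsProfile P) {L : ℝ} (hL : 0 < L) (x : ℝ) :
    Real.sign x * evenP P (x / L) = oddP P (x / L) := by
  rcases lt_trichotomy x 0 with hx | hx | hx
  · rw [evenP, oddP, h (x / L) (div_nonpos_of_nonpos_of_nonneg hx.le hL.le), Real.sign_of_neg hx]
    ring
  · simp [hx, evenP, oddP, h 0 le_rfl]
  · rw [evenP, oddP, Real.sign_of_pos hx, h (-(x / L)) (by have := div_pos hx hL; linarith)]
    ring

theorem IsProfile.sign_mul_odd {P : ℝ → ℝ} (h : IsProfile P) {L : ℝ} (hL : 0 < L) (x : ℝ) :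
    Real.sign x * oddP P (x / L) = evenP P (x / L) := by
  rcases lt_trichotomy x 0 with hx | hx | hx
  · rw [evenP, oddP, h (x / L) (div_nonpos_of_nonpos_of_nonneg hx.le hL.le), Real.sign_of_neg hx]
    ring
  · simp [hx, evenP, oddP, h 0 le_rfl]
  · rw [evenP, oddP, Real.sign_of_pos hx, h (-(x / L)) (by have := div_pos hx hL; linarith)]
    ring

/-- The two factors live on opposite half lines. Hence the parity extensions multiply like the
profiles themselves. -/
theorem IsProfile.cross {P Q : ℝ → ℝ} (hP : IsProfile P) (hQ : IsProfile Q) (y : ℝ) :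
    P y * Q (-y) = 0 := by
  rcases le_total y 0 with h | h
  · rw [hP y h, zero_mul]
  · rw [hQ (-y) (by linarith), mul_zero]

theorem IsProfile.cross' {P Q : ℝ → ℝ} (hP : IsProfile P) (hQ : IsProfile Q) (y : ℝ) :
    P (-y) * Q y = 0 := by rw [mul_comm]; exact hQ.cross hP y

theorem evenP_mul_evenP {P Q : ℝ → ℝ} (hP : IsProfile P) (hQ : IsProfile Q) (y : ℝ) :
    evenP P y * evenP Q y = evenP (fun y => P y * Q y) y := by
  have h1 := hP.cross hQ y
  have h2 := hP.cross' hQ y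
  simp only [evenP]
  linear_combination h1 + h2

theorem oddP_mul_oddP {P Q : ℝ → ℝ} (hP : IsProfile P) (hQ : IsProfile Q) (y : ℝ) :
    oddP P y * oddP Q y = evenP (fun y => P y * Q y) y := by
  have h1 := hP.cross hQ y
  have h2 := hP.cross' hQ y
  simp only [evenP, oddP]
  linear_combination -h1 - h2

theorem evenP_mul_oddP {P Q : ℝ → ℝ} (hP : IsProfile P) (hQ : IsProfile Q) (y : ℝ) :
    evenP P y * oddP Q y = oddP (fun y => P y * Q y) y := by
  have h1 := hP.cross hQ y
  have h2 := hP.cross' hQ y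
  simp only [evenP, oddP]
  linear_combination -h1 + h2

theorem abs_evenP_le {P : ℝ → ℝ} {M : ℝ} (h : ∀ y, |P y| ≤ M) (y : ℝ) : |evenP P y| ≤ 2 * M := by
  refine (abs_add_le _ _).trans ?_
  linarith [h y, h (-y)]

theorem abs_oddP_le {P : ℝ → ℝ} {M : ℝ} (h : ∀ y, |P y| ≤ M) (y : ℝ) : |oddP P y| ≤ 2 * M := by
  refine (abs_sub _ _).trans ?_
  linarith [h y, h (-y)]

theorem measurable_evenP {P : ℝ → ℝ} (h : Measurable P) : Measurable (evenP P) :=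
  h.add (h.comp measurable_neg)

theorem measurable_oddP {P : ℝ → ℝ} (h : Measurable P) : Measurable (oddP P) :=
  h.sub (h.comp measurable_neg)

theorem hasDerivAt_evenP {P P' : ℝ → ℝ} (h : ∀ y, HasDerivAt P (P' y) y) (y : ℝ) :
    HasDerivAt (evenP P) (oddP P' y) y := by
  have := (h y).add ((h (-y)).comp y (hasDerivAt_neg y))
  refine this.congr_deriv ?_
  simp only [oddP]
  ring

theorem hasDerivAt_oddP {P P' : ℝ → ℝ} (h : ∀ y, HasDerivAt P (P' y) y) (y : ℝ) :
    HasDerivAt (oddP P) (evenP P' y) y := by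
  have := (h y).sub ((h (-y)).comp y (hasDerivAt_neg y))
  refine this.congr_deriv ?_
  simp only [evenP]
  ring

theorem hasDerivAt_comp_div {Q Q' : ℝ → ℝ} (h : ∀ y, HasDerivAt Q (Q' y) y) (L x : ℝ) :
    HasDerivAt (fun x => Q (x / L)) (Q' (x / L) / L) x := by
  have := (h (x / L)).comp x ((hasDerivAt_id x).div_const L)
  refine this.congr_deriv ?_
  ring

theorem BddWeight.even_div {P : ℝ → ℝ} {M : ℝ} (h : BddWeight P M) (L : ℝ) :
    BddWeight (fun x => evenP P (x / L)) (2 * M) :=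
  ⟨(measurable_evenP h.meas).comp (measurable_id.div_const L), fun _ => abs_evenP_le h.bound _⟩

theorem BddWeight.odd_div {P : ℝ → ℝ} {M : ℝ} (h : BddWeight P M) (L : ℝ) :
    BddWeight (fun x => oddP P (x / L)) (2 * M) :=
  ⟨(measurable_oddP h.meas).comp (measurable_id.div_const L), fun _ => abs_oddP_le h.bound _⟩

theorem C1Weight.even_div {P P' : ℝ → ℝ} {M : ℝ} (h : C1Weight P P' M) {L : ℝ} (hL : 0 < L) :
    C1Weight (fun x => evenP P (x / L)) (fun x => oddP P' (x / L) / L)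
      (max (2 * M) (2 * M / L)) :=
  ⟨hasDerivAt_comp_div (hasDerivAt_evenP h.hasDerivAt) L,
    fun _ => (abs_evenP_le h.bound _).trans (le_max_left _ _), fun _ => by
      rw [abs_div, abs_of_pos hL]
      exact (div_le_div_of_nonneg_right (abs_oddP_le h.bound' _) hL.le).trans (le_max_right _ _)⟩

theorem C1Weight.odd_div {P P' : ℝ → ℝ} {M : ℝ} (h : C1Weight P P' M) {L : ℝ} (hL : 0 < L) :
    C1Weight (fun x => oddP P (x / L)) (fun x => evenP P' (x / L) / L)
      (max (2 * M) (2 * M / L)) :=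
  ⟨hasDerivAt_comp_div (hasDerivAt_oddP h.hasDerivAt) L,
    fun _ => (abs_oddP_le h.bound _).trans (le_max_left _ _), fun _ => by
      rw [abs_div, abs_of_pos hL]
      exact (div_le_div_of_nonneg_right (abs_evenP_le h.bound' _) hL.le).trans (le_max_right _ _)⟩

/-! ### Exterior cutoffs -/

/-- The product `F' F`. -/
def cutH (F : ℝ → ℝ) (y : ℝ) : ℝ := deriv F y * F y

/-- The derivative of `√(F' F)`, with value `0` where `F' F` vanishes. -/
def cutK (F : ℝ → ℝ) (y : ℝ) : ℝ := deriv (cutH F) y / (2 * √(cutH F y))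

/-- The profile of the localized mass term. -/
def cutG (F : ℝ → ℝ) (y : ℝ) : ℝ := deriv (deriv (cutH F)) y - 4 * cutK F y ^ 2

/-- A primitive of `y F' F`. -/
def cutY (F : ℝ → ℝ) (y : ℝ) : ℝ := ∫ z in (0 : ℝ)..y, z * cutH F z

theorem exists_bound_of_zero_off {P : ℝ → ℝ} {a b : ℝ} (hP : Continuous P)
    (h0 : ∀ y, y ∉ Icc a b → P y = 0) : ∃ M, ∀ y, |P y| ≤ M := by
  obtain ⟨C, hC⟩ := (isCompact_Icc (a := a) (b := b)).exists_bound_of_continuousOn hP.continuousOn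
  refine ⟨max C 0, fun y => ?_⟩
  by_cases hy : y ∈ Icc a b
  · exact (hC y hy).trans (le_max_left _ _)
  · rw [h0 y hy, abs_zero]; exact le_max_right _ _

theorem deriv_zero_off {P : ℝ → ℝ} {a b : ℝ} (h0 : ∀ y, y ∉ Icc a b → P y = 0) :
    ∀ y, y ∉ Icc a b → deriv P y = 0 := fun y hy => by
  have : P =ᶠ[𝓝 y] fun _ => 0 := by
    filter_upwards [isClosed_Icc.isOpen_compl.mem_nhds hy] with z hz using h0 z hz
  rw [this.deriv_eq, deriv_const]

/-- A nonnegative function with bounded second derivative has a Lipschitz square root. -/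
theorem sq_deriv_le_of_nonneg {h h1 h2 : ℝ → ℝ} {M : ℝ} (hM : 0 < M) (h0 : ∀ y, 0 ≤ h y)
    (hd : ∀ y, HasDerivAt h (h1 y) y) (hd1 : ∀ y, HasDerivAt h1 (h2 y) y)
    (hb : ∀ y, |h2 y| ≤ M) (y : ℝ) : h1 y ^ 2 ≤ 4 * M * h y := by
  have lip : ∀ z, |h1 z - h1 y| ≤ M * |z - y| := fun z =>
    Convex.norm_image_sub_le_of_norm_hasDerivWithin_le (s := univ)
      (fun x _ => (hd1 x).hasDerivWithinAt) (fun x _ => hb x) convex_univ (mem_univ y) (mem_univ z)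
  -- This `r` minimizes the Taylor upper bound `h y - h1 y * r + M r²` for `h (y - r)`.
  -- Nonnegativity at the minimizer is the claim.
  set r := h1 y / (2 * M) with hr
  have key := Convex.norm_image_sub_le_of_norm_hasDerivWithin_le (f := fun z => h z - h1 y * z)
    (f' := fun z => h1 z - h1 y) (s := Metric.closedBall y |r|) (C := M * |r|) (x := y) (y := y - r)
    (fun x _ => ((hd x).sub ((hasDerivAt_id x).const_mul (h1 y)) |>.congr_deriv
      (by simp)).hasDerivWithinAt)
    (fun x hx => (lip x).trans (by
      rw [mem_closedBall_iff_norm, Real.norm_eq_abs] at hx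
      exact mul_le_mul_of_nonneg_left hx hM.le))
    (convex_closedBall _ _) (Metric.mem_closedBall_self (abs_nonneg r))
    (by rw [mem_closedBall_iff_norm]; simp)
  have e1 : h1 y = 2 * M * r := by rw [hr]; field_simp
  have e2 : ‖y - r - y‖ = |r| := by simp
  rw [e2, Real.norm_eq_abs, mul_assoc, ← sq, sq_abs] at key
  have := (abs_le.1 key).2
  have h3 := h0 (y - r)
  rw [e1] at this ⊢
  nlinarith

section Cutoff

variable {F : ℝ → ℝ} {a b : ℝ}

theorem IsExteriorCutoff.contDiff_deriv (hF : IsExteriorCutoff F a b) : ContDiff ℝ ∞ (deriv F) :=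
  hF.smooth.deriv'

theorem IsExteriorCutoff.contDiff_cutH (hF : IsExteriorCutoff F a b) : ContDiff ℝ ∞ (cutH F) :=
  hF.contDiff_deriv.mul hF.smooth

theorem hasDerivAt_of_contDiff {P : ℝ → ℝ} (h : ContDiff ℝ ∞ P) (y : ℝ) :
    HasDerivAt P (deriv P y) y :=
  (h.differentiable (by simp) y).hasDerivAt

theorem IsExteriorCutoff.nonneg (hF : IsExteriorCutoff F a b) (y : ℝ) : 0 ≤ F y := by
  rcases le_total y a with h | h
  · rw [hF.zero y h]
  · rw [← hF.zero a le_rfl]; exact hF.mono h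

theorem IsExteriorCutoff.cutH_nonneg (hF : IsExteriorCutoff F a b) (y : ℝ) : 0 ≤ cutH F y :=
  mul_nonneg hF.mono.deriv_nonneg (hF.nonneg y)

theorem IsExteriorCutoff.le (hF : IsExteriorCutoff F a b) (y : ℝ) : F y ≤ F b := by
  rcases le_total y b with h | h
  · exact hF.mono h
  · exact (hF.const y h).le

theorem IsExteriorCutoff.deriv_zero_off (hF : IsExteriorCutoff F a b) :
    ∀ y, y ∉ Icc a b → deriv F y = 0 := fun y hy => by
  rw [mem_Icc, not_and_or, not_le, not_le] at hy
  rcases hy with hy | hy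
  · have : F =ᶠ[𝓝 y] fun _ => 0 := by
      filter_upwards [Iio_mem_nhds hy] with z hz using hF.zero z (le_of_lt hz)
    rw [this.deriv_eq, deriv_const]
  · have : F =ᶠ[𝓝 y] fun _ => F b := by
      filter_upwards [Ioi_mem_nhds hy] with z hz using hF.const z (le_of_lt hz)
    rw [this.deriv_eq, deriv_const]

theorem IsExteriorCutoff.cutH_zero_off (hF : IsExteriorCutoff F a b) :
    ∀ y, y ∉ Icc a b → cutH F y = 0 := fun y hy => by
  rw [cutH, hF.deriv_zero_off y hy, zero_mul]

theorem IsExteriorCutoff.isProfile (hF : IsExteriorCutoff F a b) : IsProfile F := fun y hy =>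
  hF.zero y (hy.trans hF.pos.le)

theorem IsExteriorCutoff.isProfile_of_zero_off (hF : IsExteriorCutoff F a b) {P : ℝ → ℝ}
    (h : ∀ y, y ∉ Icc a b → P y = 0) : IsProfile P := fun y hy =>
  h y fun hy' => by linarith [hF.pos, hy'.1]

theorem cutK_zero_off (hF : IsExteriorCutoff F a b) : ∀ y, y ∉ Icc a b → cutK F y = 0 :=
  fun y hy => by
    rw [cutK, NLSMorawetz.deriv_zero_off hF.cutH_zero_off y hy, zero_div]

theorem cutG_zero_off (hF : IsExteriorCutoff F a b) : ∀ y, y ∉ Icc a b → cutG F y = 0 :=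
  fun y hy => by
    rw [cutG, cutK_zero_off hF y hy,
      NLSMorawetz.deriv_zero_off (NLSMorawetz.deriv_zero_off hF.cutH_zero_off) y hy]
    ring

theorem measurable_cutK (hF : IsExteriorCutoff F a b) : Measurable (cutK F) :=
  (measurable_deriv _).div (hF.contDiff_cutH.continuous.measurable.sqrt.const_mul 2)

theorem measurable_cutG (hF : IsExteriorCutoff F a b) : Measurable (cutG F) :=
  (measurable_deriv _).sub (((measurable_cutK hF).pow_const 2).const_mul 4)

theorem hasDerivAt_cutY (hF : IsExteriorCutoff F a b) (y : ℝ) :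
    HasDerivAt (cutY F) (y * cutH F y) y := by
  have : Continuous fun z => z * cutH F z := continuous_id.mul hF.contDiff_cutH.continuous
  exact intervalIntegral.integral_hasDerivAt_right (this.intervalIntegrable _ _)
    (this.stronglyMeasurableAtFilter _ _) this.continuousAt

theorem C1Weight.mono {m m' : ℝ → ℝ} {M M' : ℝ} (h : C1Weight m m' M) (hM : M ≤ M') :
    C1Weight m m' M' :=
  ⟨h.hasDerivAt, fun x => (h.bound x).trans hM, fun x => (h.bound' x).trans hM⟩

/-- A common bound for all the profiles built from a cutoff. -/
structure CutoffBound (F : ℝ → ℝ) (M : ℝ) : Prop where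
  pos : 0 < M
  wF : C1Weight F (deriv F) M
  wW : C1Weight (fun y => F y ^ 2) (fun y => 2 * cutH F y) M
  wH : C1Weight (cutH F) (deriv (cutH F)) M
  wH1 : C1Weight (deriv (cutH F)) (deriv (deriv (cutH F))) M
  wY : C1Weight (cutY F) (fun y => y * cutH F y) M
  wY2 : ∀ y, |y ^ 2 * cutH F y| ≤ M
  wK : ∀ y, |cutK F y| ≤ M
  wG : ∀ y, |cutG F y| ≤ M

/-- At `h = 0` the quotient is zero by the convention for division, which is also the value wanted
for `cutK`. -/
theorem abs_cutK_le {h h1 C : ℝ} (hC : 0 ≤ C) (h0 : 0 ≤ h) (hh : h1 ^ 2 ≤ 4 * C * h) :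
    |h1 / (2 * √h)| ≤ √C := by
  rcases h0.eq_or_lt with h2 | h2
  · rw [← h2]
    simp
  · rw [abs_div, abs_of_pos (by positivity : 0 < 2 * √h), div_le_iff₀ (by positivity)]
    refine abs_le_of_sq_le_sq' ?_ (by positivity) |> fun h => abs_le.2 h
    have := Real.sq_sqrt hC
    have := Real.sq_sqrt h0
    have e : (√C * (2 * √h)) ^ 2 = 4 * (√C ^ 2 * √h ^ 2) := by ring
    rw [e, Real.sq_sqrt hC, Real.sq_sqrt h0]
    linarith

theorem IsExteriorCutoff.exists_bound (hF : IsExteriorCutoff F a b) : ∃ M, CutoffBound F M := by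
  have cH := hF.contDiff_cutH
  have cH1 : ContDiff ℝ ∞ (deriv (cutH F)) := cH.deriv'
  have cH2 : ContDiff ℝ ∞ (deriv (deriv (cutH F))) := cH1.deriv'
  have z0 := hF.cutH_zero_off
  have z1 := NLSMorawetz.deriv_zero_off z0
  have z2 := NLSMorawetz.deriv_zero_off z1
  obtain ⟨M1, h1⟩ := exists_bound_of_zero_off hF.contDiff_deriv.continuous hF.deriv_zero_off
  obtain ⟨M2, h2⟩ := exists_bound_of_zero_off cH.continuous z0
  obtain ⟨M3, h3⟩ := exists_bound_of_zero_off cH1.continuous z1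
  obtain ⟨M4, h4⟩ := exists_bound_of_zero_off cH2.continuous z2
  have c5 : Continuous fun y => y * cutH F y := continuous_id.mul cH.continuous
  have z5 : ∀ y, y ∉ Icc a b → y * cutH F y = 0 := fun y hy => by rw [z0 y hy, mul_zero]
  obtain ⟨M5, h5⟩ := exists_bound_of_zero_off c5 z5
  obtain ⟨M6, h6⟩ := exists_bound_of_zero_off (P := fun y => y ^ 2 * cutH F y) (a := a) (b := b)
    ((continuous_id.pow 2).mul cH.continuous) fun y hy => by rw [z0 y hy, mul_zero]
  have i5 : Integrable fun y => y * cutH F y :=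
    c5.integrable_of_hasCompactSupport (HasCompactSupport.intro isCompact_Icc z5)
  have h7 : ∀ y, |cutY F y| ≤ ∫ z, ‖z * cutH F z‖ := fun y => by
    rw [← Real.norm_eq_abs, cutY]
    refine (intervalIntegral.norm_integral_le_integral_norm_uIoc).trans ?_
    exact setIntegral_le_integral i5.norm (ae_of_all _ fun _ => norm_nonneg _)
  have p1 := (abs_nonneg _).trans (h1 0)
  have p2 := (abs_nonneg _).trans (h2 0)
  have p3 := (abs_nonneg _).trans (h3 0)
  have p4 := (abs_nonneg _).trans (h4 0)
  have p5 := (abs_nonneg _).trans (h5 0)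
  have p6 := (abs_nonneg _).trans (h6 0)
  have p7 := (abs_nonneg _).trans (h7 0)
  set M7 := ∫ z, ‖z * cutH F z‖
  have p8 := hF.nonneg b
  -- `M4` may vanish, while `sq_deriv_le_of_nonneg` needs a positive bound on the second derivative;
  -- hence `M4 + 1`.
  have h8 : ∀ y, |cutK F y| ≤ √(M4 + 1) := fun y =>
    abs_cutK_le (by linarith) (hF.cutH_nonneg y) (sq_deriv_le_of_nonneg (by linarith) hF.cutH_nonneg
      (hasDerivAt_of_contDiff cH) (hasDerivAt_of_contDiff cH1)
      (fun y => (h4 y).trans (by linarith)) y)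
  have p9 := Real.sqrt_nonneg (M4 + 1)
  have h9 : ∀ y, |cutG F y| ≤ M4 + 4 * (M4 + 1) := fun y => by
    refine (abs_sub _ _).trans (add_le_add (h4 y) ?_)
    rw [abs_mul, abs_pow, abs_of_pos (by norm_num : (0:ℝ) < 4)]
    have : |cutK F y| ^ 2 ≤ √(M4 + 1) ^ 2 := pow_le_pow_left₀ (abs_nonneg _) (h8 y) 2
    rw [Real.sq_sqrt (by linarith)] at this
    linarith
  have pF2 : 0 ≤ F b ^ 2 := sq_nonneg _
  -- A sum of nonnegative bounds dominates each of them; the leading 1 makes it positive.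
  refine ⟨1 + F b + F b ^ 2 + M1 + 2 * M2 + M3 + M4 + M5 + M6 + M7 + √(M4 + 1) + 4 * (M4 + 1),
    by positivity, ⟨hasDerivAt_of_contDiff hF.smooth, fun y => ?_, fun y => ?_⟩,
    ⟨fun y => ?_, fun y => ?_, fun y => ?_⟩,
    ⟨hasDerivAt_of_contDiff cH, fun y => ?_, fun y => ?_⟩,
    ⟨hasDerivAt_of_contDiff cH1, fun y => ?_, fun y => ?_⟩,
    ⟨hasDerivAt_cutY hF, fun y => ?_, fun y => ?_⟩, fun y => ?_, fun y => ?_, fun y => ?_⟩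
  · rw [abs_of_nonneg (hF.nonneg y)]; linarith [hF.le y]
  · linarith [h1 y]
  · refine ((hasDerivAt_of_contDiff hF.smooth y).pow 2).congr_deriv ?_
    simp only [cutH]; push_cast; ring
  · rw [abs_of_nonneg (sq_nonneg _)]
    have := pow_le_pow_left₀ (hF.nonneg y) (hF.le y) 2
    linarith
  · rw [abs_mul, abs_of_pos (by norm_num : (0:ℝ) < 2)]; linarith [h2 y]
  · linarith [h2 y]
  · linarith [h3 y]
  · linarith [h3 y]
  · linarith [h4 y]
  · linarith [h7 y]
  · linarith [h5 y]
  · linarith [h6 y]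
  · linarith [h8 y]
  · linarith [h9 y]

/-! ### The operator `γ` on cut off functions -/

/-- When `f` vanishes near the origin, differentiation commutes with the sign, as `h` expresses. The
two halves of `γ` then agree, and `2/(2i) = -i`. -/
theorem gammaOp_ae {f f1 f2 : ℝ → ℂ} (h1 : IsH1 f f1)
    (h2 : IsH1 (fun x => (Real.sign x : ℂ) * f x) f2)
    (h : ∀ x, (Real.sign x : ℂ) * f1 x = f2 x) :
    gammaOp f =ᵐ[volume] fun x => -Complex.I * f2 x := by
  filter_upwards [h1.weakDeriv_ae, h2.weakDeriv_ae] with x e1 e2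
  rw [gammaOp, e1, e2, h, ← two_mul, div_eq_iff (by simp)]
  linear_combination (2 * f2 x) * Complex.I_mul_I

/-- A profile together with a function playing the role of its derivative in `H¹`. -/
structure CutProfile (P P' : ℝ → ℝ) : Prop where
  prof : IsProfile P
  prof' : IsProfile P'
  isH1_even : ∀ {u ux : ℝ → ℂ} {L : ℝ}, IsH1 u ux → 0 < L →
    IsH1 (fun x => (evenP P (x / L) : ℂ) * u x)
      (fun x => ((oddP P' (x / L) / L : ℝ) : ℂ) * u x + (evenP P (x / L) : ℂ) * ux x)
  isH1_odd : ∀ {u ux : ℝ → ℂ} {L : ℝ}, IsH1 u ux → 0 < L →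
    IsH1 (fun x => (oddP P (x / L) : ℂ) * u x)
      (fun x => ((evenP P' (x / L) / L : ℝ) : ℂ) * u x + (oddP P (x / L) : ℂ) * ux x)

theorem C1Weight.cutProfile {P P' : ℝ → ℝ} {M : ℝ} (h : C1Weight P P' M) (hP : IsProfile P)
    (hP' : IsProfile P') : CutProfile P P' :=
  ⟨hP, hP', fun hu hL => (h.even_div hL).isH1_mul hu, fun hu hL => (h.odd_div hL).isH1_mul hu⟩

theorem CutProfile.sign_mul {P P' : ℝ → ℝ} (h : CutProfile P P') {L : ℝ} (hL : 0 < L)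
    (u : ℝ → ℂ) : (fun x => (Real.sign x : ℂ) * ((P (|x| / L) : ℂ) * u x))
      = fun x => (oddP P (x / L) : ℂ) * u x := by
  ext x
  rw [h.prof.abs hL, ← h.prof.sign_mul_even hL]
  push_cast
  ring

theorem CutProfile.isH1 {P P' : ℝ → ℝ} (h : CutProfile P P') {L : ℝ} (hL : 0 < L)
    {u ux : ℝ → ℂ} (hu : IsH1 u ux) : IsH1 (fun x => (P (|x| / L) : ℂ) * u x)
      (fun x => ((oddP P' (x / L) / L : ℝ) : ℂ) * u x + (evenP P (x / L) : ℂ) * ux x) := by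
  simp_rw [h.prof.abs hL]
  exact h.isH1_even hu hL

theorem CutProfile.memGammaDomain {P P' : ℝ → ℝ} (h : CutProfile P P') {L : ℝ} (hL : 0 < L)
    {u ux : ℝ → ℂ} (hu : IsH1 u ux) : MemGammaDomain (fun x => (P (|x| / L) : ℂ) * u x) := by
  refine ⟨(h.isH1 hL hu).memH1, ?_⟩
  rw [h.sign_mul hL]
  exact (h.isH1_odd hu hL).memH1

theorem CutProfile.gammaOp_ae {P P' : ℝ → ℝ} (h : CutProfile P P') {L : ℝ} (hL : 0 < L)
    {u ux : ℝ → ℂ} (hu : IsH1 u ux) :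
    gammaOp (fun x => (P (|x| / L) : ℂ) * u x) =ᵐ[volume] fun x => -Complex.I *
      (((evenP P' (x / L) / L : ℝ) : ℂ) * u x + (oddP P (x / L) : ℂ) * ux x) := by
  refine NLSMorawetz.gammaOp_ae (h.isH1 hL hu) ?_ fun x => ?_
  · rw [h.sign_mul hL]
    exact h.isH1_odd hu hL
  · rw [← h.prof.sign_mul_even hL, ← h.prof'.sign_mul_odd hL]
    push_cast
    ring

end Cutoff

/-! ### The Lipschitz profile `√(F'F)` as an admissible multiplier -/

section Cutoff

variable {F : ℝ → ℝ} {a b M : ℝ}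

theorem tendsto_evenP {ι : Type*} {l : Filter ι} {P : ι → ℝ → ℝ} {Q : ℝ → ℝ}
    (h : ∀ y, Tendsto (fun i => P i y) l (𝓝 (Q y))) (y : ℝ) :
    Tendsto (fun i => evenP (P i) y) l (𝓝 (evenP Q y)) := (h y).add (h (-y))

theorem tendsto_oddP {ι : Type*} {l : Filter ι} {P : ι → ℝ → ℝ} {Q : ℝ → ℝ}
    (h : ∀ y, Tendsto (fun i => P i y) l (𝓝 (Q y))) (y : ℝ) :
    Tendsto (fun i => oddP (P i) y) l (𝓝 (oddP Q y)) := (h y).sub (h (-y))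

/-- Uniformly bounded pointwise limits of differentiable profiles still act on `H¹`, by dominated
convergence and closedness of the weak derivative. No differentiability of the limit is required. -/
theorem CutProfile.of_tendsto {P P' : ℕ → ℝ → ℝ} {Q Q' : ℝ → ℝ} (h : ∀ n, C1Weight (P n) (P' n) M)
    (hP : ∀ n, IsProfile (P n)) (hP' : ∀ n, IsProfile (P' n))
    (hQ : BddWeight Q M) (hQ' : BddWeight Q' M)
    (hlim : ∀ y, Tendsto (fun n => P n y) atTop (𝓝 (Q y)))
    (hlim' : ∀ y, Tendsto (fun n => P' n y) atTop (𝓝 (Q' y))) : CutProfile Q Q' := by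
  have bdd : ∀ {c : ℕ → ℝ → ℝ} {c₀ : ℝ → ℝ} {v : ℝ → ℂ} {B : ℝ}, (∀ n, BddWeight (c n) B) →
      BddWeight c₀ B → (∀ x, Tendsto (fun n => c n x) atTop (𝓝 (c₀ x))) → MemLp v 2 →
      L2Tendsto atTop (fun n x => (c n x : ℂ) * v x) (fun x => (c₀ x : ℂ) * v x) :=
    fun hc hc0 hl hv => (L2Tendsto.const hv).bdd_mul (fun n => (hc n).aesm) hc0.aesm
      (fun n => (hc n).norm_le) hc0.norm_le
      (ae_of_all _ fun x => (Complex.continuous_ofReal.tendsto _).comp (hl x))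
  have div : ∀ {c : ℝ → ℝ} {B : ℝ} (L : ℝ), 0 < L → BddWeight c B →
      BddWeight (fun x => c x / L) (B / L) := fun L hL hc =>
    ⟨hc.meas.div_const L, fun x => by
      rw [abs_div, abs_of_pos hL]; exact div_le_div_of_nonneg_right (hc.bound x) hL.le⟩
  refine ⟨fun y hy => tendsto_nhds_unique (hlim y) (by simp [hP _ y hy]),
    fun y hy => tendsto_nhds_unique (hlim' y) (by simp [hP' _ y hy]), ?_, ?_⟩
  · intro u ux L hu hL
    refine IsH1.of_tendsto (bdd (fun n => (h n).weight.even_div L) (hQ.even_div L)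
      (fun x => tendsto_evenP hlim _) hu.memLp) ((bdd (fun n => div L hL ((h n).weight'.odd_div L))
      (div L hL (hQ'.odd_div L)) (fun x => (tendsto_oddP hlim' _).div_const L) hu.memLp).add
      (bdd (fun n => (h n).weight.even_div L) (hQ.even_div L)
      (fun x => tendsto_evenP hlim _) hu.memLp')) fun n => ((h n).even_div hL).isH1_mul hu
  · intro u ux L hu hL
    refine IsH1.of_tendsto (bdd (fun n => (h n).weight.odd_div L) (hQ.odd_div L)
      (fun x => tendsto_oddP hlim _) hu.memLp) ((bdd (fun n => div L hL ((h n).weight'.even_div L))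
      (div L hL (hQ'.even_div L)) (fun x => (tendsto_evenP hlim' _).div_const L) hu.memLp).add
      (bdd (fun n => (h n).weight.odd_div L) (hQ.odd_div L)
      (fun x => tendsto_oddP hlim _) hu.memLp')) fun n => ((h n).odd_div hL).isH1_mul hu

/-- A zero of the nonnegative function `F'F` is a minimum. This makes the value 0 of `cutK` at such
points the right one. -/
theorem IsExteriorCutoff.deriv_cutH_of_zero (hF : IsExteriorCutoff F a b) {y : ℝ}
    (h : cutH F y = 0) : deriv (cutH F) y = 0 :=
  IsLocalMin.deriv_eq_zero (Eventually.of_forall fun z => by rw [h]; exact hF.cutH_nonneg z)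

theorem isProfile_deriv_cutH (hF : IsExteriorCutoff F a b) : IsProfile (deriv (cutH F)) :=
  hF.isProfile_of_zero_off (deriv_zero_off hF.cutH_zero_off)

/-- The profile `√(F'F)` is admissible, although it need not be differentiable. -/
theorem cutProfile_sqrtFF (hF : IsExteriorCutoff F a b) (hM : CutoffBound F M) :
    CutProfile (sqrtFF F) (cutK F) := by
  set d : ℕ → ℝ := fun n => 1 / ((n : ℝ) + 1) with hd
  have d0 : ∀ n, 0 < d n := fun n => by positivity
  have dlim : Tendsto d atTop (𝓝 0) := tendsto_one_div_add_atTop_nhds_zero_nat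
  have h0 := hF.cutH_nonneg
  have hH : ∀ n y, 0 < cutH F y + d n ^ 2 := fun n y => by
    have := h0 y; have := d0 n; positivity
  have hlimH : ∀ y, Tendsto (fun n => √(cutH F y + d n ^ 2)) atTop (𝓝 √(cutH F y)) := fun y => by
    have := ((dlim.pow 2).const_add (cutH F y)).sqrt
    simpa using this
  have hB : M ≤ max M √M := le_max_left _ _
  have hsle : ∀ y, √(cutH F y) ≤ max M √M := fun y =>
    (Real.sqrt_le_sqrt ((le_abs_self _).trans (hM.wH.bound y))).trans (le_max_right _ _)
  -- Adding `d n ^ 2` under the root restores differentiability; subtracting `d n` keeps the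
  -- approximation zero where `F'F` vanishes, so it remains a profile.
  refine CutProfile.of_tendsto (M := max M √M) (P := fun n y => √(cutH F y + d n ^ 2) - d n)
    (P' := fun n y => deriv (cutH F) y / (2 * √(cutH F y + d n ^ 2))) (fun n => ⟨fun y => ?_,
    fun y => ?_, fun y => ?_⟩) (fun n y hy => ?_) (fun n y hy => ?_)
    ⟨(hF.contDiff_cutH.continuous.sqrt).measurable, fun y => ?_⟩
    ⟨measurable_cutK hF, fun y => (hM.wK y).trans hB⟩ (fun y => ?_) fun y => ?_
  · exact (((hM.wH.hasDerivAt y).add_const _).sqrt (hH n y).ne').sub_const _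
  · refine le_trans ?_ (hsle y)
    have h1 : d n ≤ √(cutH F y + d n ^ 2) := Real.le_sqrt_of_sq_le (by linarith [h0 y])
    rw [abs_of_nonneg (by linarith), sub_le_iff_le_add]
    refine Real.sqrt_le_iff.2 ⟨add_nonneg (Real.sqrt_nonneg _) (d0 n).le, ?_⟩
    nlinarith [Real.sq_sqrt (h0 y), Real.sqrt_nonneg (cutH F y), d0 n]
  · refine le_trans ?_ ((hM.wK y).trans hB)
    rcases (h0 y).eq_or_lt with h2 | h2
    · rw [hF.deriv_cutH_of_zero h2.symm, zero_div, abs_zero]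
      exact abs_nonneg _
    · rw [cutK, abs_div, abs_div, abs_of_pos (mul_pos two_pos (Real.sqrt_pos.2 (hH n y))),
        abs_of_pos (mul_pos two_pos (Real.sqrt_pos.2 h2))]
      refine div_le_div_of_nonneg_left (abs_nonneg _) (mul_pos two_pos (Real.sqrt_pos.2 h2)) ?_
      have := Real.sqrt_le_sqrt (by have := sq_nonneg (d n); linarith :
        cutH F y ≤ cutH F y + d n ^ 2)
      linarith
  · have : cutH F y = 0 := hF.isProfile_of_zero_off hF.cutH_zero_off y hy
    simp only [this, zero_add, Real.sqrt_sq (d0 n).le, sub_self]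
  · simp only [isProfile_deriv_cutH hF y hy, zero_div]
  · change |√(cutH F y)| ≤ _
    rw [abs_of_nonneg (Real.sqrt_nonneg _)]; exact hsle y
  · have := (hlimH y).sub dlim
    simpa [sqrtFF, cutH] using this
  -- At zeros of `F'F` the approximating derivatives are all zero, matching `cutK`; elsewhere the
  -- denominators have a positive limit.
  · rcases (h0 y).eq_or_lt with h2 | h2
    · simp only [cutK, hF.deriv_cutH_of_zero h2.symm, zero_div]
      exact tendsto_const_nhds
    · exact tendsto_const_nhds.div ((hlimH y).const_mul 2)
        (mul_pos two_pos (Real.sqrt_pos.2 h2)).ne'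

/-! ### The observable and the linear Morawetz term -/

/-- The vector field `sgn(x) F(|x|/L)²`. -/
def wt (F : ℝ → ℝ) (L x : ℝ) : ℝ := oddP (fun y => F y ^ 2) (x / L)

/-- The expectation is `-i (A/2 + D)`, with `A = ∫ w_x |u|²` real and `D = ∫ w u_x ū`. Integration
by parts gives `A = -2 Re D`, so only `Im D` survives and the expectation is real. -/
theorem expectation_extMorawetz (hF : IsExteriorCutoff F a b) (hM : CutoffBound F M) {β s : ℝ}
    (hs : 0 < s ^ β) {u ux : ℝ → ℂ} (hu : IsH1 u ux) :
    expectation (extMorawetz F β s) u = ((bil (wt F (s ^ β)) ux u).im : ℂ) := by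
  set L := s ^ β with hL
  have pF := hF.isProfile
  have pF' := hF.isProfile_of_zero_off hF.deriv_zero_off
  have pH := hF.isProfile_of_zero_off hF.cutH_zero_off
  have hg := (hM.wF.cutProfile pF pF').gammaOp_ae hs hu
  have wW := hM.wW.odd_div hs
  have wW' := wW.weight'
  have e1 : expectation (extMorawetz F β s) u
      = -Complex.I * ((bil (fun x => evenP (fun y => 2 * cutH F y) (x / L) / L) u u) / 2
        + bil (wt F L) ux u) := by
    have i1 := wW'.integrable hu.memLp hu.memLp
    have i2 := wW.weight.integrable hu.memLp' hu.memLp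
    rw [bil, bil, ← integral_div]
    simp only [wt]
    rw [← integral_add (i1.div_const 2) i2, ← integral_const_mul]
    refine integral_congr_ae ?_
    filter_upwards [hg] with x hx
    have e2 : extMorawetz F β s u x = (F (|x| / L) : ℂ)
        * gammaOp (fun x => (F (|x| / L) : ℂ) * u x) x := rfl
    have e3 : evenP F (x / L) * evenP (deriv F) (x / L) = evenP (fun y => 2 * cutH F y) (x / L) / 2
        := by
      rw [evenP_mul_evenP pF pF']
      simp only [evenP, cutH]
      ring
    have e4 : evenP F (x / L) * oddP F (x / L) = oddP (fun y => F y ^ 2) (x / L) := by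
      rw [evenP_mul_oddP pF pF]
      simp only [oddP]
      ring
    have e3' := congrArg (fun r : ℝ => (r : ℂ)) e3
    have e4' := congrArg (fun r : ℝ => (r : ℂ)) e4
    simp only [Complex.ofReal_mul, Complex.ofReal_div, Complex.ofReal_ofNat] at e3' e4'
    rw [e2, hx, pF.abs hs]
    push_cast
    linear_combination (-Complex.I * u x / L * (starRingEnd ℂ) (u x)) * e3'
      + (-Complex.I * ux x * (starRingEnd ℂ) (u x)) * e4'
  have e5 := wW.bil_self_deriv hu
  have e6 := bil_self_im (fun x => evenP (fun y => 2 * cutH F y) (x / L) / L) u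
  rw [e1]
  set A := bil (fun x => evenP (fun y => 2 * cutH F y) (x / L) / L) u u
  change A.re = -2 * (bil (wt F L) ux u).re at e5
  set D := bil (wt F L) ux u
  apply Complex.ext
  · simp [e6]
  · simp [e5]
    ring

theorem memGammaDomain_mulCut (hF : IsExteriorCutoff F a b) (hM : CutoffBound F M) {β s : ℝ}
    (hs : 0 < s ^ β) {u ux : ℝ → ℂ} (hu : IsH1 u ux) : MemGammaDomain (mulCut F β s u) :=
  (hM.wF.cutProfile hF.isProfile
    (hF.isProfile_of_zero_off hF.deriv_zero_off)).memGammaDomain hs hu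

theorem memGammaDomain_mulCut_sqrtFF (hF : IsExteriorCutoff F a b) (hM : CutoffBound F M) {β s : ℝ}
    (hs : 0 < s ^ β) {u ux : ℝ → ℂ} (hu : IsH1 u ux) :
    MemGammaDomain (mulCut (sqrtFF F) β s u) :=
  (cutProfile_sqrtFF hF hM).memGammaDomain hs hu

theorem locMass_eq {G : ℝ → ℝ} (hG : IsProfile G) {β s : ℝ} (hs : 0 < s ^ β) (u : ℝ → ℂ) :
    locMass G β s u = (bil (fun x => evenP G (x / s ^ β)) u u).re := by
  rw [bil_self_re, locMass]
  simp_rw [hG.abs hs]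

theorem cutK_sq (hF : IsExteriorCutoff F a b) (y : ℝ) :
    cutK F y * sqrtFF F y = deriv (cutH F) y / 2 := by
  change deriv (cutH F) y / (2 * √(cutH F y)) * √(cutH F y) = _
  rcases (hF.cutH_nonneg y).eq_or_lt with h | h
  · rw [hF.deriv_cutH_of_zero h.symm]; simp
  · have := Real.sqrt_pos.2 h
    field_simp

/-- The square in `‖γ √H u‖²` is expanded. Its cross term has weight `2 (√H)' √H = H'`, and one
integration by parts turns that into `-H''/2` against `|u|²`. Collecting the zero-order terms leaves
`4 ((√H)')² - 2H''`, which is `-G - H''`. -/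
theorem linTerm_eq (hF : IsExteriorCutoff F a b) (hM : CutoffBound F M) {β s : ℝ}
    (hs : 0 < s ^ β) {u ux : ℝ → ℂ} (hu : IsH1 u ux) :
    4 * linTerm F β s u = 4 * (bil (fun x => evenP (cutH F) (x / s ^ β)) ux ux).re
      - (bil (fun x => evenP (cutG F) (x / s ^ β)) u u).re / (s ^ β) ^ 2
      - (bil (fun x => evenP (deriv (deriv (cutH F))) (x / s ^ β)) u u).re / (s ^ β) ^ 2 := by
  set L := s ^ β with hL
  have pS := (cutProfile_sqrtFF hF hM).prof
  have pK := (cutProfile_sqrtFF hF hM).prof'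
  have hg := (cutProfile_sqrtFF hF hM).gammaOp_ae hs hu
  have wK : BddWeight (fun y => cutK F y ^ 2) (M ^ 2) :=
    ⟨(measurable_cutK hF).pow_const 2, fun y => by
      rw [abs_pow]; exact pow_le_pow_left₀ (abs_nonneg _) (hM.wK y) 2⟩
  have wG : BddWeight (cutG F) M := ⟨measurable_cutG hF, hM.wG⟩
  have wHe := hM.wH.weight.even_div L
  have wKe := wK.even_div L
  have wGe := wG.even_div L
  have wH2e := hM.wH1.weight'.even_div L
  have wo := hM.wH1.odd_div hs
  have e1 : linTerm F β s u = (bil (fun x => evenP (cutH F) (x / L)) ux ux).re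
      + (bil (fun x => evenP (fun y => cutK F y ^ 2) (x / L)) u u).re / L ^ 2
      + (bil (fun x => oddP (deriv (cutH F)) (x / L)) ux u).re / L := by
    have i1 := (wHe.integrable hu.memLp' hu.memLp').re
    have i2 := (wKe.integrable hu.memLp hu.memLp).re
    have i3 := (wo.weight.integrable hu.memLp' hu.memLp).re
    have r1 := integral_re (wHe.integrable hu.memLp' hu.memLp')
    have r2 := integral_re (wKe.integrable hu.memLp hu.memLp)
    have r3 := integral_re (wo.weight.integrable hu.memLp' hu.memLp)
    simp only [RCLike.re_to_complex] at i1 i2 i3 r1 r2 r3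
    have i12 : Integrable fun x =>
        ((evenP (cutH F) (x / L) : ℂ) * ux x * (starRingEnd ℂ) (ux x)).re +
        ((evenP (fun y => cutK F y ^ 2) (x / L) : ℂ) * u x * (starRingEnd ℂ) (u x)).re / L ^ 2 :=
      i1.add (i2.div_const _)
    rw [bil, bil, bil, ← r1, ← r2, ← r3, ← integral_div, ← integral_div,
      ← integral_add i1 (i2.div_const _), ← integral_add i12 (i3.div_const _)]
    refine integral_congr_ae ?_
    filter_upwards [hg] with x hx
    change ‖gammaOp (fun x => (sqrtFF F (|x| / L) : ℂ) * u x) x‖ ^ 2 = _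
    rw [hx, norm_mul, norm_neg, Complex.norm_I, one_mul]
    set A := evenP (cutK F) (x / L) with hA
    set B := oddP (sqrtFF F) (x / L) with hB
    have f1 : evenP (cutH F) (x / L) = B * B := by
      rw [hB, oddP_mul_oddP pS pS]
      congr 1
      ext y
      exact (Real.mul_self_sqrt (hF.cutH_nonneg y)).symm
    have f2 : evenP (fun y => cutK F y ^ 2) (x / L) = A * A := by
      rw [hA, evenP_mul_evenP pK pK]
      simp only [evenP]
      ring
    have f3 : oddP (deriv (cutH F)) (x / L) = 2 * (A * B) := by
      rw [hA, hB, evenP_mul_oddP pK pS]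
      simp only [oddP, cutK_sq hF]
      ring
    simp only [f1, f2, f3]
    rw [← Complex.normSq_eq_norm_sq, Complex.normSq_apply]
    simp only [Complex.add_re, Complex.add_im, Complex.ofReal_re, Complex.ofReal_im,
      zero_mul, sub_zero, add_zero, Complex.mul_re, Complex.mul_im, Complex.conj_re, Complex.conj_im]
    have : L ≠ 0 := hs.ne'
    field_simp
    ring
  have e2 := wo.bil_self_deriv hu
  have e3 : bil (fun x => evenP (deriv (deriv (cutH F))) (x / L) / L) u u
      = ((1 / L : ℝ) : ℂ) * bil (fun x => evenP (deriv (deriv (cutH F))) (x / L)) u u := by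
    rw [← bil_const_mul_weight]
    congr 1
    ext x
    ring
  have e4 : bil (fun x => evenP (cutG F) (x / L)) u u
      + ((4 : ℝ) : ℂ) * bil (fun x => evenP (fun y => cutK F y ^ 2) (x / L)) u u
      = bil (fun x => evenP (deriv (deriv (cutH F))) (x / L)) u u := by
    have w4 : BddWeight (fun x => 4 * evenP (fun y => cutK F y ^ 2) (x / L)) (4 * (2 * M ^ 2)) :=
      ⟨wKe.meas.const_mul 4, fun x => by
        rw [abs_mul, abs_of_pos (by norm_num : (0:ℝ) < 4)]; linarith [wKe.bound x]⟩
    rw [← bil_const_mul_weight, ← bil_add_weight wGe w4 hu.memLp hu.memLp]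
    congr 1
    ext x
    simp only [evenP, cutG]
    ring
  have e4' := congrArg Complex.re e4
  rw [e3, Complex.re_ofReal_mul] at e2
  rw [Complex.add_re, Complex.re_ofReal_mul] at e4'
  rw [e1]
  set X := (bil (fun x => evenP (deriv (deriv (cutH F))) (x / L)) u u).re
  set Y := (bil (fun x => oddP (deriv (cutH F)) (x / L)) ux u).re
  have : L ≠ 0 := hs.ne'
  have e5 : Y / L = -(X / L ^ 2) / 2 := by
    have : Y = -(1 / L * X) / 2 := by linarith
    rw [this]; field_simp
  rw [e5, ← e4']
  ring

end Cutoff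

/-! ### Evolution of products -/

/-- On `[t₀, T]`, `A` is a primitive of the bounded measurable function `a`. -/
structure LipPrim (t₀ T : ℝ) (A a : ℝ → ℂ) : Prop where
  meas : Measurable A
  meas' : Measurable a
  bound : ∃ C, ∀ s ∈ Icc t₀ T, ‖A s‖ ≤ C ∧ ‖a s‖ ≤ C
  eq : ∀ t ∈ Icc t₀ T, A t = A t₀ + ∫ s in t₀..t, a s

theorem intervalIntegrable_of_bound {E : Type*} [NormedAddCommGroup E] {t₀ T C : ℝ} {a : ℝ → E}
    (hle : t₀ ≤ T) (hm : AEStronglyMeasurable a) (hC : ∀ s ∈ Icc t₀ T, ‖a s‖ ≤ C) :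
    IntervalIntegrable a volume t₀ T := by
  rw [intervalIntegrable_iff_integrableOn_Icc_of_le hle]
  exact Measure.integrableOn_of_bounded (M := C) (by simp) hm
    ((ae_restrict_iff' measurableSet_Icc).2 (ae_of_all _ hC))

theorem LipPrim.intervalIntegrable {t₀ T : ℝ} {A a : ℝ → ℂ} (h : LipPrim t₀ T A a)
    (hle : t₀ ≤ T) : IntervalIntegrable a volume t₀ T := by
  obtain ⟨C, hC⟩ := h.bound
  exact intervalIntegrable_of_bound hle h.meas'.aestronglyMeasurable fun s hs => (hC s hs).2

theorem lipschitzOnWith_primitive {t₀ T C : ℝ} {a : ℝ → ℂ} (hle : t₀ ≤ T)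
    (hm : Measurable a) (hC : ∀ s ∈ Icc t₀ T, ‖a s‖ ≤ C) :
    LipschitzOnWith C.toNNReal (fun t => ∫ s in t₀..t, a s) (uIcc t₀ T) := by
  have hint := intervalIntegrable_of_bound hle hm.aestronglyMeasurable hC
  have hC0 : 0 ≤ C := (norm_nonneg _).trans (hC t₀ (left_mem_Icc.2 hle))
  refine LipschitzOnWith.of_dist_le_mul fun x hx y hy => ?_
  have s1 : ∀ z ∈ uIcc t₀ T, IntervalIntegrable a volume t₀ z := fun z hz =>
    hint.mono_set (uIcc_subset_uIcc left_mem_uIcc hz)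
  rw [dist_eq_norm, intervalIntegral.integral_interval_sub_left (s1 x hx) (s1 y hy),
    Real.coe_toNNReal C hC0, Real.dist_eq]
  refine intervalIntegral.norm_integral_le_of_norm_le_const fun z hz => hC z ?_
  rw [← uIcc_of_le hle]
  exact uIcc_subset_uIcc hy hx (uIoc_subset_uIcc hz)

/-- Primitives of bounded functions are Lipschitz, hence absolutely continuous. The product rule
holds almost everywhere in time, and absolute continuity promotes it to the integrated form. -/
theorem LipPrim.mul {t₀ T : ℝ} {A a B b : ℝ → ℂ} (hA : LipPrim t₀ T A a) (hB : LipPrim t₀ T B b) :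
    LipPrim t₀ T (fun s => A s * B s) (fun s => a s * B s + A s * b s) := by
  obtain ⟨C, hC⟩ := hA.bound
  obtain ⟨D, hD⟩ := hB.bound
  have hbd : ∀ s ∈ Icc t₀ T, ‖a s * B s + A s * b s‖ ≤ 2 * (C * D) := fun s hs => by
    have c0 := (norm_nonneg _).trans (hC s hs).1
    refine (norm_add_le _ _).trans ?_
    rw [norm_mul, norm_mul]
    have h1 : ‖a s‖ * ‖B s‖ ≤ C * D :=
      mul_le_mul (hC s hs).2 (hD s hs).1 (norm_nonneg _) c0
    have h2 : ‖A s‖ * ‖b s‖ ≤ C * D :=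
      mul_le_mul (hC s hs).1 (hD s hs).2 (norm_nonneg _) c0
    linarith
  refine ⟨hA.meas.mul hB.meas, (hA.meas'.mul hB.meas).add (hA.meas.mul hB.meas'),
    ⟨2 * (C * D), fun s hs => ⟨?_, hbd s hs⟩⟩, fun t ht => ?_⟩
  · have c0 := (norm_nonneg _).trans (hC s hs).1
    have d0 := (norm_nonneg _).trans (hD s hs).1
    rw [norm_mul]
    have := mul_le_mul (hC s hs).1 (hD s hs).1 (norm_nonneg _) c0
    nlinarith [mul_nonneg c0 d0]
  have hle : t₀ ≤ T := ht.1.trans ht.2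
  -- `A` is controlled only on `[t₀, T]`, whereas a derivative at an endpoint sees both sides; the
  -- primitive is defined on the whole line.
  set A' : ℝ → ℂ := fun t => A t₀ + ∫ s in t₀..t, a s with hA'
  set B' : ℝ → ℂ := fun t => B t₀ + ∫ s in t₀..t, b s with hB'
  set c : ℝ → ℂ := fun s => a s * B s + A s * b s with hc
  have cm : Measurable c := (hA.meas'.mul hB.meas).add (hA.meas.mul hB.meas')
  have eA : ∀ s ∈ Icc t₀ T, A s = A' s := fun s hs => hA.eq s hs
  have eB : ∀ s ∈ Icc t₀ T, B s = B' s := fun s hs => hB.eq s hs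
  have ci := intervalIntegrable_of_bound hle cm.aestronglyMeasurable hbd
  have lipA : AbsolutelyContinuousOnInterval A' t₀ T :=
    ((LipschitzWith.const (A t₀)).lipschitzOnWith.add (lipschitzOnWith_primitive hle hA.meas'
      fun s hs => (hC s hs).2)).absolutelyContinuousOnInterval
  have lipB : AbsolutelyContinuousOnInterval B' t₀ T :=
    ((LipschitzWith.const (B t₀)).lipschitzOnWith.add (lipschitzOnWith_primitive hle hB.meas'
      fun s hs => (hD s hs).2)).absolutelyContinuousOnInterval
  have lipc : AbsolutelyContinuousOnInterval (fun t => ∫ s in t₀..t, c s) t₀ T :=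
    (lipschitzOnWith_primitive hle cm hbd).absolutelyContinuousOnInterval
  -- This absolutely continuous difference has zero derivative almost everywhere, so it is constant.
  have hac := (lipA.fun_smul lipB).sub lipc
  obtain ⟨E, hE⟩ := hac.const_of_ae_hasDerivAt_zero (by
    filter_upwards [(hA.intervalIntegrable hle).ae_hasDerivAt_integral,
      (hB.intervalIntegrable hle).ae_hasDerivAt_integral, ci.ae_hasDerivAt_integral]
      with x h1 h2 h3 hx
    have d1 : HasDerivAt A' (a x) x := (h1 hx t₀ left_mem_uIcc).const_add _
    have d2 : HasDerivAt B' (b x) x := (h2 hx t₀ left_mem_uIcc).const_add _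
    have d3 := h3 hx t₀ left_mem_uIcc
    have hx' : x ∈ Icc t₀ T := by rwa [uIcc_of_le hle] at hx
    refine ((d1.mul d2).sub d3).congr_deriv ?_
    simp only [hc, eA x hx', eB x hx', sub_self])
  have e1 := hE t₀ left_mem_uIcc
  have e2 := hE t (by rw [uIcc_of_le hle]; exact ht)
  simp only [Pi.sub_apply, smul_eq_mul, intervalIntegral.integral_same, sub_zero] at e1 e2
  rw [eA t ht, eB t ht, eA t₀ (left_mem_Icc.2 hle), eB t₀ (left_mem_Icc.2 hle), e1, ← e2]
  ring

theorem LipPrim.conj {t₀ T : ℝ} {A a : ℝ → ℂ} (hA : LipPrim t₀ T A a) :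
    LipPrim t₀ T (fun s => (starRingEnd ℂ) (A s)) (fun s => (starRingEnd ℂ) (a s)) := by
  obtain ⟨C, hC⟩ := hA.bound
  refine ⟨Complex.continuous_conj.measurable.comp hA.meas,
    Complex.continuous_conj.measurable.comp hA.meas', ⟨C, fun s hs => ?_⟩, fun t ht => ?_⟩
  · simpa only [RCLike.norm_conj] using hC s hs
  · rw [hA.eq t ht, map_add, intervalIntegral.integral_of_le ht.1,
      intervalIntegral.integral_of_le ht.1, ← integral_conj]

theorem LipPrim.of_hasDerivAt {t₀ T C : ℝ} {m m' : ℝ → ℝ} (hm : Measurable m) (hm' : Measurable m')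
    (hd : ∀ s ∈ Icc t₀ T, HasDerivAt m (m' s) s) (hC : ∀ s ∈ Icc t₀ T, |m s| ≤ C)
    (hC' : ∀ s ∈ Icc t₀ T, |m' s| ≤ C) :
    LipPrim t₀ T (fun s => (m s : ℂ)) (fun s => (m' s : ℂ)) := by
  refine ⟨Complex.measurable_ofReal.comp hm, Complex.measurable_ofReal.comp hm',
    ⟨C, fun s hs => ?_⟩, fun t ht => ?_⟩
  · rw [Complex.norm_real, Complex.norm_real]; exact ⟨hC s hs, hC' s hs⟩
  · have sub : Icc t₀ t ⊆ Icc t₀ T := Icc_subset_Icc_right ht.2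
    have hi : IntervalIntegrable m' volume t₀ t :=
      intervalIntegrable_of_bound ht.1 hm'.aestronglyMeasurable fun s hs => hC' s (sub hs)
    rw [intervalIntegral.integral_ofReal, intervalIntegral.integral_eq_sub_of_hasDerivAt
      (fun s hs => hd s (sub (by rwa [uIcc_of_le ht.1] at hs))) hi]
    push_cast
    ring

/-- Integration in space of a family of primitives in time. -/
theorem integral_sub_integral_of_primitive {t₀ T C : ℝ} (hle : t₀ ≤ T) {Z I : ℝ → ℝ → ℂ}
    (hm : Measurable (Function.uncurry I)) (hI : ∀ s ∈ Icc t₀ T, Integrable (I s))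
    (hC : ∀ s ∈ Icc t₀ T, ∫ x, ‖I s x‖ ≤ C) (h0 : Integrable (Z t₀)) (hT : Integrable (Z T))
    (heq : ∀ x, Z T x = Z t₀ x + ∫ s in t₀..T, I s x) :
    (∫ x, Z T x) - ∫ x, Z t₀ x = ∫ s in t₀..T, ∫ x, I s x := by
  have hsub : Ioc t₀ T ⊆ Icc t₀ T := Ioc_subset_Icc_self
  have hint : Integrable (Function.uncurry I) ((volume.restrict (Ioc t₀ T)).prod volume) := by
    rw [integrable_prod_iff hm.aestronglyMeasurable]
    constructor
    · exact (ae_restrict_iff' measurableSet_Ioc).2 (ae_of_all _ fun s hs => hI s (hsub hs))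
    · refine Measure.integrableOn_of_bounded (M := C) (by simp)
        hm.norm.stronglyMeasurable.integral_prod_right.aestronglyMeasurable ?_
      refine (ae_restrict_iff' measurableSet_Ioc).2 (ae_of_all _ fun s hs => ?_)
      rw [Real.norm_of_nonneg (integral_nonneg fun _ => norm_nonneg _)]
      exact hC s (hsub hs)
  rw [← integral_sub hT h0, intervalIntegral.integral_of_le hle, integral_integral_swap hint]
  refine integral_congr_ae (ae_of_all _ fun x => ?_)
  simp only
  rw [heq x, intervalIntegral.integral_of_le hle]
  ring

/-! ### Time evolution of weighted forms -/

/-- A jointly measurable family which is bounded in `L²` for times in `[t₀, T]`. -/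
structure L2Fam (t₀ T : ℝ) (A : ℝ → ℝ → ℂ) : Prop where
  meas : Measurable (Function.uncurry A)
  memLp : ∀ s, MemLp (A s) 2
  bound : ∃ C, ∀ s ∈ Icc t₀ T, l2n (A s) ≤ C

/-- A space-time weight `m` with `∂ₛ m = ms` and `∂ₓ m = mx` on `[t₀, T]`, all bounded. -/
structure STWeight (t₀ T : ℝ) (m ms mx : ℝ → ℝ → ℝ) (M : ℝ) : Prop where
  meas : Measurable (Function.uncurry m)
  meas_s : Measurable (Function.uncurry ms)
  meas_x : Measurable (Function.uncurry mx)
  time : ∀ x, ∀ s ∈ Icc t₀ T, HasDerivAt (fun s => m s x) (ms s x) s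
  space : ∀ s ∈ Icc t₀ T, C1Weight (m s) (mx s) M
  bound_s : ∀ s ∈ Icc t₀ T, ∀ x, |ms s x| ≤ M

theorem bddWeight_slice {m : ℝ → ℝ → ℝ} {M s : ℝ} (h : Measurable (Function.uncurry m))
    (hb : ∀ x, |m s x| ≤ M) : BddWeight (m s) M :=
  ⟨h.comp measurable_prodMk_left, hb⟩

theorem STWeight.weight_s {t₀ T M s : ℝ} {m ms mx : ℝ → ℝ → ℝ} (h : STWeight t₀ T m ms mx M)
    (hs : s ∈ Icc t₀ T) : BddWeight (ms s) M :=
  bddWeight_slice h.meas_s (h.bound_s s hs)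

theorem BddWeight.integral_norm_le {m : ℝ → ℝ} {M : ℝ} (h : BddWeight m M) {f g : ℝ → ℂ}
    (hf : MemLp f 2) (hg : MemLp g 2) :
    ∫ x, ‖(m x : ℂ) * f x * (starRingEnd ℂ) (g x)‖ ≤ M * (l2n f * l2n g) := by
  simpa only [l2n_conj] using integral_norm_bdd_mul_mul_le hf (MemLp.conj hg) h.aesm h.norm_le

theorem measurable_term {m : ℝ → ℝ → ℝ} {P Q : ℝ → ℝ → ℂ} (hm : Measurable (Function.uncurry m))
    (hP : Measurable (Function.uncurry P)) (hQ : Measurable (Function.uncurry Q)) :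
    Measurable (Function.uncurry fun s x => (m s x : ℂ) * P s x * (starRingEnd ℂ) (Q s x)) :=
  ((Complex.measurable_ofReal.comp hm).mul hP).mul (Complex.continuous_conj.measurable.comp hQ)

theorem measurable_bil {m : ℝ → ℝ → ℝ} {P Q : ℝ → ℝ → ℂ} (hm : Measurable (Function.uncurry m))
    (hP : Measurable (Function.uncurry P)) (hQ : Measurable (Function.uncurry Q)) :
    Measurable fun s => bil (m s) (P s) (Q s) :=
  (measurable_term hm hP hQ).stronglyMeasurable.integral_prod_right.measurable

theorem L2Fam.exists_bil_bound {t₀ T M : ℝ} {A B : ℝ → ℝ → ℂ} (hA : L2Fam t₀ T A)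
    (hB : L2Fam t₀ T B) (hM : 0 ≤ M) :
    ∃ C, ∀ s ∈ Icc t₀ T, M * (l2n (A s) * l2n (B s)) ≤ C := by
  obtain ⟨C, hC⟩ := hA.bound
  obtain ⟨D, hD⟩ := hB.bound
  refine ⟨M * (C * D), fun s hs => ?_⟩
  exact mul_le_mul_of_nonneg_left (mul_le_mul (hC s hs) (hD s hs) (l2n_nonneg _)
    ((l2n_nonneg _).trans (hC s hs))) hM

/-- The evolution of a weighted form of two families which are differentiable in time. -/
theorem bil_evolution {t₀ T M : ℝ} (hle : t₀ ≤ T) {m ms mx : ℝ → ℝ → ℝ}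
    (hm : STWeight t₀ T m ms mx M)
    {A a B b : ℝ → ℝ → ℂ} (hA : L2Fam t₀ T A) (ha : L2Fam t₀ T a) (hB : L2Fam t₀ T B)
    (hb : L2Fam t₀ T b) (pA : ∀ x, LipPrim t₀ T (fun s => A s x) (fun s => a s x))
    (pB : ∀ x, LipPrim t₀ T (fun s => B s x) (fun s => b s x)) :
    bil (m T) (A T) (B T) - bil (m t₀) (A t₀) (B t₀) = ∫ s in t₀..T,
      (bil (ms s) (A s) (B s) + bil (m s) (a s) (B s) + bil (m s) (A s) (b s)) := by
  have hl : t₀ ∈ Icc t₀ T := left_mem_Icc.2 hle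
  have hr : T ∈ Icc t₀ T := right_mem_Icc.2 hle
  have hM : 0 ≤ M := (abs_nonneg _).trans (hm.bound_s t₀ hl 0)
  have i1 : ∀ s ∈ Icc t₀ T, Integrable fun x => (ms s x : ℂ) * A s x * (starRingEnd ℂ) (B s x) :=
    fun s hs => (hm.weight_s hs).integrable (hA.memLp s) (hB.memLp s)
  have i2 : ∀ s ∈ Icc t₀ T, Integrable fun x => (m s x : ℂ) * a s x * (starRingEnd ℂ) (B s x) :=
    fun s hs => (hm.space s hs).weight.integrable (ha.memLp s) (hB.memLp s)
  have i3 : ∀ s ∈ Icc t₀ T, Integrable fun x => (m s x : ℂ) * A s x * (starRingEnd ℂ) (b s x) :=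
    fun s hs => (hm.space s hs).weight.integrable (hA.memLp s) (hb.memLp s)
  have i12 : ∀ s ∈ Icc t₀ T, Integrable fun x => (ms s x : ℂ) * A s x * (starRingEnd ℂ) (B s x)
      + (m s x : ℂ) * a s x * (starRingEnd ℂ) (B s x) := fun s hs => (i1 s hs).add (i2 s hs)
  obtain ⟨C1, h1⟩ := hA.exists_bil_bound hB hM
  obtain ⟨C2, h2⟩ := ha.exists_bil_bound hB hM
  obtain ⟨C3, h3⟩ := hA.exists_bil_bound hb hM
  have key := integral_sub_integral_of_primitive (C := C1 + C2 + C3) hle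
    (Z := fun s x => (m s x : ℂ) * A s x * (starRingEnd ℂ) (B s x))
    (I := fun s x => (ms s x : ℂ) * A s x * (starRingEnd ℂ) (B s x)
      + (m s x : ℂ) * a s x * (starRingEnd ℂ) (B s x)
      + (m s x : ℂ) * A s x * (starRingEnd ℂ) (b s x))
    (((measurable_term hm.meas_s hA.meas hB.meas).add
      (measurable_term hm.meas ha.meas hB.meas)).add (measurable_term hm.meas hA.meas hb.meas))
    (fun s hs => (i12 s hs).add (i3 s hs)) (fun s hs => ?_)
    ((hm.space _ hl).weight.integrable (hA.memLp _) (hB.memLp _))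
    ((hm.space _ hr).weight.integrable (hA.memLp _) (hB.memLp _)) (fun x => ?_)
  · rw [bil, bil, key]
    refine intervalIntegral.integral_congr fun s hs => ?_
    rw [uIcc_of_le hle] at hs
    rw [integral_add (i12 s hs) (i3 s hs), integral_add (i1 s hs) (i2 s hs)]
    rfl
  · calc _ ≤ ∫ x, (‖(ms s x : ℂ) * A s x * (starRingEnd ℂ) (B s x)‖
          + ‖(m s x : ℂ) * a s x * (starRingEnd ℂ) (B s x)‖
          + ‖(m s x : ℂ) * A s x * (starRingEnd ℂ) (b s x)‖) :=
          integral_mono ((i12 s hs).add (i3 s hs)).norm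
            (((i1 s hs).norm.add (i2 s hs).norm).add (i3 s hs).norm) fun x => norm_add₃_le
      _ = (∫ x, ‖(ms s x : ℂ) * A s x * (starRingEnd ℂ) (B s x)‖)
          + (∫ x, ‖(m s x : ℂ) * a s x * (starRingEnd ℂ) (B s x)‖)
          + ∫ x, ‖(m s x : ℂ) * A s x * (starRingEnd ℂ) (b s x)‖ := by
          have i12n : Integrable fun x => ‖(ms s x : ℂ) * A s x * (starRingEnd ℂ) (B s x)‖
            + ‖(m s x : ℂ) * a s x * (starRingEnd ℂ) (B s x)‖ := (i1 s hs).norm.add (i2 s hs).norm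
          rw [integral_add i12n (i3 s hs).norm, integral_add (i1 s hs).norm (i2 s hs).norm]
      _ ≤ _ := add_le_add (add_le_add
          (((hm.weight_s hs).integral_norm_le (hA.memLp s) (hB.memLp s)).trans (h1 s hs))
          (((hm.space s hs).weight.integral_norm_le (ha.memLp s) (hB.memLp s)).trans (h2 s hs)))
          (((hm.space s hs).weight.integral_norm_le (hA.memLp s) (hb.memLp s)).trans (h3 s hs))
  · have pm : LipPrim t₀ T (fun s => (m s x : ℂ)) (fun s => (ms s x : ℂ)) :=
      LipPrim.of_hasDerivAt (hm.meas.comp measurable_prodMk_right)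
        (hm.meas_s.comp measurable_prodMk_right) (hm.time x)
        (fun s hs => (hm.space s hs).bound x) (fun s hs => hm.bound_s s hs x)
    rw [((pm.mul (pA x)).mul (pB x).conj).eq T hr]
    congr 1
    refine intervalIntegral.integral_congr fun s _ => ?_
    ring

/-- Besides the limit of the integrals this yields integrability of the limiting rate, whose
measurability in time is inherited from the approximations and need not be shown directly. -/
theorem tendsto_intervalIntegral_of_bounded {t₀ T C : ℝ} (hle : t₀ ≤ T) {D : ℕ → ℝ → ℝ}
    {D₀ : ℝ → ℝ} (hm : ∀ n, Measurable (D n)) (hb : ∀ n, ∀ s ∈ Icc t₀ T, |D n s| ≤ C)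
    (hl : ∀ s ∈ Icc t₀ T, Tendsto (fun n => D n s) atTop (𝓝 (D₀ s))) :
    IntervalIntegrable D₀ volume t₀ T ∧
      Tendsto (fun n => ∫ s in t₀..T, D n s) atTop (𝓝 (∫ s in t₀..T, D₀ s)) := by
  have hsub : uIoc t₀ T ⊆ Icc t₀ T := by rw [uIoc_of_le hle]; exact Ioc_subset_Icc_self
  constructor
  · rw [intervalIntegrable_iff_integrableOn_Icc_of_le hle]
    refine Integrable.of_bound (aestronglyMeasurable_of_tendsto_ae (u := atTop) (f := D) (fun n =>
      (hm n).aestronglyMeasurable) ((ae_restrict_iff' measurableSet_Icc).2 (ae_of_all _ hl))) C ?_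
    refine (ae_restrict_iff' measurableSet_Icc).2 (ae_of_all _ fun s hs => ?_)
    exact le_of_tendsto (hl s hs).norm (Eventually.of_forall fun n => hb n s hs)
  · refine intervalIntegral.tendsto_integral_filter_of_dominated_convergence (fun _ => C)
      (Eventually.of_forall fun n => (hm n).aestronglyMeasurable)
      (Eventually.of_forall fun n => ae_of_all _ fun s hs => hb n s (hsub hs))
      intervalIntegrable_const (ae_of_all _ fun s hs => hl s (hsub hs))

/-! ### The Schrödinger evolution -/

/-- `u ∈ C(ℝ; H¹)` solves `i ∂ₜ u = -∂ₓ² u + f` for positive times, in the sense of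
distributions, with a locally bounded source `f`. -/
structure Evolution (u ux f : ℝ → ℝ → ℂ) : Prop where
  isH1 : ∀ s, IsH1 (u s) (ux s)
  cont : ∀ s, L2Tendsto (𝓝 s) u (u s)
  cont' : ∀ s, L2Tendsto (𝓝 s) ux (ux s)
  memLp_f : ∀ s, MemLp (f s) 2
  bdd_f : ∀ t₀ T, ∃ C, ∀ s ∈ Icc t₀ T, l2n (f s) ≤ C
  meas_f : ∀ φ, IsTest φ → Measurable fun s => ∫ x, f s x * φ x
  eq : ∀ φ, IsTest φ → ∀ t₀ t, 0 ≤ t₀ → t₀ ≤ t →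
    Complex.I * ((∫ x, u t x * φ x) - ∫ x, u t₀ x * φ x) =
      ∫ s in t₀..t, (-(∫ x, u s x * deriv (deriv φ) x) + ∫ x, f s x * φ x)

theorem exists_l2n_bound {P : ℝ → ℝ → ℂ} (h : ∀ s, L2Tendsto (𝓝 s) P (P s)) (t₀ T : ℝ) :
    ∃ C, ∀ s ∈ Icc t₀ T, l2n (P s) ≤ C := by
  have hc : Continuous fun s => l2n (P s) := continuous_iff_continuousAt.2 fun s =>
    (h s).tendsto_l2n
  obtain ⟨C, hC⟩ := (isCompact_Icc (a := t₀) (b := T)).exists_bound_of_continuousOn hc.continuousOn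
  exact ⟨C, fun s hs => (le_abs_self _).trans (hC s hs)⟩

theorem continuous_integral_mul {P : ℝ → ℝ → ℂ} (h : ∀ s, L2Tendsto (𝓝 s) P (P s)) {φ : ℝ → ℂ}
    (hφ : MemLp φ 2) : Continuous fun s => ∫ x, P s x * φ x :=
  continuous_iff_continuousAt.2 fun s => (h s).tendsto_integral_mul (L2Tendsto.const hφ)

/-- A representative of `g s` is chosen separately at each time, so `g` itself need not be jointly
measurable. Its mollification is a Carathéodory function: continuous in `x`, and measurable in `s`
as a pairing with a test function. -/
theorem measurable_uncurry_mol {k : ℝ → ℂ} (hk : IsTest k) {g : ℝ → ℝ → ℂ}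
    (hg : ∀ s, MemLp (g s) 2) (hm : ∀ φ, IsTest φ → Measurable fun s => ∫ x, g s x * φ x) :
    Measurable (Function.uncurry fun s x => mol k (g s) x) := by
  have := (stronglyMeasurable_uncurry_of_continuous_of_stronglyMeasurable
    (u := fun x s => mol k (g s) x)
    (fun s => continuous_mol hk (MemLp.locallyIntegrable_two (hg s)))
    fun x => (hm _ (hk.comp_sub x)).stronglyMeasurable).measurable
  exact this.comp measurable_swap

theorem norm_mol_le {k g : ℝ → ℂ} (hk : IsTest k) (hg : MemLp g 2) (x : ℝ) :
    ‖mol k g x‖ ≤ l2n g * l2n (fun y => k (x - y)) :=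
  (norm_integral_le_integral_norm _).trans (integral_norm_mul_le hg (hk.comp_sub x).memLp)

theorem l2Fam_mol {k : ℝ → ℂ} (hk : IsTest k) {g : ℝ → ℝ → ℂ} {t₀ T : ℝ}
    (hg : ∀ s, MemLp (g s) 2) (hm : ∀ φ, IsTest φ → Measurable fun s => ∫ x, g s x * φ x)
    (hb : ∃ C, ∀ s ∈ Icc t₀ T, l2n (g s) ≤ C) : L2Fam t₀ T fun s => mol k (g s) := by
  refine ⟨measurable_uncurry_mol hk hg hm, fun s => memLp_mol hk (hg s), ?_⟩
  obtain ⟨C, hC⟩ := hb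
  exact ⟨_, fun s hs => (l2n_mol_le hk (hg s)).trans
    (mul_le_mul_of_nonneg_left (hC s hs) ENNReal.toReal_nonneg)⟩

theorem l2n_add_le {f g : ℝ → ℂ} (hf : MemLp f 2) (hg : MemLp g 2) :
    l2n (fun x => f x + g x) ≤ l2n f + l2n g := by
  rw [l2n, l2n, l2n, ← ENNReal.toReal_add hf.2.ne hg.2.ne]
  exact ENNReal.toReal_mono (by simp [hf.2.ne, hg.2.ne]) (eLpNorm_add_le hf.1 hg.1 (by norm_num))

theorem l2n_const_mul (c : ℂ) (f : ℝ → ℂ) : l2n (fun x => c * f x) = ‖c‖ * l2n f := by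
  have : eLpNorm (fun x => c * f x) 2 volume = ‖c‖ₑ * eLpNorm f 2 volume :=
    eLpNorm_const_smul c f 2 volume
  rw [l2n, l2n, this, ENNReal.toReal_mul]
  simp

theorem L2Fam.const_mul {t₀ T : ℝ} {A : ℝ → ℝ → ℂ} (h : L2Fam t₀ T A) (c : ℂ) :
    L2Fam t₀ T fun s x => c * A s x := by
  refine ⟨h.meas.const_mul c, fun s => (h.memLp s).const_mul c, ?_⟩
  obtain ⟨C, hC⟩ := h.bound
  exact ⟨‖c‖ * C, fun s hs => by
    rw [l2n_const_mul]; exact mul_le_mul_of_nonneg_left (hC s hs) (norm_nonneg _)⟩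

theorem L2Fam.add {t₀ T : ℝ} {A B : ℝ → ℝ → ℂ} (h : L2Fam t₀ T A) (h' : L2Fam t₀ T B) :
    L2Fam t₀ T fun s x => A s x + B s x := by
  refine ⟨h.meas.add h'.meas, fun s => (h.memLp s).add (h'.memLp s), ?_⟩
  obtain ⟨C, hC⟩ := h.bound
  obtain ⟨D, hD⟩ := h'.bound
  exact ⟨C + D, fun s hs => (l2n_add_le (h.memLp s) (h'.memLp s)).trans
    (add_le_add (hC s hs) (hD s hs))⟩

section

variable {u ux f : ℝ → ℝ → ℂ} {t₀ T : ℝ}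

theorem Evolution.l2Fam_u (h : Evolution u ux f) {k : ℝ → ℂ} (hk : IsTest k) :
    L2Fam t₀ T fun s => mol k (u s) :=
  l2Fam_mol hk (fun s => (h.isH1 s).memLp)
    (fun _ hφ => (continuous_integral_mul h.cont hφ.memLp).measurable) (exists_l2n_bound h.cont _ _)

theorem Evolution.l2Fam_ux (h : Evolution u ux f) {k : ℝ → ℂ} (hk : IsTest k) :
    L2Fam t₀ T fun s => mol k (ux s) :=
  l2Fam_mol hk (fun s => (h.isH1 s).memLp')
    (fun _ hφ => (continuous_integral_mul h.cont' hφ.memLp).measurable)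
    (exists_l2n_bound h.cont' _ _)

theorem Evolution.l2Fam_f (h : Evolution u ux f) {k : ℝ → ℂ} (hk : IsTest k) :
    L2Fam t₀ T fun s => mol k (f s) :=
  l2Fam_mol hk h.memLp_f h.meas_f (h.bdd_f _ _)

/-- The time derivative of the mollification of a solution. -/
def dtMol (k : ℝ → ℂ) (u f : ℝ → ℝ → ℂ) (s x : ℝ) : ℂ :=
  Complex.I * mol (deriv (deriv k)) (u s) x + -Complex.I * mol k (f s) x

theorem Evolution.l2Fam_dtMol (h : Evolution u ux f) {k : ℝ → ℂ} (hk : IsTest k) :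
    L2Fam t₀ T (dtMol k u f) :=
  ((h.l2Fam_u hk.deriv.deriv).const_mul _).add ((h.l2Fam_f hk).const_mul _)

theorem L2Fam.measurable_slice {A : ℝ → ℝ → ℂ} (h : L2Fam t₀ T A) (x : ℝ) :
    Measurable fun s => A s x := h.meas.comp measurable_prodMk_right

theorem exists_norm_mol_bound {k : ℝ → ℂ} (hk : IsTest k) {g : ℝ → ℝ → ℂ}
    (hg : ∀ s, MemLp (g s) 2) (hb : ∃ C, ∀ s ∈ Icc t₀ T, l2n (g s) ≤ C) (x : ℝ) :
    ∃ C, ∀ s ∈ Icc t₀ T, ‖mol k (g s) x‖ ≤ C := by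
  obtain ⟨C, hC⟩ := hb
  exact ⟨_, fun s hs => (norm_mol_le hk (hg s) x).trans
    (mul_le_mul_of_nonneg_right (hC s hs) (l2n_nonneg _))⟩

/-- The distributional equation tested against `y ↦ k (x - y)` is an integral equation in time at
each fixed `x`; the two reflections in the second derivative cancel. -/
theorem Evolution.lipPrim (h : Evolution u ux f) {k : ℝ → ℂ} (hk : IsTest k) (h0 : 0 ≤ t₀)
    (x : ℝ) : LipPrim t₀ T (fun s => mol k (u s) x) (fun s => dtMol k u f s x) := by
  have hu : ∀ s, MemLp (u s) 2 := fun s => (h.isH1 s).memLp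
  obtain ⟨C1, h1⟩ := exists_norm_mol_bound hk hu (exists_l2n_bound h.cont t₀ T) x
  obtain ⟨C2, h2⟩ := exists_norm_mol_bound hk.deriv.deriv hu (exists_l2n_bound h.cont t₀ T) x
  obtain ⟨C3, h3⟩ := exists_norm_mol_bound hk h.memLp_f (h.bdd_f t₀ T) x
  refine ⟨(h.l2Fam_u (t₀ := t₀) (T := T) hk).measurable_slice x,
    (h.l2Fam_dtMol (t₀ := t₀) (T := T) hk).measurable_slice x,
    ⟨max C1 (C2 + C3), fun s hs => ⟨(h1 s hs).trans (le_max_left _ _), ?_⟩⟩, fun t ht => ?_⟩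
  · refine le_trans ?_ (le_max_right _ _)
    refine (norm_add_le _ _).trans ?_
    rw [norm_mul, norm_mul, norm_neg, Complex.norm_I, one_mul, one_mul]
    exact add_le_add (h2 s hs) (h3 s hs)
  · have e := h.eq _ (hk.comp_sub x) t₀ t h0 ht.1
    have e2 : ∀ y, deriv (deriv fun y => k (x - y)) y = deriv (deriv k) (x - y) := fun y => by
      rw [deriv_comp_const_sub', deriv.fun_neg, deriv_comp_const_sub (f := deriv k)]
      simp
    simp_rw [e2] at e
    change Complex.I * (mol k (u t) x - mol k (u t₀) x) = ∫ s in t₀..t,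
      (-(mol (deriv (deriv k)) (u s) x) + mol k (f s) x) at e
    have e3 : ∫ s in t₀..t, dtMol k u f s x = -Complex.I * ∫ s in t₀..t,
        (-(mol (deriv (deriv k)) (u s) x) + mol k (f s) x) := by
      rw [← intervalIntegral.integral_const_mul]
      refine intervalIntegral.integral_congr fun s _ => ?_
      simp only [dtMol]
      ring
    rw [e3, ← e]
    linear_combination (mol k (u t) x - mol k (u t₀) x) * Complex.I_mul_I

end

/-! ### The local mass law and the Morawetz identity as limits of mollified identities -/

/-- A weakly measurable family which is bounded in `L²` for times in `[t₀, T]`. -/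
structure MeasFam (t₀ T : ℝ) (g : ℝ → ℝ → ℂ) : Prop where
  memLp : ∀ s, MemLp (g s) 2
  meas : ∀ φ, IsTest φ → Measurable fun s => ∫ x, g s x * φ x
  bound : ∃ C, ∀ s ∈ Icc t₀ T, l2n (g s) ≤ C

section

variable {u ux f : ℝ → ℝ → ℂ} {t₀ T M : ℝ}

theorem Evolution.fam_u (h : Evolution u ux f) : MeasFam t₀ T u :=
  ⟨fun s => (h.isH1 s).memLp, fun _ hφ => (continuous_integral_mul h.cont hφ.memLp).measurable,
    exists_l2n_bound h.cont _ _⟩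

theorem Evolution.fam_ux (h : Evolution u ux f) : MeasFam t₀ T ux :=
  ⟨fun s => (h.isH1 s).memLp', fun _ hφ => (continuous_integral_mul h.cont' hφ.memLp).measurable,
    exists_l2n_bound h.cont' _ _⟩

theorem Evolution.fam_f (h : Evolution u ux f) : MeasFam t₀ T f :=
  ⟨h.memLp_f, h.meas_f, h.bdd_f _ _⟩

/-- The form of two mollified families. -/
def molBil (n : ℕ) (m : ℝ → ℝ → ℝ) (g g' : ℝ → ℝ → ℂ) (s : ℝ) : ℂ :=
  bil (m s) (mol (rho n) (g s)) (mol (rho n) (g' s))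

theorem measurable_molBil {m : ℝ → ℝ → ℝ} {g g' : ℝ → ℝ → ℂ}
    (hm : Measurable (Function.uncurry m)) (hg : MeasFam t₀ T g) (hg' : MeasFam t₀ T g') (n : ℕ) :
    Measurable (molBil n m g g') :=
  measurable_bil hm (measurable_uncurry_mol (isTest_rho n) hg.memLp hg.meas)
    (measurable_uncurry_mol (isTest_rho n) hg'.memLp hg'.meas)

theorem exists_molBil_bound {m : ℝ → ℝ → ℝ} {g g' : ℝ → ℝ → ℂ}
    (hm : ∀ s ∈ Icc t₀ T, BddWeight (m s) M) (hg : MeasFam t₀ T g) (hg' : MeasFam t₀ T g') :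
    ∃ C, ∀ n, ∀ s ∈ Icc t₀ T, ‖molBil n m g g' s‖ ≤ C := by
  obtain ⟨C, hC⟩ := hg.bound
  obtain ⟨D, hD⟩ := hg'.bound
  refine ⟨M * (C * D), fun n s hs => ((hm s hs).norm_bil_le (memLp_mol (isTest_rho n) (hg.memLp s))
    (memLp_mol (isTest_rho n) (hg'.memLp s))).trans ?_⟩
  have hM : 0 ≤ M := (abs_nonneg _).trans ((hm s hs).bound 0)
  exact mul_le_mul_of_nonneg_left (mul_le_mul ((l2n_mol_rho_le (hg.memLp s) n).trans (hC s hs))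
    ((l2n_mol_rho_le (hg'.memLp s) n).trans (hD s hs)) (l2n_nonneg _)
    ((l2n_nonneg _).trans (hC s hs))) hM

theorem tendsto_molBil {m : ℝ → ℝ → ℝ} {g g' : ℝ → ℝ → ℂ} {s : ℝ}
    (hm : BddWeight (m s) M) (hg : MeasFam t₀ T g) (hg' : MeasFam t₀ T g') :
    Tendsto (fun n => molBil n m g g' s) atTop (𝓝 (bil (m s) (g s) (g' s))) :=
  tendsto_bil_const hm (l2Tendsto_mol_rho (hg.memLp s)) (l2Tendsto_mol_rho (hg'.memLp s))

/-- One derivative is moved from the kernel to `u`. The second-order term then appears as the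
derivative of the mollified `ux`, ready for integration by parts. -/
theorem bil_dtMol {m : ℝ → ℝ} (hm : BddWeight m M) (h : Evolution u ux f) {k : ℝ → ℂ}
    (hk : IsTest k) (s : ℝ) {g : ℝ → ℂ} (hg : MemLp g 2) :
    bil m (dtMol k u f s) g
      = Complex.I * bil m (mol (deriv k) (ux s)) g - Complex.I * bil m (mol k (f s)) g := by
  have e : mol (deriv (deriv k)) (u s) = mol (deriv k) (ux s) := mol_deriv hk.deriv (h.isH1 s).weak
  have h1 := (memLp_mol hk.deriv (h.isH1 s).memLp')
  have h2 := (memLp_mol hk (h.memLp_f s))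
  have := hm.bil_add_left (h1.const_mul Complex.I) (h2.const_mul (-Complex.I)) hg
  rw [bil_const_mul_left, bil_const_mul_left] at this
  rw [← e] at this ⊢
  rw [sub_eq_add_neg, ← neg_mul]
  exact this

theorem intervalIntegrable_bil {m : ℝ → ℝ → ℝ} {A B : ℝ → ℝ → ℂ} (hle : t₀ ≤ T)
    (hmeas : Measurable (Function.uncurry m)) (hm : ∀ s ∈ Icc t₀ T, BddWeight (m s) M)
    (hA : L2Fam t₀ T A) (hB : L2Fam t₀ T B) :
    IntervalIntegrable (fun s => bil (m s) (A s) (B s)) volume t₀ T := by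
  have hM : 0 ≤ M := (abs_nonneg _).trans ((hm t₀ (left_mem_Icc.2 hle)).bound 0)
  obtain ⟨C, hC⟩ := hA.exists_bil_bound hB hM
  exact intervalIntegrable_of_bound hle (measurable_bil hmeas hA.meas hB.meas).aestronglyMeasurable
    fun s hs => ((hm s hs).norm_bil_le (hA.memLp s) (hB.memLp s)).trans (hC s hs)

/-- The integrand of the local mass law. -/
def massRate (Φ Φs Φx : ℝ → ℝ → ℝ) (u ux f : ℝ → ℝ → ℂ) (s : ℝ) : ℝ :=
  (bil (Φs s) (u s) (u s)).re + 2 * (bil (Φx s) (ux s) (u s)).im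
    + 2 * (bil (Φ s) (f s) (u s)).im

/-- The local mass law. -/
theorem Evolution.mass_law (h : Evolution u ux f) (h0 : 0 ≤ t₀) (hle : t₀ ≤ T)
    {Φ Φs Φx : ℝ → ℝ → ℝ} (hΦ : STWeight t₀ T Φ Φs Φx M) :
    IntervalIntegrable (massRate Φ Φs Φx u ux f) volume t₀ T ∧
    (bil (Φ T) (u T) (u T)).re - (bil (Φ t₀) (u t₀) (u t₀)).re
      = ∫ s in t₀..T, massRate Φ Φs Φx u ux f s := by
  have hl : t₀ ∈ Icc t₀ T := left_mem_Icc.2 hle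
  have hr : T ∈ Icc t₀ T := right_mem_Icc.2 hle
  have gu : MeasFam t₀ T u := h.fam_u
  have gx : MeasFam t₀ T ux := h.fam_ux
  have gf : MeasFam t₀ T f := h.fam_f
  set D : ℕ → ℝ → ℝ := fun n s => (molBil n Φs u u s).re + 2 * (molBil n Φx ux u s).im
    + 2 * (molBil n Φ f u s).im with hD
  have step : ∀ n, (molBil n Φ u u T).re - (molBil n Φ u u t₀).re = ∫ s in t₀..T, D n s := by
    intro n
    have hk := isTest_rho n
    have ev := bil_evolution hle hΦ (h.l2Fam_u hk) (h.l2Fam_dtMol hk) (h.l2Fam_u hk)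
      (h.l2Fam_dtMol hk) (h.lipPrim hk h0) (h.lipPrim hk h0)
    have e1 : ∫ s in t₀..T, (bil (Φs s) (mol (rho n) (u s)) (mol (rho n) (u s))
        + bil (Φ s) (dtMol (rho n) u f s) (mol (rho n) (u s))
        + bil (Φ s) (mol (rho n) (u s)) (dtMol (rho n) u f s)) = ((∫ s in t₀..T, D n s : ℝ) : ℂ) := by
      rw [← intervalIntegral.integral_ofReal]
      refine intervalIntegral.integral_congr fun s hs => ?_
      rw [uIcc_of_le hle] at hs
      have mA := memLp_mol hk (h.isH1 s).memLp
      have A1 : IsH1 (mol (rho n) (u s)) (mol (rho n) (ux s)) :=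
        IsH1.of_hasDerivAt ((h.isH1 s).hasDerivAt_mol hk) mA (memLp_mol hk (h.isH1 s).memLp')
      have A2 : IsH1 (mol (rho n) (ux s)) (mol (deriv (rho n)) (ux s)) :=
        IsH1.of_hasDerivAt (hasDerivAt_mol hk (h.isH1 s).weak.2.1) A1.memLp'
          (memLp_mol hk.deriv (h.isH1 s).memLp')
      have w := hΦ.space s hs
      have e2 := bil_dtMol w.weight h hk s mA
      have e3 := w.integral_by_parts A2 A1
      have e4 := bil_self_im (Φs s) (mol (rho n) (u s))
      -- The term with `|u_x|²` from the integration by parts is real, so only the flux with weight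
      -- `Φx` enters the imaginary part.
      have e5 := bil_self_im (Φ s) (mol (rho n) (ux s))
      have e6 := congrArg Complex.im e3
      simp only [Complex.add_im, e5, Complex.zero_im, add_zero] at e6
      rw [← conj_bil (Φ s) (dtMol (rho n) u f s), e2]
      apply Complex.ext
      · simp only [hD, molBil, Complex.add_re, Complex.conj_re, Complex.sub_re, Complex.mul_re,
          Complex.I_re, Complex.I_im, Complex.ofReal_re]
        linear_combination (-2) * e6
      · simp only [Complex.add_im, Complex.conj_im, Complex.ofReal_im, e4]
        ring
    rw [e1] at ev
    have := congrArg Complex.re ev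
    rwa [Complex.sub_re, Complex.ofReal_re] at this
  obtain ⟨C1, c1⟩ := exists_molBil_bound (fun s hs => hΦ.weight_s hs) gu gu
  obtain ⟨C2, c2⟩ := exists_molBil_bound (fun s hs => (hΦ.space s hs).weight') gx gu
  obtain ⟨C3, c3⟩ := exists_molBil_bound (fun s hs => (hΦ.space s hs).weight) gf gu
  have re : Continuous Complex.re := Complex.continuous_re
  have im : Continuous Complex.im := Complex.continuous_im
  obtain ⟨hi, ht⟩ := tendsto_intervalIntegral_of_bounded (D := D) (C := C1 + 2 * C2 + 2 * C3)
    (D₀ := massRate Φ Φs Φx u ux f) hle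
    (fun n => ((re.measurable.comp (measurable_molBil hΦ.meas_s gu gu n)).add
      ((im.measurable.comp (measurable_molBil hΦ.meas_x gx gu n)).const_mul 2)).add
      ((im.measurable.comp (measurable_molBil hΦ.meas gf gu n)).const_mul 2))
    (fun n s hs => by
      have b1 := (Complex.abs_re_le_norm _).trans (c1 n s hs)
      have b2 := (Complex.abs_im_le_norm _).trans (c2 n s hs)
      have b3 := (Complex.abs_im_le_norm _).trans (c3 n s hs)
      rw [abs_le] at *
      constructor <;> simp only [hD] <;> linarith [b1.1, b1.2, b2.1, b2.2, b3.1, b3.2])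
    (fun s hs => (((re.tendsto _).comp (tendsto_molBil (hΦ.weight_s hs) gu gu)).add
      (((im.tendsto _).comp (tendsto_molBil (hΦ.space s hs).weight' gx gu)).const_mul 2)).add
      (((im.tendsto _).comp (tendsto_molBil (hΦ.space s hs).weight gf gu)).const_mul 2))
  refine ⟨hi, tendsto_nhds_unique ?_ ht⟩
  simp_rw [← step]
  exact ((re.tendsto _).comp (tendsto_molBil (hΦ.space T hr).weight gu gu)).sub
    ((re.tendsto _).comp (tendsto_molBil (hΦ.space t₀ hl).weight gu gu))

/-- The integrand of the Morawetz identity. -/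
def moraRate (w ws wx wxx : ℝ → ℝ → ℝ) (u ux f : ℝ → ℝ → ℂ) (s : ℝ) : ℝ :=
  (bil (ws s) (ux s) (u s)).im + (bil (wxx s) (ux s) (u s)).re
    + 2 * (bil (wx s) (ux s) (ux s)).re + (bil (wx s) (f s) (u s)).re
    + 2 * (bil (w s) (f s) (ux s)).re

/-- The Morawetz identity with a general source. -/
theorem Evolution.morawetz_law (h : Evolution u ux f) (h0 : 0 ≤ t₀) (hle : t₀ ≤ T)
    {w ws wx wxx : ℝ → ℝ → ℝ} (hw : STWeight t₀ T w ws wx M)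
    (hxx : Measurable (Function.uncurry wxx)) (hwx : ∀ s ∈ Icc t₀ T, C1Weight (wx s) (wxx s) M) :
    IntervalIntegrable (moraRate w ws wx wxx u ux f) volume t₀ T ∧
    (bil (w T) (ux T) (u T)).im - (bil (w t₀) (ux t₀) (u t₀)).im
      = ∫ s in t₀..T, moraRate w ws wx wxx u ux f s := by
  have hl : t₀ ∈ Icc t₀ T := left_mem_Icc.2 hle
  have hr : T ∈ Icc t₀ T := right_mem_Icc.2 hle
  have gu : MeasFam t₀ T u := h.fam_u
  have gx : MeasFam t₀ T ux := h.fam_ux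
  have gf : MeasFam t₀ T f := h.fam_f
  set D : ℕ → ℝ → ℝ := fun n s => (molBil n ws ux u s).im + (molBil n wxx ux u s).re
    + 2 * (molBil n wx ux ux s).re + (molBil n wx f u s).re + 2 * (molBil n w f ux s).re with hD
  have step : ∀ n, (molBil n w ux u T).im - (molBil n w ux u t₀).im = ∫ s in t₀..T, D n s := by
    intro n
    have hk := isTest_rho n
    have eux : ∀ s, mol (deriv (rho n)) (u s) = mol (rho n) (ux s) := fun s =>
      mol_deriv hk (h.isH1 s).weak
    have fA : L2Fam t₀ T fun s => mol (rho n) (u s) := h.l2Fam_u hk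
    have fAx : L2Fam t₀ T fun s => mol (rho n) (ux s) := h.l2Fam_ux hk
    have fa : L2Fam t₀ T (dtMol (rho n) u f) := h.l2Fam_dtMol hk
    have fb : L2Fam t₀ T (dtMol (deriv (rho n)) u f) := h.l2Fam_dtMol hk.deriv
    -- The mollified `ux` is also the mollification of `u` with kernel `ρ'`, so its evolution comes
    -- from the same equation.
    have px : ∀ x, LipPrim t₀ T (fun s => mol (rho n) (ux s) x)
        (fun s => dtMol (deriv (rho n)) u f s x) := fun x => by
      simp_rw [← eux]
      exact h.lipPrim hk.deriv h0 x
    have ev := bil_evolution hle hw fAx fb fA fa px (h.lipPrim hk h0)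
    have j1 := intervalIntegrable_bil hle hw.meas_s (fun s hs => hw.weight_s hs) fAx fA
    have j2 := intervalIntegrable_bil hle hw.meas (fun s hs => (hw.space s hs).weight) fb fA
    have j3 := intervalIntegrable_bil hle hw.meas (fun s hs => (hw.space s hs).weight) fAx fa
    have e0 := congrArg Complex.im ev
    have e1 := Complex.imCLM.intervalIntegral_comp_comm ((j1.add j2).add j3)
    simp only [Complex.imCLM_apply] at e1
    rw [← e1, Complex.sub_im] at e0
    refine e0.trans (intervalIntegral.integral_congr fun s hs => ?_)
    rw [uIcc_of_le hle] at hs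
    have mA := memLp_mol hk (h.isH1 s).memLp
    have A1 : IsH1 (mol (rho n) (u s)) (mol (rho n) (ux s)) :=
      IsH1.of_hasDerivAt ((h.isH1 s).hasDerivAt_mol hk) mA (memLp_mol hk (h.isH1 s).memLp')
    have A2 : IsH1 (mol (rho n) (ux s)) (mol (deriv (rho n)) (ux s)) :=
      IsH1.of_hasDerivAt (hasDerivAt_mol hk (h.isH1 s).weak.2.1) A1.memLp'
        (memLp_mol hk.deriv (h.isH1 s).memLp')
    have a1 : IsH1 (dtMol (rho n) u f s) (dtMol (deriv (rho n)) u f s) :=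
      IsH1.of_hasDerivAt (fun x =>
        ((hasDerivAt_mol hk.deriv.deriv (h.isH1 s).weak.1 x).const_mul _).add
        ((hasDerivAt_mol hk (MemLp.locallyIntegrable_two (h.memLp_f s)) x).const_mul _))
        (fa.memLp s) (fb.memLp s)
    have w1 := hw.space s hs
    have w2 := hwx s hs
    -- With `A` the mollified solution and `a = ∂ₛA`, parts and conjugate symmetry give `Im⟨w a_x,
    -- A⟩ + Im⟨w A_x, a⟩ = -Im⟨w_x a, A⟩ - 2 Im⟨w a, A_x⟩`. Inserting `a = i (A_xx - f)` turns
    -- imaginary into real parts. Each of the two terms in `A_xx` then yields one copy of `⟨w_x A_x,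
    -- A_x⟩` (`q4`, `q5`), and the first also yields the `w_xx` term.
    have q1 := congrArg Complex.im (w1.integral_by_parts a1 A1)
    have q2 := congrArg Complex.im (bil_dtMol w1.weight' h hk s mA)
    have q3 := congrArg Complex.im (bil_dtMol w1.weight h hk s A1.memLp')
    have q4 := w1.bil_self_deriv A2
    have q5 := congrArg Complex.re (w2.integral_by_parts A2 A1)
    have q6 := bil_im_symm (w s) (mol (rho n) (ux s)) (dtMol (rho n) u f s)
    simp only [Complex.add_im, Complex.sub_im, Complex.mul_im, Complex.I_re, Complex.I_im,
      Complex.zero_im, zero_mul, one_mul, zero_add] at q1 q2 q3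
    simp only [Complex.add_re, Complex.zero_re] at q5
    simp only [Complex.add_im, hD, molBil, q6]
    linarith
  obtain ⟨C1, c1⟩ := exists_molBil_bound (fun s hs => hw.weight_s hs) gx gu
  obtain ⟨C2, c2⟩ := exists_molBil_bound (fun s hs => (hwx s hs).weight') gx gu
  obtain ⟨C3, c3⟩ := exists_molBil_bound (fun s hs => (hw.space s hs).weight') gx gx
  obtain ⟨C4, c4⟩ := exists_molBil_bound (fun s hs => (hw.space s hs).weight') gf gu
  obtain ⟨C5, c5⟩ := exists_molBil_bound (fun s hs => (hw.space s hs).weight) gf gx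
  have re : Continuous Complex.re := Complex.continuous_re
  have im : Continuous Complex.im := Complex.continuous_im
  obtain ⟨hi, ht⟩ := tendsto_intervalIntegral_of_bounded (D := D)
    (C := C1 + C2 + 2 * C3 + C4 + 2 * C5) (D₀ := moraRate w ws wx wxx u ux f) hle
    (fun n => ((((im.measurable.comp (measurable_molBil hw.meas_s gx gu n)).add
      (re.measurable.comp (measurable_molBil hxx gx gu n))).add
      ((re.measurable.comp (measurable_molBil hw.meas_x gx gx n)).const_mul 2)).add
      (re.measurable.comp (measurable_molBil hw.meas_x gf gu n))).add
      ((re.measurable.comp (measurable_molBil hw.meas gf gx n)).const_mul 2))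
    (fun n s hs => by
      have b1 := (Complex.abs_im_le_norm _).trans (c1 n s hs)
      have b2 := (Complex.abs_re_le_norm _).trans (c2 n s hs)
      have b3 := (Complex.abs_re_le_norm _).trans (c3 n s hs)
      have b4 := (Complex.abs_re_le_norm _).trans (c4 n s hs)
      have b5 := (Complex.abs_re_le_norm _).trans (c5 n s hs)
      rw [abs_le] at *
      constructor <;> simp only [hD] <;>
        linarith [b1.1, b1.2, b2.1, b2.2, b3.1, b3.2, b4.1, b4.2, b5.1, b5.2])
    (fun s hs => (((((im.tendsto _).comp (tendsto_molBil (hw.weight_s hs) gx gu)).add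
      ((re.tendsto _).comp (tendsto_molBil (hwx s hs).weight' gx gu))).add
      (((re.tendsto _).comp (tendsto_molBil (hw.space s hs).weight' gx gx)).const_mul 2)).add
      ((re.tendsto _).comp (tendsto_molBil (hw.space s hs).weight' gf gu))).add
      (((re.tendsto _).comp (tendsto_molBil (hw.space s hs).weight gf gx)).const_mul 2))
  refine ⟨hi, tendsto_nhds_unique ?_ ht⟩
  simp_rw [← step]
  exact ((im.tendsto _).comp (tendsto_molBil (hw.space T hr).weight gx gu)).sub
    ((im.tendsto _).comp (tendsto_molBil (hw.space t₀ hl).weight gx gu))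

end

/-! ### Energy solutions -/

theorem one_le_jBra (x : ℝ) : 1 ≤ jBra x := by
  rw [jBra, Real.one_le_sqrt]
  nlinarith [sq_nonneg x]

theorem abs_le_jBra (x : ℝ) : |x| ≤ jBra x :=
  Real.abs_le_sqrt (by linarith)

theorem IsLocalizedPotential.abs_le {σ K : ℝ} {V : ℝ → ℝ → ℝ} (hV : IsLocalizedPotential σ K V)
    (hσ : 0 ≤ σ) {t : ℝ} (ht : 0 ≤ t) (x : ℝ) : |V t x| ≤ K :=
  (le_mul_of_one_le_left (abs_nonneg _) (Real.one_le_rpow (one_le_jBra x) hσ)).trans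
    (hV.bound t ht x)

theorem IsLocalizedPotential.abs_deriv_le {σ K : ℝ} {V : ℝ → ℝ → ℝ}
    (hV : IsLocalizedPotential σ K V) (hσ : 0 ≤ σ) {t : ℝ} (ht : 0 ≤ t) (x : ℝ) :
    |deriv (V t) x| ≤ K :=
  (le_mul_of_one_le_left (abs_nonneg _) (Real.one_le_rpow (one_le_jBra x) (by linarith))).trans
    (hV.deriv_bound t ht x)

theorem eLpNorm_eq_ofReal_l2n {f : ℝ → ℂ} (hf : MemLp f 2) : eLpNorm f 2 = ENNReal.ofReal (l2n f) :=
  (ENNReal.ofReal_toReal hf.2.ne).symm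

theorem l2n_congr_ae {f g : ℝ → ℂ} (h : f =ᵐ[volume] g) : l2n f = l2n g := by
  rw [l2n, l2n, eLpNorm_congr_ae h]

theorem l2n_bdd_mul_le {m : ℝ → ℂ} {M : ℝ} {Q : ℝ → ℂ} (hQ : MemLp Q 2)
    (hM : ∀ᵐ x, ‖m x‖ ≤ M) (hM0 : 0 ≤ M) : l2n (fun x => m x * Q x) ≤ M * l2n Q := by
  have : eLpNorm (fun x => m x * Q x) 2 ≤ ENNReal.ofReal M * eLpNorm Q 2 :=
    eLpNorm_le_mul_eLpNorm_of_ae_le_mul (hM.mono fun x hx => by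
      rw [norm_mul]; exact mul_le_mul_of_nonneg_right hx (norm_nonneg _)) 2
  rw [l2n, l2n, ← ENNReal.toReal_ofReal hM0, ← ENNReal.toReal_mul]
  exact ENNReal.toReal_mono (ENNReal.mul_ne_top ENNReal.ofReal_ne_top hQ.2.ne) this

theorem l2n_pw_le {p R : ℝ} (hp : 1 < p) {u : ℝ → ℂ} (hu : MemLp u 2) (hR : ∀ᵐ x, ‖u x‖ ≤ R)
    (hR0 : 0 ≤ R) : l2n (fun x => pw p (u x)) ≤ R ^ (p - 1) * l2n u :=
  l2n_bdd_mul_le hu (hR.mono fun x hx => by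
    rw [Complex.norm_real, Real.norm_of_nonneg (Real.rpow_nonneg (norm_nonneg _) _)]
    exact Real.rpow_le_rpow (norm_nonneg _) hx (by linarith)) (Real.rpow_nonneg hR0 _)

theorem h1Norm_eq {u ux : ℝ → ℂ} (h : IsH1 u ux) : h1Norm u = √(l2n u ^ 2 + l2n ux ^ 2) := by
  have : MemLp (weakDeriv u) 2 := (memLp_congr_ae h.weakDeriv_ae).2 h.memLp'
  rw [h1Norm, l2NormSq_eq h.memLp, l2NormSq_eq this, l2n_congr_ae h.weakDeriv_ae]

theorem l2n_le_h1Norm {u ux : ℝ → ℂ} (h : IsH1 u ux) : l2n u ≤ h1Norm u := by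
  rw [h1Norm_eq h]
  exact Real.le_sqrt_of_sq_le (by nlinarith [sq_nonneg (l2n ux)])

theorem l2n_le_h1Norm' {u ux : ℝ → ℂ} (h : IsH1 u ux) : l2n ux ≤ h1Norm u := by
  rw [h1Norm_eq h]
  exact Real.le_sqrt_of_sq_le (by nlinarith [sq_nonneg (l2n u)])

/-- The solution, extended to negative times by its initial value. -/
def extU (u : ℝ → ℝ → ℂ) (s : ℝ) : ℝ → ℂ := u (max s 0)

/-- The spatial derivative of the extended solution. -/
def extUx (u : ℝ → ℝ → ℂ) (s : ℝ) : ℝ → ℂ := weakDeriv (u (max s 0))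

/-- The source `V u + |u|^(p-1) u` of the extended solution. -/
def extSrc (p : ℝ) (V : ℝ → ℝ → ℝ) (u : ℝ → ℝ → ℂ) (s x : ℝ) : ℂ :=
  (V (max s 0) x : ℂ) * extU u s x + pw p (extU u s x)

section

variable {p σ K : ℝ} {V : ℝ → ℝ → ℝ} {u : ℝ → ℝ → ℂ}

theorem IsEnergySolution.isH1 (hu : IsEnergySolution p V u) (s : ℝ) :
    IsH1 (extU u s) (extUx u s) := (hu.memH1 _ (le_max_right _ _)).isH1

theorem IsEnergySolution.tendsto_h1Norm (hu : IsEnergySolution p V u) (t : ℝ) :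
    Tendsto (fun s => h1Norm fun x => extU u s x - extU u t x) (𝓝 t) (𝓝 0) := by
  have h1 : Tendsto (fun s : ℝ => max s 0) (𝓝 t) (𝓝[Ici 0] (max t 0)) :=
    tendsto_nhdsWithin_iff.2 ⟨(continuous_id.max continuous_const).tendsto t,
      Eventually.of_forall fun s => mem_Ici.2 (le_max_right _ _)⟩
  exact (hu.continuous (max t 0) (le_max_right _ _)).comp h1

theorem IsEnergySolution.cont (hu : IsEnergySolution p V u) (t : ℝ) :
    L2Tendsto (𝓝 t) (extU u) (extU u t) := by
  refine ⟨fun s => (hu.isH1 s).memLp, (hu.isH1 t).memLp, ?_⟩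
  have h : ∀ s, eLpNorm (fun x => extU u s x - extU u t x) 2
      = ENNReal.ofReal (l2n fun x => extU u s x - extU u t x) := fun s =>
    eLpNorm_eq_ofReal_l2n ((hu.isH1 s).sub (hu.isH1 t)).memLp
  simp_rw [h]
  rw [← ENNReal.ofReal_zero]
  exact ENNReal.tendsto_ofReal (squeeze_zero (fun _ => l2n_nonneg _)
    (fun s => l2n_le_h1Norm ((hu.isH1 s).sub (hu.isH1 t))) (hu.tendsto_h1Norm t))

theorem IsEnergySolution.cont' (hu : IsEnergySolution p V u) (t : ℝ) :
    L2Tendsto (𝓝 t) (extUx u) (extUx u t) := by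
  refine ⟨fun s => (hu.isH1 s).memLp', (hu.isH1 t).memLp', ?_⟩
  have h : ∀ s, eLpNorm (fun x => extUx u s x - extUx u t x) 2
      = ENNReal.ofReal (l2n fun x => extUx u s x - extUx u t x) := fun s =>
    eLpNorm_eq_ofReal_l2n ((hu.isH1 s).sub (hu.isH1 t)).memLp'
  simp_rw [h]
  rw [← ENNReal.ofReal_zero]
  exact ENNReal.tendsto_ofReal (squeeze_zero (fun _ => l2n_nonneg _)
    (fun s => l2n_le_h1Norm' ((hu.isH1 s).sub (hu.isH1 t))) (hu.tendsto_h1Norm t))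

theorem IsEnergySolution.measurable_mol (hu : IsEnergySolution p V u) (n : ℕ) :
    Measurable (Function.uncurry fun s x => mol (rho n) (extU u s) x) :=
  measurable_uncurry_mol (isTest_rho n) (fun s => (hu.isH1 s).memLp)
    fun _ hφ => (continuous_integral_mul hu.cont hφ.memLp).measurable

theorem L2Tendsto.pw_mol (hp : 1 < p) {v vx : ℝ → ℂ} (h : IsH1 v vx) :
    L2Tendsto atTop (fun n x => NLSMorawetz.pw p (mol (rho n) v x))
      (fun x => NLSMorawetz.pw p (v x)) :=
  (l2Tendsto_mol_rho h.memLp).pw hp (R := l2n v + l2n vx)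
    (fun n => ae_of_all _ (h.norm_mol_le n)) h.norm_le

theorem bddWeight_potential (hV : IsLocalizedPotential σ K V) (hσ : 0 ≤ σ) (s : ℝ) :
    BddWeight (V (max s 0)) K :=
  ⟨hV.measurable.comp measurable_prodMk_left, hV.abs_le hσ (le_max_right _ _)⟩

theorem measurable_extV (hV : IsLocalizedPotential σ K V) :
    Measurable (Function.uncurry fun s x => V (max s 0) x) :=
  hV.measurable.comp ((measurable_fst.max measurable_const).prodMk measurable_snd)

theorem IsEnergySolution.memLp_V (hu : IsEnergySolution p V u) (hV : IsLocalizedPotential σ K V)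
    (hσ : 0 ≤ σ) (s : ℝ) : MemLp (fun x => (V (max s 0) x : ℂ) * extU u s x) 2 :=
  memLp_bdd_mul (hu.isH1 s).memLp (bddWeight_potential hV hσ s).aesm
    (bddWeight_potential hV hσ s).norm_le

theorem IsEnergySolution.memLp_pw (hu : IsEnergySolution p V u) (hp : 1 < p) (s : ℝ) :
    MemLp (fun x => pw p (extU u s x)) 2 :=
  NLSMorawetz.memLp_pw hp (hu.isH1 s).memLp (hu.isH1 s).norm_le

theorem IsEnergySolution.exists_norm_bound (hu : IsEnergySolution p V u) (t₀ T : ℝ) :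
    ∃ C, ∀ s ∈ Icc t₀ T, l2n (extU u s) ≤ C ∧ l2n (extUx u s) ≤ C := by
  obtain ⟨C, hC⟩ := exists_l2n_bound hu.cont t₀ T
  obtain ⟨D, hD⟩ := exists_l2n_bound hu.cont' t₀ T
  exact ⟨max C D, fun s hs => ⟨(hC s hs).trans (le_max_left _ _),
    (hD s hs).trans (le_max_right _ _)⟩⟩

theorem IsEnergySolution.exists_pw_bound (hu : IsEnergySolution p V u) (hp : 1 < p) (t₀ T : ℝ) :
    ∃ C, ∀ s ∈ Icc t₀ T, l2n (fun x => pw p (extU u s x)) ≤ C := by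
  obtain ⟨C, hC⟩ := hu.exists_norm_bound t₀ T
  refine ⟨(C + C) ^ (p - 1) * C, fun s hs => ?_⟩
  have hC0 : 0 ≤ C := (l2n_nonneg _).trans (hC s hs).1
  refine (l2n_pw_le hp (hu.isH1 s).memLp (R := C + C) ?_ (by linarith)).trans ?_
  · filter_upwards [(hu.isH1 s).norm_le] with x hx
    exact hx.trans (add_le_add (hC s hs).1 (hC s hs).2)
  · exact mul_le_mul_of_nonneg_left (hC s hs).1 (Real.rpow_nonneg (by linarith) _)

/-- Measurability in time is obtained through mollification: the nonlinearity applied to a mollified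
solution is jointly measurable, and its pairings converge because the nonlinearity is Lipschitz on
bounded sets. -/
theorem IsEnergySolution.fam_pw (hu : IsEnergySolution p V u) (hp : 1 < p) (t₀ T : ℝ) :
    MeasFam t₀ T fun s x => pw p (extU u s x) := by
  refine ⟨hu.memLp_pw hp, fun φ hφ => ?_, hu.exists_pw_bound hp t₀ T⟩
  refine measurable_of_tendsto_metrizable
    (f := fun n s => ∫ x, pw p (mol (rho n) (extU u s) x) * φ x) (fun n => ?_)
    (tendsto_pi_nhds.2 fun s =>
      (L2Tendsto.pw_mol hp (hu.isH1 s)).tendsto_integral_mul (L2Tendsto.const hφ.memLp))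
  have : Measurable (Function.uncurry fun s x => pw p (mol (rho n) (extU u s) x) * φ x) :=
    ((continuous_pw hp).measurable.comp (hu.measurable_mol n)).mul
      (hφ.continuous.measurable.comp measurable_snd)
  exact this.stronglyMeasurable.integral_prod_right.measurable

theorem IsEnergySolution.fam_V (hu : IsEnergySolution p V u) (hV : IsLocalizedPotential σ K V)
    (hσ : 0 ≤ σ) (t₀ T : ℝ) : MeasFam t₀ T fun s x => (V (max s 0) x : ℂ) * extU u s x := by
  have hK : 0 ≤ K := (abs_nonneg _).trans ((bddWeight_potential hV hσ 0).bound 0)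
  refine ⟨hu.memLp_V hV hσ, fun φ hφ => ?_, ?_⟩
  · refine measurable_of_tendsto_metrizable
      (f := fun n s => ∫ x, (V (max s 0) x : ℂ) * mol (rho n) (extU u s) x * φ x) (fun n => ?_)
      (tendsto_pi_nhds.2 fun s => ?_)
    · have : Measurable (Function.uncurry fun s x =>
          (V (max s 0) x : ℂ) * mol (rho n) (extU u s) x * φ x) :=
        ((Complex.measurable_ofReal.comp (measurable_extV hV)).mul (hu.measurable_mol n)).mul
          (hφ.continuous.measurable.comp measurable_snd)
      exact this.stronglyMeasurable.integral_prod_right.measurable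
    · have b := bddWeight_potential hV hσ s
      exact ((l2Tendsto_mol_rho (hu.isH1 s).memLp).bdd_mul (fun _ => b.aesm) b.aesm
        (fun _ => b.norm_le) b.norm_le
        (ae_of_all _ fun _ => tendsto_const_nhds)).tendsto_integral_mul (L2Tendsto.const hφ.memLp)
  · obtain ⟨C, hC⟩ := hu.exists_norm_bound t₀ T
    exact ⟨K * C, fun s hs => (l2n_bdd_mul_le (hu.isH1 s).memLp
      (ae_of_all _ (bddWeight_potential hV hσ s).norm_le) hK).trans
      (mul_le_mul_of_nonneg_left (hC s hs).1 hK)⟩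

theorem MeasFam.add {t₀ T : ℝ} {g g' : ℝ → ℝ → ℂ} (h : MeasFam t₀ T g) (h' : MeasFam t₀ T g') :
    MeasFam t₀ T fun s x => g s x + g' s x := by
  refine ⟨fun s => (h.memLp s).add (h'.memLp s), fun φ hφ => ?_, ?_⟩
  · have e : ∀ s, ∫ x, (g s x + g' s x) * φ x = (∫ x, g s x * φ x) + ∫ x, g' s x * φ x := fun s => by
      rw [← integral_add (integrable_mul_of_memLp (h.memLp s) hφ.memLp)
        (integrable_mul_of_memLp (h'.memLp s) hφ.memLp)]
      simp_rw [add_mul]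
    simp_rw [e]
    exact (h.meas φ hφ).add (h'.meas φ hφ)
  · obtain ⟨C, hC⟩ := h.bound
    obtain ⟨D, hD⟩ := h'.bound
    exact ⟨C + D, fun s hs => (l2n_add_le (h.memLp s) (h'.memLp s)).trans
      (add_le_add (hC s hs) (hD s hs))⟩

theorem MeasFam.norm_integral_le {t₀ T : ℝ} {g : ℝ → ℝ → ℂ} (h : MeasFam t₀ T g) {φ : ℝ → ℂ}
    (hφ : MemLp φ 2) : ∃ C, ∀ s ∈ Icc t₀ T, ‖∫ x, g s x * φ x‖ ≤ C := by
  obtain ⟨C, hC⟩ := h.bound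
  exact ⟨C * l2n φ, fun s hs => ((norm_integral_le_integral_norm _).trans
    (integral_norm_mul_le (h.memLp s) hφ)).trans
    (mul_le_mul_of_nonneg_right (hC s hs) (l2n_nonneg _))⟩

theorem IsEnergySolution.evolution (hu : IsEnergySolution p V u)
    (hV : IsLocalizedPotential σ K V) (hσ : 0 ≤ σ) (hp : 1 < p) :
    Evolution (extU u) (extUx u) (extSrc p V u) := by
  have fam : ∀ t₀ T, MeasFam t₀ T (extSrc p V u) := fun t₀ T =>
    (hu.fam_V hV hσ t₀ T).add (hu.fam_pw hp t₀ T)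
  refine ⟨hu.isH1, hu.cont, hu.cont', (fam 0 0).memLp, fun t₀ T => (fam t₀ T).bound,
    (fam 0 0).meas, fun φ hφ t₀ t h0 hle => ?_⟩
  set J : ℝ → ℂ := fun s => -(∫ x, extU u s x * deriv (deriv φ) x) + ∫ x, extSrc p V u s x * φ x
    with hJ
  -- The equation is given from time 0; the version from `t₀` is the difference of two instances.
  have key : ∀ r, 0 ≤ r → Complex.I * ((∫ x, u r x * φ x) - ∫ x, u 0 x * φ x)
      = ∫ s in (0 : ℝ)..r, J s := by
    intro r hr
    rw [hu.equation φ hφ r hr]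
    refine intervalIntegral.integral_congr fun s hs => ?_
    rw [uIcc_of_le hr] at hs
    have hs0 : max s 0 = s := max_eq_left hs.1
    simp only [hJ]
    have e : ∫ x, extSrc p V u s x * φ x = (∫ x, (V (max s 0) x : ℂ) * extU u s x * φ x)
        + ∫ x, pw p (extU u s x) * φ x := by
      rw [← integral_add (integrable_mul_of_memLp (hu.memLp_V hV hσ s) hφ.memLp)
        (integrable_mul_of_memLp (hu.memLp_pw hp s) hφ.memLp)]
      refine integral_congr_ae (ae_of_all _ fun x => ?_)
      simp only [extSrc]
      ring
    rw [e, ← add_assoc]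
    simp only [extU, hs0, pw]
  have hmu : Measurable fun s => ∫ x, extU u s x * deriv (deriv φ) x :=
    (continuous_integral_mul hu.cont hφ.deriv.deriv.memLp).measurable
  have hint : ∀ r, 0 ≤ r → IntervalIntegrable J volume 0 r := fun r hr => by
    obtain ⟨C, hC⟩ := (fam 0 r).norm_integral_le hφ.memLp
    obtain ⟨D, hD⟩ := (exists_l2n_bound hu.cont 0 r)
    refine intervalIntegrable_of_bound (C := D * l2n (deriv (deriv φ)) + C) hr
      (hmu.neg.add ((fam 0 0).meas φ hφ)).aestronglyMeasurable fun s hs => ?_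
    refine (norm_add_le _ _).trans (add_le_add ?_ (hC s hs))
    rw [norm_neg]
    exact ((norm_integral_le_integral_norm _).trans (integral_norm_mul_le (hu.isH1 s).memLp
      hφ.deriv.deriv.memLp)).trans (mul_le_mul_of_nonneg_right (hD s hs) (l2n_nonneg _))
  rw [← intervalIntegral.integral_interval_sub_left (hint t (h0.trans hle)) (hint t₀ h0),
    ← key t (h0.trans hle), ← key t₀ h0]
  simp only [extU, max_eq_left h0, max_eq_left (h0.trans hle)]
  ring

end

/-! ### The space-time weights -/

theorem mul_evenP (P : ℝ → ℝ) (z : ℝ) : z * evenP P z = oddP (fun y => y * P y) z := by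
  simp only [evenP, oddP]; ring

theorem mul_oddP (P : ℝ → ℝ) (z : ℝ) : z * oddP P z = evenP (fun y => y * P y) z := by
  simp only [evenP, oddP]; ring

theorem hasDerivAt_div_rpow {β s : ℝ} (hs : 0 < s) (x : ℝ) :
    HasDerivAt (fun s => x / s ^ β) (-(β * s⁻¹ * (x / s ^ β))) s := by
  have h := (Real.hasDerivAt_rpow_const (p := β) (Or.inl hs.ne')).fun_inv
    (Real.rpow_pos_of_pos hs β).ne' |>.const_mul x
  simp only [← div_eq_mul_inv] at h
  refine h.congr_deriv ?_
  have h1 : s ^ (β - 1) = s ^ β * s⁻¹ := by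
    rw [Real.rpow_sub_one hs.ne', div_eq_mul_inv]
  have h2 := (Real.rpow_pos_of_pos hs β).ne'
  rw [h1]
  field_simp

theorem measurable_profile_div {Q : ℝ → ℝ} (hQ : Measurable Q) (β : ℝ) :
    Measurable (Function.uncurry fun s x : ℝ => Q (x / s ^ β)) :=
  hQ.comp (measurable_snd.div (measurable_fst.pow_const β))

theorem measurable_rpow_fst (β : ℝ) : Measurable fun z : ℝ × ℝ => z.1 ^ β :=
  measurable_fst.pow_const β

section

variable {F : ℝ → ℝ} {a b M : ℝ}

theorem C1Weight.measurable {m m' : ℝ → ℝ} (h : C1Weight m m' M) : Measurable m := h.weight.meas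

theorem C1Weight.measurable' {m m' : ℝ → ℝ} (h : C1Weight m m' M) : Measurable m' := h.weight'.meas

theorem C1Weight.div_const {m m' : ℝ → ℝ} (h : C1Weight m m' M) {L : ℝ} (hL : 0 < L) :
    C1Weight (fun x => m x / L) (fun x => m' x / L) (M / L) :=
  ⟨fun x => (h.hasDerivAt x).div_const L, fun x => by
    rw [abs_div, abs_of_pos hL]; exact div_le_div_of_nonneg_right (h.bound x) hL.le, fun x => by
    rw [abs_div, abs_of_pos hL]; exact div_le_div_of_nonneg_right (h.bound' x) hL.le⟩

theorem C1Weight.const_mul {m m' : ℝ → ℝ} (h : C1Weight m m' M) (c : ℝ) :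
    C1Weight (fun x => c * m x) (fun x => c * m' x) (|c| * M) :=
  ⟨fun x => (h.hasDerivAt x).const_mul c, fun x => by
    rw [abs_mul]; exact mul_le_mul_of_nonneg_left (h.bound x) (abs_nonneg _), fun x => by
    rw [abs_mul]; exact mul_le_mul_of_nonneg_left (h.bound' x) (abs_nonneg _)⟩

theorem C1Weight.mul {m m' n n' : ℝ → ℝ} {N : ℝ} (h : C1Weight m m' M) (h' : C1Weight n n' N) :
    C1Weight (fun x => m x * n x) (fun x => m' x * n x + m x * n' x) (2 * (M * N)) := by
  have hM : 0 ≤ M := (abs_nonneg _).trans (h.bound 0)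
  have hN : 0 ≤ N := (abs_nonneg _).trans (h'.bound 0)
  have hMN := mul_nonneg hM hN
  refine ⟨fun x => (h.hasDerivAt x).mul (h'.hasDerivAt x), fun x => ?_, fun x => ?_⟩
  · rw [abs_mul]
    have := mul_le_mul (h.bound x) (h'.bound x) (abs_nonneg _) hM
    linarith
  · refine (abs_add_le _ _).trans ?_
    rw [abs_mul, abs_mul]
    have h1 := mul_le_mul (h.bound' x) (h'.bound x) (abs_nonneg _) hM
    have h2 := mul_le_mul (h.bound x) (h'.bound' x) (abs_nonneg _) hM
    linarith

/-- The first derivative of the vector field `wt`. -/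
def wtx (F : ℝ → ℝ) (L x : ℝ) : ℝ := evenP (fun y => 2 * cutH F y) (x / L) / L

/-- The second derivative of the vector field `wt`. -/
def wtxx (F : ℝ → ℝ) (L x : ℝ) : ℝ := oddP (fun y => 2 * deriv (cutH F) y) (x / L) / L / L

/-- The third derivative of the vector field `wt`. -/
def wtxxx (F : ℝ → ℝ) (L x : ℝ) : ℝ :=
  evenP (fun y => 2 * deriv (deriv (cutH F)) y) (x / L) / L / L / L

/-- The time derivative of the vector field `wt` along `L = s ^ β`. -/
def wts (F : ℝ → ℝ) (β s x : ℝ) : ℝ := -2 * β * s⁻¹ * oddP (fun y => y * cutH F y) (x / s ^ β)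

/-- The potential of the mass flux. -/
def fluxW (F : ℝ → ℝ) (β s x : ℝ) : ℝ := -β * s ^ (β - 1) * evenP (cutY F) (x / s ^ β)

/-- The spatial derivative of `fluxW`. -/
def fluxWx (F : ℝ → ℝ) (β s x : ℝ) : ℝ := -β * s⁻¹ * oddP (fun y => y * cutH F y) (x / s ^ β)

/-- The time derivative of `fluxW`. -/
def fluxWs (F : ℝ → ℝ) (β s x : ℝ) : ℝ := s ^ (β - 2) * (-β * (β - 1) * evenP (cutY F) (x / s ^ β)
  + β ^ 2 * evenP (fun y => y ^ 2 * cutH F y) (x / s ^ β))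

theorem CutoffBound.c1_wt (hM : CutoffBound F M) {L : ℝ} (hL : 0 < L) :
    C1Weight (wt F L) (wtx F L) (max (2 * M) (2 * M / L)) := hM.wW.odd_div hL

theorem CutoffBound.c1_wtx (hM : CutoffBound F M) {L : ℝ} (hL : 0 < L) :
    C1Weight (wtx F L) (wtxx F L) (max (4 * M) (4 * M / L) / L) := by
  have h := ((hM.wH.const_mul 2).even_div hL).div_const hL
  rw [abs_two] at h
  have e : 2 * (2 * M) = 4 * M := by ring
  rw [e] at h
  exact h

theorem CutoffBound.c1_wtxx (hM : CutoffBound F M) {L : ℝ} (hL : 0 < L) :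
    C1Weight (wtxx F L) (wtxxx F L) (max (4 * M) (4 * M / L) / L / L) := by
  have h := (((hM.wH1.const_mul 2).odd_div hL).div_const hL).div_const hL
  rw [abs_two] at h
  have e : 2 * (2 * M) = 4 * M := by ring
  rw [e] at h
  exact h

theorem CutoffBound.abs_flux_le (hM : CutoffBound F M) (y : ℝ) :
    |oddP (fun y => y * cutH F y) y| ≤ 2 * M := abs_oddP_le hM.wY.bound' y

theorem CutoffBound.c1_fluxW (hM : CutoffBound F M) {β s : ℝ} (hs : 0 < s) :
    C1Weight (fluxW F β s) (fluxWx F β s)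
      (|-β * s ^ (β - 1)| * max (2 * M) (2 * M / s ^ β)) := by
  have hL := Real.rpow_pos_of_pos hs β
  have h := (hM.wY.even_div hL).const_mul (-β * s ^ (β - 1))
  have e : fluxWx F β s = fun x => -β * s ^ (β - 1)
      * (oddP (fun y => y * cutH F y) (x / s ^ β) / s ^ β) := by
    ext x
    rw [fluxWx, Real.rpow_sub_one hs.ne']
    field_simp
  rw [e]
  exact h

theorem CutoffBound.abs_fluxW_le (hM : CutoffBound F M) {β s : ℝ} (hs : 0 < s) (hβ : 0 < β)
    (hβ1 : β < 1) (x : ℝ) : |fluxW F β s x| ≤ 2 * M * s ^ (β - 1) := by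
  have h := abs_evenP_le hM.wY.bound (x / s ^ β)
  have hp := Real.rpow_pos_of_pos hs (β - 1)
  rw [fluxW, abs_mul, abs_mul, abs_neg, abs_of_pos hβ, abs_of_pos hp]
  calc _ ≤ 1 * s ^ (β - 1) * (2 * M) := by gcongr
    _ = _ := by ring

theorem CutoffBound.abs_fluxWs_le (hM : CutoffBound F M) {β s : ℝ} (hs : 0 < s) (hβ : 0 < β)
    (hβ1 : β < 1) (x : ℝ) : |fluxWs F β s x| ≤ 2 * M * s ^ (β - 2) := by
  have h1 := abs_evenP_le hM.wY.bound (x / s ^ β)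
  have h2 := abs_evenP_le hM.wY2 (x / s ^ β)
  have hp := Real.rpow_pos_of_pos hs (β - 2)
  have hM0 := hM.pos
  rw [fluxWs, abs_mul, abs_of_pos hp, mul_comm]
  refine mul_le_mul_of_nonneg_right ((abs_add_le _ _).trans ?_) hp.le
  rw [abs_mul (-β * (β - 1)), abs_mul (β ^ 2), abs_of_pos (by nlinarith : 0 < -β * (β - 1)),
    abs_of_pos (by positivity : 0 < β ^ 2)]
  -- The two coefficients add up to `β(1 - β) + β² = β`, which is less than 1.
  calc _ ≤ -β * (β - 1) * (2 * M) + β ^ 2 * (2 * M) :=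
        add_le_add (mul_le_mul_of_nonneg_left h1 (by nlinarith))
          (mul_le_mul_of_nonneg_left h2 (by positivity))
    _ = β * (2 * M) := by ring
    _ ≤ 2 * M := by nlinarith

theorem hasDerivAt_fluxW (hM : CutoffBound F M) {β s : ℝ} (hs : 0 < s) (x : ℝ) :
    HasDerivAt (fun s => fluxW F β s x) (fluxWs F β s x) s := by
  have h1 := (Real.hasDerivAt_rpow_const (p := β - 1) (Or.inl hs.ne')).const_mul (-β)
  have h2 := (hasDerivAt_evenP hM.wY.hasDerivAt (x / s ^ β)).comp s (hasDerivAt_div_rpow hs x)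
  refine (h1.mul h2).congr_deriv ?_
  have e := mul_oddP (fun y => y * cutH F y) (x / s ^ β)
  have e1 : s ^ (β - 1) = s ^ (β - 2) * s := by
    rw [← Real.rpow_add_one hs.ne']; ring_nf
  have e2 : s ^ (β - 1 - 1) = s ^ (β - 2) := by ring_nf
  have e3 : evenP (fun y => y ^ 2 * cutH F y) (x / s ^ β)
      = x / s ^ β * oddP (fun y => y * cutH F y) (x / s ^ β) := by
    rw [e]; simp only [evenP]; ring
  simp only [Function.comp_apply, fluxWs]
  rw [e3, e2, e1]
  field_simp

theorem hasDerivAt_wt (hM : CutoffBound F M) {β s : ℝ} (hs : 0 < s) (x : ℝ) :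
    HasDerivAt (fun s => wt F (s ^ β) x) (wts F β s x) s := by
  have h2 := (hasDerivAt_oddP hM.wW.hasDerivAt (x / s ^ β)).comp s (hasDerivAt_div_rpow hs x)
  refine h2.congr_deriv ?_
  rw [wts, ← mul_evenP]
  simp only [evenP]
  ring

/-- Every bound is a negative power of `s`, so the worst case on `[t₀, T]` is `t₀`. This constant
only licenses the mass law; the quantitative estimates use the pointwise bounds. -/
theorem stWeight_flux (hM : CutoffBound F M) {β t₀ T : ℝ} (h0 : 0 < t₀) (hβ : 0 < β)
    (hβ1 : β < 1) : ∃ B, STWeight t₀ T (fluxW F β) (fluxWs F β) (fluxWx F β) B := by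
  have hM0 := hM.pos
  have pos : ∀ s ∈ Icc t₀ T, 0 < s := fun s hs => h0.trans_le hs.1
  have my := hM.wY.measurable
  have my' := hM.wY.measurable'
  have my2 : Measurable fun y => y ^ 2 * cutH F y := (measurable_id.pow_const 2).mul hM.wH.measurable
  refine ⟨max (max (2 * M * t₀ ^ (β - 1)) (t₀⁻¹ * (2 * M))) (2 * M * t₀ ^ (β - 2)), ?_, ?_, ?_,
    fun x s hs => hasDerivAt_fluxW hM (pos s hs) x, fun s hs => ⟨(hM.c1_fluxW (pos s hs)).hasDerivAt,
    fun x => ?_, fun x => ?_⟩, fun s hs x => ?_⟩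
  · exact ((measurable_rpow_fst (β - 1)).const_mul (-β)).mul
      (measurable_profile_div (measurable_evenP my) β)
  · exact (measurable_rpow_fst (β - 2)).mul
      (((measurable_profile_div (measurable_evenP my) β).const_mul (-β * (β - 1))).add
      ((measurable_profile_div (measurable_evenP my2) β).const_mul (β ^ 2)))
  · exact (measurable_fst.inv.const_mul (-β)).mul (measurable_profile_div (measurable_oddP my') β)
  · refine ((hM.abs_fluxW_le (pos s hs) hβ hβ1 x).trans ?_).trans
      ((le_max_left _ _).trans (le_max_left _ _))
    exact mul_le_mul_of_nonneg_left (Real.rpow_le_rpow_of_nonpos h0 hs.1 (by linarith))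
      (by positivity)
  · refine le_trans ?_ ((le_max_right _ _).trans (le_max_left _ _))
    have hsp := pos s hs
    rw [fluxWx, abs_mul, abs_mul, abs_neg, abs_of_pos hβ, abs_of_pos (inv_pos.2 hsp)]
    have : s⁻¹ ≤ t₀⁻¹ := inv_anti₀ h0 hs.1
    calc _ ≤ 1 * t₀⁻¹ * (2 * M) := by
          gcongr
          exact hM.abs_flux_le _
      _ = _ := by ring
  · refine ((hM.abs_fluxWs_le (pos s hs) hβ hβ1 x).trans ?_).trans (le_max_right _ _)
    exact mul_le_mul_of_nonneg_left (Real.rpow_le_rpow_of_nonpos h0 hs.1 (by linarith))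
      (by positivity)

theorem stWeight_wt (hM : CutoffBound F M) {β t₀ T : ℝ} (h0 : 0 < t₀) (hβ : 0 < β) : ∃ B,
    STWeight t₀ T (fun s => wt F (s ^ β)) (wts F β) (fun s => wtx F (s ^ β)) B ∧
    Measurable (Function.uncurry fun s => wtxx F (s ^ β)) ∧
    ∀ s ∈ Icc t₀ T, C1Weight (wtx F (s ^ β)) (wtxx F (s ^ β)) B := by
  have hM0 := hM.pos
  have pos : ∀ s ∈ Icc t₀ T, 0 < s := fun s hs => h0.trans_le hs.1
  have hL0 := Real.rpow_pos_of_pos h0 β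
  have hL : ∀ s ∈ Icc t₀ T, t₀ ^ β ≤ s ^ β := fun s hs => Real.rpow_le_rpow h0.le hs.1 hβ.le
  have posL : ∀ s ∈ Icc t₀ T, 0 < s ^ β := fun s hs => Real.rpow_pos_of_pos (pos s hs) β
  have mL := measurable_rpow_fst β
  set B1 := max (2 * M) (2 * M / t₀ ^ β)
  set B2 := max (4 * M) (4 * M / t₀ ^ β) / t₀ ^ β
  set B3 := 2 * β * t₀⁻¹ * (2 * M)
  refine ⟨max (max B1 B2) B3, ⟨?_, ?_, ?_, fun x s hs => hasDerivAt_wt hM (pos s hs) x,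
    fun s hs => (hM.c1_wt (posL s hs)).mono ?_, fun s hs x => ?_⟩, ?_,
    fun s hs => (hM.c1_wtx (posL s hs)).mono ?_⟩
  · exact measurable_profile_div (measurable_oddP hM.wW.measurable) β
  · exact (measurable_fst.inv.const_mul (-2 * β)).mul
      (measurable_profile_div (measurable_oddP hM.wY.measurable') β)
  · exact (measurable_profile_div (measurable_evenP hM.wW.measurable') β).div mL
  · refine le_trans (max_le_max le_rfl ?_) ((le_max_left _ _).trans (le_max_left _ _))
    exact div_le_div_of_nonneg_left (by positivity) hL0 (hL s hs)
  · refine le_trans ?_ (le_max_right _ _)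
    have hsp := pos s hs
    rw [wts, abs_mul, abs_mul, abs_mul, abs_of_pos hβ, abs_of_pos (inv_pos.2 hsp)]
    have : s⁻¹ ≤ t₀⁻¹ := inv_anti₀ h0 hs.1
    have e : |(-2 : ℝ)| = 2 := by norm_num
    rw [e]
    simp only [B3]
    gcongr
    exact hM.abs_flux_le _
  · exact ((measurable_profile_div (measurable_oddP (hM.wH1.measurable.const_mul 2)) β).div mL).div
      mL
  · refine le_trans ?_ ((le_max_right _ _).trans (le_max_left _ _))
    have h1 : 4 * M / s ^ β ≤ 4 * M / t₀ ^ β :=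
      div_le_div_of_nonneg_left (by positivity) hL0 (hL s hs)
    exact div_le_div₀ (by positivity) (max_le_max le_rfl h1) hL0 (hL s hs)

end

/-! ### The source term -/

section

variable {F : ℝ → ℝ} {a b M p σ K β : ℝ} {V : ℝ → ℝ → ℝ} {u : ℝ → ℝ → ℂ}

theorem IsEnergySolution.bil_src (hu : IsEnergySolution p V u) (hV : IsLocalizedPotential σ K V)
    (hσ : 0 ≤ σ) (hp : 1 < p) {m : ℝ → ℝ} {B : ℝ} (hm : BddWeight m B) (s : ℝ) {g : ℝ → ℂ}
    (hg : MemLp g 2) : bil m (extSrc p V u s) g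
      = bil (fun x => m x * V (max s 0) x) (extU u s) g + bil m (fun x => pw p (extU u s x)) g := by
  rw [← bil_mul_left]
  exact hm.bil_add_left (hu.memLp_V hV hσ s) (hu.memLp_pw hp s) hg

/-- The source is `u` times a real function, so it produces no local mass. -/
theorem IsEnergySolution.bil_src_self_im (hu : IsEnergySolution p V u)
    (hV : IsLocalizedPotential σ K V) (hσ : 0 ≤ σ) (hp : 1 < p) {m : ℝ → ℝ} {B : ℝ}
    (hm : BddWeight m B) (s : ℝ) : (bil m (extSrc p V u s) (extU u s)).im = 0 := by
  rw [hu.bil_src hV hσ hp hm s (hu.isH1 s).memLp, Complex.add_im, bil_self_im, bil_pw_self hp,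
    Complex.ofReal_im, add_zero]

theorem bil_zero_weight (f g : ℝ → ℂ) : bil (fun _ => 0) f g = 0 := by simp [bil]

/-- Conservation of mass. -/
theorem IsEnergySolution.mass_conservation (hu : IsEnergySolution p V u)
    (hV : IsLocalizedPotential σ K V) (hσ : 0 ≤ σ) (hp : 1 < p) {T : ℝ} (hT : 0 ≤ T) :
    l2n (extU u T) ^ 2 = l2n (extU u 0) ^ 2 := by
  -- With the constant weight 1 neither flux nor weight derivative remains in the mass law.
  have hΦ : STWeight 0 T (fun _ _ => 1) (fun _ _ => 0) (fun _ _ => 0) 1 :=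
    ⟨measurable_const, measurable_const, measurable_const, fun _ s _ => hasDerivAt_const s 1,
      fun _ _ => ⟨fun x => hasDerivAt_const x 1, by simp, by simp⟩, by simp⟩
  have h := ((hu.evolution hV hσ hp).mass_law le_rfl hT hΦ).2
  have e : ∀ s ∈ uIcc 0 T, massRate (fun _ _ => 1) (fun _ _ => 0) (fun _ _ => 0) (extU u) (extUx u)
      (extSrc p V u) s = 0 := fun s hs => by
    rw [uIcc_of_le hT] at hs
    rw [massRate, hu.bil_src_self_im hV hσ hp (hΦ.space s hs).weight]
    simp [bil_zero_weight]
  rw [intervalIntegral.integral_congr e, intervalIntegral.integral_zero, bil_self_re,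
    bil_self_re] at h
  simp only [one_mul] at h
  rw [← l2NormSq_eq (hu.isH1 T).memLp, ← l2NormSq_eq (hu.isH1 0).memLp]
  exact sub_eq_zero.1 h

theorem nonlinTerm_eq (hF : IsExteriorCutoff F a b) (hp : 1 < p) {s : ℝ} (hs : 0 < s ^ β)
    (f : ℝ → ℂ) : nonlinTerm F p β s f
      = (bil (fun x => evenP (cutH F) (x / s ^ β)) (fun x => pw p (f x)) f).re := by
  rw [bil_pw_self hp, Complex.ofReal_re, nonlinTerm]
  simp_rw [← (hF.isProfile_of_zero_off hF.cutH_zero_off).abs hs]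
  rfl

theorem integrable_nonlinDensity (hF : IsExteriorCutoff F a b) (hM : CutoffBound F M) (hp : 1 < p)
    {s : ℝ} (hs : 0 < s ^ β) {f : ℝ → ℂ} (hf : MemLp f 2) (hpf : MemLp (fun x => pw p (f x)) 2) :
    Integrable (nonlinDensity F p β s f) := by
  have h := ((hM.wH.weight.even_div (s ^ β)).integrable hpf hf).re
  refine h.congr (ae_of_all _ fun x => ?_)
  simp only [nonlinDensity]
  rw [mul_assoc, pw_mul_conj hp]
  have e := (hF.isProfile_of_zero_off hF.cutH_zero_off).abs hs x
  rw [← e]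
  simp [cutH]

/-- The potential energy part of the Morawetz rate. -/
theorem IsEnergySolution.potential_rate (hu : IsEnergySolution p V u)
    (hV : IsLocalizedPotential σ K V) (hσ : 0 ≤ σ) (hM : CutoffBound F M) {L s : ℝ} (hL : 0 < L) :
    (bil (fun x => wtx F L x * V (max s 0) x) (extU u s) (extU u s)).re
      + 2 * (bil (fun x => wt F L x * V (max s 0) x) (extU u s) (extUx u s)).re
      = -(bil (fun x => wt F L x * deriv (V (max s 0)) x) (extU u s) (extU u s)).re := by
  have h0 : 0 ≤ max s 0 := le_max_right _ _
  have v : C1Weight (V (max s 0)) (deriv (V (max s 0))) K :=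
    ⟨fun x => (hV.differentiable _ h0 x).hasDerivAt, hV.abs_le hσ h0, hV.abs_deriv_le hσ h0⟩
  have w := hM.c1_wt hL
  -- Differentiating the product `w V` moves the derivative off `u`; the `w_x V` contributions
  -- cancel and only `w V_x` is left.
  have e := (w.mul v).bil_self_deriv (hu.isH1 s)
  have mul : ∀ {m n : ℝ → ℝ} {B B' : ℝ}, BddWeight m B → BddWeight n B' →
      BddWeight (fun x => m x * n x) (B * B') := fun hm hn =>
    ⟨hm.meas.mul hn.meas, fun x => by
      rw [abs_mul]
      exact mul_le_mul (hm.bound x) (hn.bound x) (abs_nonneg _) ((abs_nonneg _).trans (hm.bound x))⟩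
  rw [bil_add_weight (mul w.weight' v.weight) (mul w.weight v.weight') (hu.isH1 s).memLp
    (hu.isH1 s).memLp, Complex.add_re, bil_re_symm _ (extUx u s)] at e
  linarith

theorem rpow_neg_three_mul {s : ℝ} (hs : 0 < s) : s ^ (-3 * β) = ((s ^ β) ^ 3)⁻¹ := by
  rw [← Real.rpow_natCast, ← Real.rpow_mul hs.le, ← Real.rpow_neg hs.le]
  congr 1
  push_cast
  ring

theorem bil_wtx (L : ℝ) (f g : ℝ → ℂ) : (bil (wtx F L) f g).re
    = 2 / L * (bil (fun x => evenP (cutH F) (x / L)) f g).re := by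
  have e : wtx F L = fun x => 2 / L * evenP (cutH F) (x / L) := by
    ext x; simp only [wtx, evenP]; ring
  rw [e, bil_const_mul_weight, Complex.re_ofReal_mul]

/-- The rate of change of the Morawetz functional. -/
theorem IsEnergySolution.rate_eq (hu : IsEnergySolution p V u) (hV : IsLocalizedPotential σ K V)
    (hσ : 0 ≤ σ) (hp : 1 < p) (hF : IsExteriorCutoff F a b) (hM : CutoffBound F M) {s : ℝ}
    (hs : 0 < s) :
    moraRate (fun s => wt F (s ^ β)) (wts F β) (fun s => wtx F (s ^ β)) (fun s => wtxx F (s ^ β))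
        (extU u) (extUx u) (extSrc p V u) s
      = massRate (fluxW F β) (fluxWs F β) (fluxWx F β) (extU u) (extUx u) (extSrc p V u) s
        + (4 * s ^ (-β) * linTerm F β s (u s)
          + 2 * s ^ (-β) * ((p - 1) / (p + 1)) * nonlinTerm F p β s (u s))
        + s ^ (-3 * β) * locMass (cutG F) β s (u s)
        - (bil (fluxWs F β s) (extU u s) (extU u s)).re
        - (bil (fun x => wt F (s ^ β) x * deriv (V (max s 0)) x) (extU u s) (extU u s)).re := by
  have hL := Real.rpow_pos_of_pos hs β
  have hx := hu.isH1 s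
  have hus : u s = extU u s := by rw [extU, max_eq_left hs.le]
  have w := hM.c1_wt hL
  -- The motion of the cutoff is recognized as a mass flux: the factor 2 is the one in `massRate`.
  have e1 : (bil (wts F β s) (extUx u s) (extU u s)).im
      = 2 * (bil (fluxWx F β s) (extUx u s) (extU u s)).im := by
    have : wts F β s = fun x => 2 * fluxWx F β s x := by
      ext x; simp only [wts, fluxWx]; ring
    rw [this, bil_const_mul_weight, Complex.im_ofReal_mul]
  have e2 := (hM.c1_wtxx hL).bil_self_deriv hx
  have e3 : (bil (wtxxx F (s ^ β)) (extU u s) (extU u s)).re = 2 / (s ^ β) ^ 3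
      * (bil (fun x => evenP (deriv (deriv (cutH F))) (x / s ^ β)) (extU u s) (extU u s)).re := by
    have : wtxxx F (s ^ β)
        = fun x => 2 / (s ^ β) ^ 3 * evenP (deriv (deriv (cutH F))) (x / s ^ β) := by
      ext x; simp only [wtxxx, evenP]; field_simp
    rw [this, bil_const_mul_weight, Complex.re_ofReal_mul]
  have e4 := linTerm_eq hF hM hL hx
  have e5 := w.bil_pw hx hp
  have e6 := hu.potential_rate hV hσ hM (s := s) hL
  have e7 := nonlinTerm_eq hF hp hL (extU u s)
  rw [bil_wtx, ← e7] at e5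
  rw [moraRate, massRate, hu.bil_src_self_im hV hσ hp (hM.c1_fluxW hs).weight, e1,
    hu.bil_src hV hσ hp w.weight' s hx.memLp, hu.bil_src hV hσ hp w.weight s hx.memLp',
    Complex.add_re, Complex.add_re, bil_wtx (s ^ β) (extUx u s), bil_wtx (s ^ β) (fun x => pw p _),
    ← e7, hus, locMass_eq (hF.isProfile_of_zero_off (cutG_zero_off hF)) hL,
    Real.rpow_neg hs.le, rpow_neg_three_mul hs]
  -- This term enters the rate doubled, against a full `2/L` times the nonlinear term from `w_x`;
  -- hence `1 - 2/(p+1) = (p-1)/(p+1)`.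
  have e8 : (bil (wt F (s ^ β)) (fun x => pw p (extU u s x)) (extUx u s)).re
      = -(2 / s ^ β * nonlinTerm F p β s (extU u s)) / (p + 1) := by
    rw [eq_div_iff (by linarith)]
    linarith
  rw [e8]
  -- A further integration by parts gives minus one half of the form with weight `wtxxx`.
  have e9 : (bil (wtxx F (s ^ β)) (extUx u s) (extU u s)).re = -1 / (s ^ β) ^ 3
      * (bil (fun x => evenP (deriv (deriv (cutH F))) (x / s ^ β)) (extU u s) (extU u s)).re := by
    rw [e3] at e2
    linear_combination (1 / 2 : ℝ) * e2
  have e10 : 4 * (s ^ β)⁻¹ * linTerm F β s (extU u s) = (s ^ β)⁻¹ * (4 * linTerm F β s (extU u s)) :=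
    by ring
  rw [e9, e10, e4]
  have hp1 : p + 1 ≠ 0 := by linarith
  have hL0 := hL.ne'
  generalize s ^ β = L at *
  linear_combination (norm := skip) e6
  field_simp
  ring

/-- The vector field vanishes for `|x| ≤ a s^β`; beyond that radius `⟨x⟩ ≥ |x| ≥ a s^β`, and the
decay of `∂ₓV` becomes decay in time. -/
theorem abs_wt_mul_deriv_le (hV : IsLocalizedPotential σ K V) (hF : IsExteriorCutoff F a b)
    (hM : CutoffBound F M) (hσ : 0 ≤ σ) {s : ℝ} (hs : 0 < s) (x : ℝ) :
    |wt F (s ^ β) x * deriv (V (max s 0)) x|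
      ≤ 2 * M * (K * a ^ (-(σ + 1))) * s ^ (-(β * (σ + 1))) := by
  have hL := Real.rpow_pos_of_pos hs β
  have ha := hF.pos
  have h0 : 0 ≤ max s 0 := le_max_right _ _
  have hK : 0 ≤ K := (abs_nonneg _).trans (hV.abs_le hσ h0 x)
  have hM0 := hM.pos
  by_cases hx : |x| ≤ a * s ^ β
  · have h1 : x / s ^ β ≤ a := by
      rw [div_le_iff₀ hL]; exact (le_abs_self x).trans hx
    have h2 : -(x / s ^ β) ≤ a := by
      rw [← neg_div, div_le_iff₀ hL]; exact (neg_le_abs x).trans hx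
    have : wt F (s ^ β) x = 0 := by simp [wt, oddP, hF.zero _ h1, hF.zero _ h2]
    rw [this, zero_mul, abs_zero]
    positivity
  · rw [not_le] at hx
    have hd := hV.deriv_bound _ h0 x
    have hj : (a * s ^ β) ^ (σ + 1) ≤ jBra x ^ (σ + 1) :=
      Real.rpow_le_rpow (by positivity) (hx.le.trans (abs_le_jBra x)) (by linarith)
    have e : a ^ (-(σ + 1)) * s ^ (-(β * (σ + 1))) = ((a * s ^ β) ^ (σ + 1))⁻¹ := by
      rw [Real.mul_rpow ha.le hL.le, ← Real.rpow_mul hs.le, Real.rpow_neg ha.le,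
        Real.rpow_neg hs.le, mul_inv]
    have hq : 0 < (a * s ^ β) ^ (σ + 1) := by positivity
    have h3 : |deriv (V (max s 0)) x| ≤ K * ((a * s ^ β) ^ (σ + 1))⁻¹ := by
      rw [← div_eq_mul_inv, le_div_iff₀ hq, mul_comm]
      exact (mul_le_mul_of_nonneg_right hj (abs_nonneg _)).trans hd
    have h4 : |wt F (s ^ β) x| ≤ 2 * M := abs_oddP_le hM.wW.bound _
    rw [abs_mul]
    calc _ ≤ 2 * M * (K * ((a * s ^ β) ^ (σ + 1))⁻¹) :=
          mul_le_mul h4 h3 (abs_nonneg _) (by positivity)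
      _ = _ := by rw [← e]; ring

end

/-! ### The integrated identity -/

theorem intervalIntegrable_bil_re {m : ℝ → ℝ → ℝ} {g g' : ℝ → ℝ → ℂ} {t₀ T M : ℝ} (hle : t₀ ≤ T)
    (hm : Measurable (Function.uncurry m)) (hb : ∀ s ∈ Icc t₀ T, BddWeight (m s) M)
    (hg : MeasFam t₀ T g) (hg' : MeasFam t₀ T g') :
    IntervalIntegrable (fun s => (bil (m s) (g s) (g' s)).re) volume t₀ T := by
  obtain ⟨C, hC⟩ := exists_molBil_bound hb hg hg'
  exact (tendsto_intervalIntegral_of_bounded hle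
    (fun n => Complex.measurable_re.comp (measurable_molBil hm hg hg' n))
    (fun n s hs => (Complex.abs_re_le_norm _).trans (hC n s hs))
    (fun s hs => (Complex.continuous_re.tendsto _).comp (tendsto_molBil (hb s hs) hg hg'))).1

theorem intervalIntegrable_rpow_pos {t T : ℝ} (ht : 0 < t) (hle : t ≤ T) (r : ℝ) :
    IntervalIntegrable (fun s => s ^ r) volume t T :=
  intervalIntegral.intervalIntegrable_rpow (Or.inr fun h => by
    rw [uIcc_of_le hle] at h; exact absurd h.1 (not_le.2 ht))

theorem integral_rpow_neg_le {t T : ℝ} (ht : 0 < t) (hle : t ≤ T) {r : ℝ} (hr : 1 < r) :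
    ∫ s in t..T, s ^ (-r) ≤ t ^ (1 - r) / (r - 1) := by
  have h0 : (0 : ℝ) ∉ uIcc t T := fun h => by
    rw [uIcc_of_le hle] at h; exact absurd h.1 (not_le.2 ht)
  have e : -r + 1 = -(r - 1) := by ring
  have hr' : 0 < r - 1 := by linarith
  rw [integral_rpow (Or.inr ⟨by linarith, h0⟩), e, div_neg, ← neg_div, neg_sub (r : ℝ) 1 |>.symm]
  have : 0 ≤ T ^ (-(r - 1)) := Real.rpow_nonneg (ht.le.trans hle) _
  refine div_le_div_of_nonneg_right ?_ hr'.le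
  linarith

section

variable {F : ℝ → ℝ} {a b M p σ K β t T : ℝ} {V : ℝ → ℝ → ℝ} {u : ℝ → ℝ → ℂ}

theorem continuousOn_rpow_pos (r : ℝ) (ht : 0 < t) (hle : t ≤ T) :
    ContinuousOn (fun s : ℝ => s ^ r) (uIcc t T) := fun s hs => by
  rw [uIcc_of_le hle] at hs
  exact (Real.continuousAt_rpow_const s r (Or.inl (ht.trans_le hs.1).ne')).continuousWithinAt

theorem IsEnergySolution.intervalIntegrable_locMass (hu : IsEnergySolution p V u)
    (hV : IsLocalizedPotential σ K V) (hσ : 0 ≤ σ) (hp : 1 < p) {G : ℝ → ℝ} (hG : BddWeight G M)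
    (hG0 : IsProfile G) (ht : 0 < t) (hle : t ≤ T) :
    IntervalIntegrable (fun s => s ^ (-3 * β) * locMass G β s (u s)) volume t T := by
  have h := intervalIntegrable_bil_re (m := fun s x => evenP G (x / s ^ β)) hle
    (measurable_profile_div (measurable_evenP hG.meas) β) (fun s _ => hG.even_div _)
    (hu.evolution hV hσ hp).fam_u (hu.evolution hV hσ hp).fam_u
  refine (h.continuousOn_mul (continuousOn_rpow_pos (-3 * β) ht hle)).congr fun s hs => ?_
  rw [uIoc_of_le hle] at hs
  have h0 : 0 < s := ht.trans hs.1
  simp only [locMass_eq hG0 (Real.rpow_pos_of_pos h0 β), extU, max_eq_left h0.le]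

theorem IsEnergySolution.intervalIntegrable_nonlinTerm (hu : IsEnergySolution p V u)
    (hV : IsLocalizedPotential σ K V) (hσ : 0 ≤ σ) (hp : 1 < p) (hF : IsExteriorCutoff F a b)
    (hM : CutoffBound F M) (ht : 0 < t) (hle : t ≤ T) :
    IntervalIntegrable (fun s => s ^ (-β) * nonlinTerm F p β s (u s)) volume t T := by
  have h := intervalIntegrable_bil_re (m := fun s x => evenP (cutH F) (x / s ^ β)) hle
    (measurable_profile_div (measurable_evenP hM.wH.measurable) β)
    (fun s _ => hM.wH.weight.even_div _) (hu.fam_pw hp t T) (hu.evolution hV hσ hp).fam_u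
  refine (h.continuousOn_mul (continuousOn_rpow_pos (-β) ht hle)).congr fun s hs => ?_
  rw [uIoc_of_le hle] at hs
  have h0 : 0 < s := ht.trans hs.1
  simp only [nonlinTerm_eq hF hp (Real.rpow_pos_of_pos h0 β), extU, max_eq_left h0.le]

/-- The dependence of `gammaOp` on time goes through chosen weak derivatives, so integrability is
read off from `linTerm_eq`, which expresses the term by weighted forms. -/
theorem IsEnergySolution.intervalIntegrable_linTerm (hu : IsEnergySolution p V u)
    (hV : IsLocalizedPotential σ K V) (hσ : 0 ≤ σ) (hp : 1 < p) (hF : IsExteriorCutoff F a b)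
    (hM : CutoffBound F M) (ht : 0 < t) (hle : t ≤ T) :
    IntervalIntegrable (fun s => s ^ (-β) * linTerm F β s (u s)) volume t T := by
  have gu : MeasFam t T (extU u) := (hu.evolution hV hσ hp).fam_u
  have gx : MeasFam t T (extUx u) := (hu.evolution hV hσ hp).fam_ux
  have int : ∀ {P : ℝ → ℝ} {g : ℝ → ℝ → ℂ} (r : ℝ), BddWeight P M → MeasFam t T g →
      IntervalIntegrable (fun s => s ^ r * (bil (fun x => evenP P (x / s ^ β)) (g s) (g s)).re)
        volume t T := fun r hP hg =>
    (intervalIntegrable_bil_re (m := fun s x => evenP _ (x / s ^ β)) hle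
      (measurable_profile_div (measurable_evenP hP.meas) β) (fun s _ => hP.even_div _) hg
      hg).continuousOn_mul (continuousOn_rpow_pos r ht hle)
  have h := ((int (-β) hM.wH.weight gx).sub
    ((int (-3 * β) ⟨measurable_cutG hF, hM.wG⟩ gu).const_mul (1 / 4))).sub
    ((int (-3 * β) hM.wH1.weight' gu).const_mul (1 / 4))
  refine h.congr fun s hs => ?_
  rw [uIoc_of_le hle] at hs
  have h0 : 0 < s := ht.trans hs.1
  have hL := Real.rpow_pos_of_pos h0 β
  have e := linTerm_eq hF hM hL (hu.isH1 s)
  have hus : u s = extU u s := by rw [extU, max_eq_left h0.le]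
  rw [hus, ← mul_div_cancel_left₀ (linTerm F β s (extU u s)) (four_ne_zero (α := ℝ)), e,
    rpow_neg_three_mul h0, Real.rpow_neg h0.le]
  field_simp

/-- The integrand of the positive terms. -/
def posRate (F : ℝ → ℝ) (p β : ℝ) (u : ℝ → ℝ → ℂ) (s : ℝ) : ℝ :=
  4 * s ^ (-β) * linTerm F β s (u s)
    + 2 * s ^ (-β) * ((p - 1) / (p + 1)) * nonlinTerm F p β s (u s)

theorem IsEnergySolution.intervalIntegrable_posRate (hu : IsEnergySolution p V u)
    (hV : IsLocalizedPotential σ K V) (hσ : 0 ≤ σ) (hp : 1 < p) (hF : IsExteriorCutoff F a b)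
    (hM : CutoffBound F M) (ht : 0 < t) (hle : t ≤ T) :
    IntervalIntegrable (posRate F p β u) volume t T := by
  refine (((hu.intervalIntegrable_linTerm (β := β) hV hσ hp hF hM ht hle).const_mul 4).add
    ((hu.intervalIntegrable_nonlinTerm (β := β) hV hσ hp hF hM ht hle).const_mul
      (2 * ((p - 1) / (p + 1))))).congr fun s _ => ?_
  simp only [posRate]
  ring

/-- The constant in the error estimate. -/
def errConst (M K a σ β : ℝ) : ℝ :=
  4 * M + 2 * M / (1 - β) + 2 * M * (K * a ^ (-(σ + 1))) / (β * (σ + 1) - 1)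

theorem abs_bil_self_re_le {m : ℝ → ℝ} {B : ℝ} (hm : BddWeight m B) {f : ℝ → ℂ} (hf : MemLp f 2) :
    |(bil m f f).re| ≤ B * l2n f ^ 2 := by
  rw [sq]
  exact (Complex.abs_re_le_norm _).trans (hm.norm_bil_le hf hf)

/-- The integrated Morawetz identity. -/
theorem IsEnergySolution.morawetz_identity (hu : IsEnergySolution p V u)
    (hV : IsLocalizedPotential σ K V) (hp : 1 < p) (hF : IsExteriorCutoff F a b)
    (hM : CutoffBound F M) (hβ : 0 < β) (hβ1 : β < 1) (hβσ : 1 < β * (σ + 1)) (ht : 0 < t)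
    (hle : t ≤ T) : ∃ E : ℝ,
      |E| ≤ errConst M K a σ β * (t ^ (1 - β * (σ + 1)) + t ^ (β - 1)) * l2NormSq (u 0) ∧
      (bil (wt F (T ^ β)) (extUx u T) (extU u T)).im
          - (bil (wt F (t ^ β)) (extUx u t) (extU u t)).im
        = (∫ s in t..T, posRate F p β u s)
          + (∫ s in t..T, s ^ (-3 * β) * locMass (cutG F) β s (u s)) + E := by
  have hσ : 0 ≤ σ := by nlinarith
  have ev := hu.evolution hV hσ hp
  have hM0 := hM.pos
  have ha := hF.pos
  have hK : 0 ≤ K := (abs_nonneg _).trans (hV.abs_le hσ le_rfl 0)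
  obtain ⟨B, hΦ⟩ := stWeight_flux (T := T) hM ht hβ hβ1
  obtain ⟨B', hw, hxx, hwx⟩ := stWeight_wt (T := T) hM ht hβ
  obtain ⟨i1, e1⟩ := ev.mass_law ht.le hle hΦ
  obtain ⟨i2, e2⟩ := ev.morawetz_law ht.le hle hw hxx hwx
  have i3 := hu.intervalIntegrable_posRate (β := β) hV hσ hp hF hM ht hle
  have i4 := hu.intervalIntegrable_locMass (β := β) hV hσ hp ⟨measurable_cutG hF, hM.wG⟩
    (hF.isProfile_of_zero_off (cutG_zero_off hF)) ht hle
  set m₀ := l2n (extU u 0) ^ 2 with hm₀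
  have em : l2NormSq (u 0) = m₀ := by
    rw [hm₀, ← l2NormSq_eq (hu.isH1 0).memLp, extU, max_self]
  have hm : ∀ s, 0 < s → l2n (extU u s) ^ 2 = m₀ := fun s hs =>
    hu.mass_conservation hV hσ hp hs.le
  have hm0 : 0 ≤ m₀ := sq_nonneg _
  set mora := moraRate (fun s => wt F (s ^ β)) (wts F β) (fun s => wtx F (s ^ β))
    (fun s => wtxx F (s ^ β)) (extU u) (extUx u) (extSrc p V u) with hmora
  set mass := massRate (fluxW F β) (fluxWs F β) (fluxWx F β) (extU u) (extUx u) (extSrc p V u)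
    with hmass
  -- The remainder is defined by subtraction, so its integrability is free; `rate_eq` then
  -- identifies it with the `Φ_s` term and the potential term.
  set err : ℝ → ℝ := fun s =>
    mora s - mass s - posRate F p β u s - s ^ (-3 * β) * locMass (cutG F) β s (u s) with herr
  have e3 : ∫ s in t..T, err s = (∫ s in t..T, mora s) - (∫ s in t..T, mass s)
      - (∫ s in t..T, posRate F p β u s)
      - ∫ s in t..T, s ^ (-3 * β) * locMass (cutG F) β s (u s) := by
    rw [herr, intervalIntegral.integral_sub ((i2.sub i1).sub i3) i4,
      intervalIntegral.integral_sub (i2.sub i1) i3, intervalIntegral.integral_sub i2 i1]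
  set c := 2 * M * (K * a ^ (-(σ + 1))) with hc
  have hc0 : 0 ≤ c := by positivity
  -- Both exponents are below `-1`, because `β < 1` and `β(σ+1) > 1`.
  have hb : ∀ s, 0 < s → |err s| ≤ 2 * M * m₀ * s ^ (-(2 - β)) + c * m₀ * s ^ (-(β * (σ + 1))) := by
    intro s hs
    have h0 : 0 ≤ max s 0 := le_max_right _ _
    have q := hu.rate_eq (β := β) hV hσ hp hF hM hs
    have q' : err s = -(bil (fluxWs F β s) (extU u s) (extU u s)).re
        - (bil (fun x => wt F (s ^ β) x * deriv (V (max s 0)) x) (extU u s) (extU u s)).re := by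
      simp only [herr, hmora, hmass, posRate, q]
      ring
    have b1 := abs_bil_self_re_le (bddWeight_slice (m := fluxWs F β) (s := s) hΦ.meas_s
      (hM.abs_fluxWs_le hs hβ hβ1)) (hu.isH1 s).memLp
    have b2 := abs_bil_self_re_le (m := fun x => wt F (s ^ β) x * deriv (V (max s 0)) x)
      ⟨(hM.c1_wt (Real.rpow_pos_of_pos hs β)).measurable.mul (measurable_deriv _),
        abs_wt_mul_deriv_le hV hF hM hσ hs⟩ (hu.isH1 s).memLp
    rw [hm s hs] at b1 b2
    rw [q']
    have er : β - 2 = -(2 - β) := by ring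
    rw [er] at b1
    rw [abs_le] at *
    constructor <;> linarith [b1.1, b1.2, b2.1, b2.2]
  have hI : |∫ s in t..T, err s| ≤ 2 * M * m₀ * (t ^ (β - 1) / (1 - β))
      + c * m₀ * (t ^ (1 - β * (σ + 1)) / (β * (σ + 1) - 1)) := by
    have j1 := (intervalIntegrable_rpow_pos ht hle (-(2 - β))).const_mul (2 * M * m₀)
    have j2 := (intervalIntegrable_rpow_pos ht hle (-(β * (σ + 1)))).const_mul (c * m₀)
    have := intervalIntegral.norm_integral_le_of_norm_le (f := err) hle
      (ae_of_all _ fun s hs => hb s (ht.trans hs.1)) (j1.add j2)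
    refine this.trans ?_
    rw [intervalIntegral.integral_add j1 j2, intervalIntegral.integral_const_mul,
      intervalIntegral.integral_const_mul]
    have k1 := integral_rpow_neg_le ht hle (r := 2 - β) (by linarith)
    have k2 := integral_rpow_neg_le ht hle hβσ
    have er : 1 - (2 - β) = β - 1 := by ring
    have er' : 2 - β - 1 = 1 - β := by ring
    rw [er, er'] at k1
    exact add_le_add (mul_le_mul_of_nonneg_left k1 (by positivity))
      (mul_le_mul_of_nonneg_left k2 (by positivity))
  have hflux : ∀ s, t ≤ s →
      |(bil (fluxW F β s) (extU u s) (extU u s)).re| ≤ 2 * M * t ^ (β - 1) * m₀ := fun s hs => by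
    have h0 := ht.trans_le hs
    have b1 := abs_bil_self_re_le (bddWeight_slice (m := fluxW F β) (s := s) hΦ.meas
      (hM.abs_fluxW_le h0 hβ hβ1)) (hu.isH1 s).memLp
    rw [hm s h0] at b1
    refine b1.trans (mul_le_mul_of_nonneg_right (mul_le_mul_of_nonneg_left ?_ (by positivity)) hm0)
    exact Real.rpow_le_rpow_of_nonpos ht hs (by linarith)
  -- The mass law contributes the boundary values of `∫ Φ |u|²`, which together account for the `4M`
  -- in `errConst`.
  refine ⟨(bil (fluxW F β T) (extU u T) (extU u T)).re
    - (bil (fluxW F β t) (extU u t) (extU u t)).re + ∫ s in t..T, err s, ?_, ?_⟩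
  · have f1 := hflux T hle
    have f2 := hflux t le_rfl
    have x0 := Real.rpow_pos_of_pos ht (β - 1)
    have y0 := Real.rpow_pos_of_pos ht (1 - β * (σ + 1))
    have d1 : 0 < 1 - β := by linarith
    have d2 : 0 < β * (σ + 1) - 1 := by linarith
    rw [em]
    generalize t ^ (β - 1) = x at *
    generalize t ^ (1 - β * (σ + 1)) = y at *
    -- One constant multiplies both powers; the mixed products left over are nonnegative and are
    -- discarded.
    have main : errConst M K a σ β * (y + x) * m₀ = 2 * (2 * M * x * m₀)
        + (2 * M * m₀ * (x / (1 - β)) + c * m₀ * (y / (β * (σ + 1) - 1)))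
        + (4 * M * y + 2 * M / (1 - β) * y + c / (β * (σ + 1) - 1) * x) * m₀ := by
      rw [errConst]
      ring
    have rest : 0 ≤ (4 * M * y + 2 * M / (1 - β) * y + c / (β * (σ + 1) - 1) * x) * m₀ := by
      positivity
    rw [main]
    rw [abs_le] at *
    constructor <;> linarith [f1.1, f1.2, f2.1, f2.2, hI.1, hI.2]
  · rw [e3, ← e1, ← e2]
    ring

/-! ### Time integrability of the positive terms under bounded energy -/

theorem l2NormSq_nonneg (f : ℝ → ℂ) : 0 ≤ l2NormSq f := integral_nonneg fun _ => sq_nonneg _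

theorem linTerm_nonneg (s : ℝ) (f : ℝ → ℂ) : 0 ≤ linTerm F β s f := l2NormSq_nonneg _

theorem nonlinTerm_nonneg (hF : IsExteriorCutoff F a b) (s : ℝ) (f : ℝ → ℂ) :
    0 ≤ nonlinTerm F p β s f :=
  integral_nonneg fun _ => mul_nonneg (hF.cutH_nonneg _) (Real.rpow_nonneg (norm_nonneg _) _)

/-- With bounded energy, the positive terms have bounded time integrals. -/
theorem IsEnergySolution.exists_integral_posRate_le (hu : IsEnergySolution p V u)
    (hV : IsLocalizedPotential σ K V) (hp : 1 < p) (hF : IsExteriorCutoff F a b)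
    (hM : CutoffBound F M) (hβ1 : β < 1) (hβσ : 1 < β * (σ + 1)) (hβ3 : 1 / 3 < β)
    (hE : HasBoundedEnergy u) : ∃ I, ∀ T, 1 ≤ T → ∫ s in (1 : ℝ)..T, posRate F p β u s ≤ I := by
  obtain ⟨N, hN⟩ := hE
  have hβ : 0 < β := by linarith
  have hσ : 0 ≤ σ := by nlinarith
  have hM0 := hM.pos
  have hb : ∀ s, l2n (extU u s) ≤ N ∧ l2n (extUx u s) ≤ N := fun s =>
    have h := hN (max s 0) (le_max_right _ _)
    ⟨(l2n_le_h1Norm (hu.isH1 s)).trans h, (l2n_le_h1Norm' (hu.isH1 s)).trans h⟩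
  have hN0 : 0 ≤ N := (l2n_nonneg _).trans (hb 0).1
  have hexp : ∀ s, 0 < s →
      |(bil (wt F (s ^ β)) (extUx u s) (extU u s)).im| ≤ 2 * M * (N * N) := fun s hs => by
    have w : BddWeight (wt F (s ^ β)) (2 * M) :=
      ⟨(hM.c1_wt (Real.rpow_pos_of_pos hs β)).measurable, fun x => abs_oddP_le hM.wW.bound _⟩
    refine (Complex.abs_im_le_norm _).trans
      ((w.norm_bil_le (hu.isH1 s).memLp' (hu.isH1 s).memLp).trans ?_)
    exact mul_le_mul_of_nonneg_left (mul_le_mul (hb s).2 (hb s).1 (l2n_nonneg _) hN0)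
      (by linarith)
  -- In order: the expectations at times 1 and `T`, the localized mass through `∫₁^∞ s^(-3β) ds =
  -- 1/(3β - 1)`, and the error at `t = 1`, where both powers equal 1.
  refine ⟨2 * (2 * M * (N * N)) + 2 * M * N ^ 2 / (3 * β - 1)
    + errConst M K a σ β * 2 * l2NormSq (u 0), fun T hT => ?_⟩
  obtain ⟨E, hE, e⟩ := hu.morawetz_identity hV hp hF hM hβ hβ1 hβσ one_pos hT
  rw [Real.one_rpow, Real.one_rpow, one_add_one_eq_two] at hE
  have k := integral_rpow_neg_le one_pos hT (r := 3 * β) (by linarith)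
  have hloc : |∫ s in (1 : ℝ)..T, s ^ (-3 * β) * locMass (cutG F) β s (u s)|
      ≤ 2 * M * N ^ 2 * (1 / (3 * β - 1)) := by
    have j := (intervalIntegrable_rpow_pos one_pos hT (-(3 * β))).const_mul (2 * M * N ^ 2)
    refine (intervalIntegral.norm_integral_le_of_norm_le
      (f := fun s => s ^ (-3 * β) * locMass (cutG F) β s (u s)) hT
      (ae_of_all _ fun s hs => ?_) j).trans ?_
    · have hs0 : 0 < s := one_pos.trans hs.1
      have hus : u s = extU u s := by rw [extU, max_eq_left hs0.le]
      have b1 := abs_bil_self_re_le (BddWeight.even_div ⟨measurable_cutG hF, hM.wG⟩ (s ^ β))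
        (hu.isH1 s).memLp
      rw [← locMass_eq (hF.isProfile_of_zero_off (cutG_zero_off hF))
        (Real.rpow_pos_of_pos hs0 β)] at b1
      have b2 : l2n (extU u s) ^ 2 ≤ N ^ 2 := pow_le_pow_left₀ (l2n_nonneg _) (hb s).1 2
      have x0 := Real.rpow_pos_of_pos hs0 (-(3 * β))
      rw [norm_mul, Real.norm_eq_abs, Real.norm_eq_abs, hus, neg_mul, abs_of_pos x0, mul_comm]
      refine mul_le_mul_of_nonneg_right (b1.trans ?_) x0.le
      exact mul_le_mul_of_nonneg_left b2 (by positivity)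
    · rw [intervalIntegral.integral_const_mul]
      rw [Real.one_rpow] at k
      exact mul_le_mul_of_nonneg_left k (by positivity)
  have x1 := hexp 1 one_pos
  have x2 := hexp T (one_pos.trans_le hT)
  rw [mul_one_div] at hloc
  rw [abs_le] at *
  linarith [x1.1, x1.2, x2.1, x2.2, hE.1, hE.2, hloc.1, hloc.2]

/-- For nonnegative `f`, uniformly bounded integrals over an exhaustion suffice. A bound on the
whole positive rate therefore controls each of its summands. -/
theorem integrableOn_Ioi_one_of_le {f g : ℝ → ℝ} {I : ℝ}
    (hf : ∀ T, 1 ≤ T → IntervalIntegrable f volume 1 T)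
    (hg : ∀ T, 1 ≤ T → IntervalIntegrable g volume 1 T) (h0 : ∀ s, 0 < s → 0 ≤ f s)
    (hfg : ∀ s, 0 < s → f s ≤ g s) (hI : ∀ T, 1 ≤ T → ∫ s in (1 : ℝ)..T, g s ≤ I) :
    IntegrableOn f (Ioi 1) := by
  have h1 : ∀ n : ℕ, (1 : ℝ) ≤ n + 1 := fun n => by
    have := n.cast_nonneg (α := ℝ); linarith
  refine integrableOn_Ioi_of_intervalIntegral_norm_bounded (l := atTop)
    (b := fun n : ℕ => (n : ℝ) + 1) I 1 (fun n => (hf _ (h1 n)).1)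
    (tendsto_natCast_atTop_atTop.atTop_add tendsto_const_nhds)
    (Eventually.of_forall fun n => ?_)
  refine le_trans (intervalIntegral.integral_mono_on (h1 n) (hf _ (h1 n)).norm (hg _ (h1 n))
    fun s hs => ?_) (hI _ (h1 n))
  have hs0 : 0 < s := one_pos.trans_le hs.1
  rw [Real.norm_of_nonneg (h0 s hs0)]
  exact hfg s hs0

end

end NLSMorawetz

end

/-! ### Assembly of the theorem -/

theorem mainTheorem4 (F : ℝ → ℝ) (a b : ℝ) (hF : NLSMorawetz.IsExteriorCutoff F a b) :
    ∃ G : ℝ → ℝ, Measurable G ∧ (∃ M : ℝ, ∀ y, |G y| ≤ M) ∧ (∀ y, y ∉ Set.Icc a b → G y = 0) ∧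
      ∀ β σ K : ℝ, 0 < β → β < 1 → 1 < β * (σ + 1) →
        ∃ C : ℝ, ∀ (p : ℝ) (V : ℝ → ℝ → ℝ) (u : ℝ → ℝ → ℂ), 1 < p →
          NLSMorawetz.IsLocalizedPotential σ K V → NLSMorawetz.IsEnergySolution p V u →
          -- every term below is well defined
          (∀ s : ℝ, 0 < s →
            NLSMorawetz.MemGammaDomain (NLSMorawetz.mulCut F β s (u s)) ∧
            NLSMorawetz.MemGammaDomain
              (NLSMorawetz.mulCut (NLSMorawetz.sqrtFF F) β s (u s)) ∧
            Integrable (NLSMorawetz.nonlinDensity F p β s (u s))) ∧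
          -- the identity for the change of the expectation of the observable
          (∀ t T : ℝ, 0 < t → t ≤ T →
            IntervalIntegrable (fun s => s ^ (-β) * NLSMorawetz.linTerm F β s (u s))
              volume t T ∧
            IntervalIntegrable (fun s => s ^ (-β) * NLSMorawetz.nonlinTerm F p β s (u s))
              volume t T ∧
            IntervalIntegrable (fun s => s ^ (-3 * β) * NLSMorawetz.locMass G β s (u s))
              volume t T ∧
            ∃ E : ℝ,
              |E| ≤ C * (t ^ (1 - β * (σ + 1)) + t ^ (β - 1)) * NLSMorawetz.l2NormSq (u 0) ∧
              NLSMorawetz.expectation (NLSMorawetz.extMorawetz F β T) (u T)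
                  - NLSMorawetz.expectation (NLSMorawetz.extMorawetz F β t) (u t) =
                (((∫ s in t..T,
                    (4 * s ^ (-β) * NLSMorawetz.linTerm F β s (u s)
                      + 2 * s ^ (-β) * ((p - 1) / (p + 1))
                        * NLSMorawetz.nonlinTerm F p β s (u s)))
                  + (∫ s in t..T, s ^ (-3 * β) * NLSMorawetz.locMass G β s (u s))
                  + E : ℝ) : ℂ)) ∧
          -- integrability in time of the positive terms
          (2 < σ → 1 / 3 < β → NLSMorawetz.HasBoundedEnergy u →
            IntegrableOn (fun s => 2 * s ^ (-β) * NLSMorawetz.linTerm F β s (u s))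
              (Set.Ioi 1) ∧
            IntegrableOn (fun s => s ^ (-β) * ((p - 1) / (p + 1))
              * NLSMorawetz.nonlinTerm F p β s (u s)) (Set.Ioi 1)) := by
  obtain ⟨M, hM⟩ := hF.exists_bound
  -- `G` is `(F'F)'' - 4 ((√(F'F))')²`. The bound `M` depends on `F` only, so the error constant
  -- depends on `F`, `β`, `σ` and `K` and is fixed before `p`, `V` and `u`.
  refine ⟨NLSMorawetz.cutG F, NLSMorawetz.measurable_cutG hF, ⟨M, hM.wG⟩,
    NLSMorawetz.cutG_zero_off hF, fun β σ K hβ hβ1 hβσ =>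
    ⟨NLSMorawetz.errConst M K a σ β, fun p V u hp hV hu => ?_⟩⟩
  have hσ : 0 ≤ σ := by nlinarith
  have pos : ∀ s : ℝ, 0 < s → 0 < s ^ β := fun s hs => Real.rpow_pos_of_pos hs β
  have hus : ∀ s : ℝ, 0 < s → u s = NLSMorawetz.extU u s := fun s hs => by
    rw [NLSMorawetz.extU, max_eq_left hs.le]
  have lin := fun t T (ht : 0 < t) (hle : t ≤ T) =>
    hu.intervalIntegrable_linTerm (β := β) hV hσ hp hF hM ht hle
  have nonlin := fun t T (ht : 0 < t) (hle : t ≤ T) =>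
    hu.intervalIntegrable_nonlinTerm (β := β) hV hσ hp hF hM ht hle
  refine ⟨fun s hs => ?_, fun t T ht hle => ⟨lin t T ht hle, nonlin t T ht hle,
    hu.intervalIntegrable_locMass hV hσ hp ⟨NLSMorawetz.measurable_cutG hF, hM.wG⟩
      (hF.isProfile_of_zero_off (NLSMorawetz.cutG_zero_off hF)) ht hle, ?_⟩,
    fun _ hβ3 hE => ?_⟩
  · rw [hus s hs]
    exact ⟨NLSMorawetz.memGammaDomain_mulCut hF hM (pos s hs) (hu.isH1 s),
      NLSMorawetz.memGammaDomain_mulCut_sqrtFF hF hM (pos s hs) (hu.isH1 s),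
      NLSMorawetz.integrable_nonlinDensity hF hM hp (pos s hs) (hu.isH1 s).memLp
        (hu.memLp_pw hp s)⟩
  · obtain ⟨E, hE, e⟩ := hu.morawetz_identity hV hp hF hM hβ hβ1 hβσ ht hle
    refine ⟨E, hE, ?_⟩
    have hT := ht.trans_le hle
    conv_lhs => rw [hus T hT, hus t ht]
    rw [NLSMorawetz.expectation_extMorawetz hF hM (pos T hT) (hu.isH1 T),
      NLSMorawetz.expectation_extMorawetz hF hM (pos t ht) (hu.isH1 t), ← Complex.ofReal_sub, e]
    rfl
  · obtain ⟨I, hI⟩ := hu.exists_integral_posRate_le hV hp hF hM hβ1 hβσ hβ3 hE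
    have x0 : ∀ s : ℝ, 0 < s → 0 < s ^ (-β) := fun s hs => Real.rpow_pos_of_pos hs _
    have c0 : 0 < (p - 1) / (p + 1) := div_pos (by linarith) (by linarith)
    have l0 : ∀ s, 0 < s → 0 ≤ s ^ (-β) * NLSMorawetz.linTerm F β s (u s) := fun s hs =>
      mul_nonneg (x0 s hs).le (NLSMorawetz.linTerm_nonneg _ _)
    have n0 : ∀ s, 0 < s → 0 ≤ s ^ (-β) * ((p - 1) / (p + 1))
        * NLSMorawetz.nonlinTerm F p β s (u s) := fun s hs =>
      mul_nonneg (mul_nonneg (x0 s hs).le c0.le) (NLSMorawetz.nonlinTerm_nonneg hF _ _)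
    have pr := fun T (hT : 1 ≤ T) =>
      hu.intervalIntegrable_posRate (β := β) hV hσ hp hF hM one_pos hT
    -- Each of the two terms is nonnegative and at most `posRate`, whose integrals over `[1, T]` are
    -- bounded by `I`.
    refine ⟨NLSMorawetz.integrableOn_Ioi_one_of_le (fun T hT => ?_) pr (fun s hs => ?_)
      (fun s hs => ?_) hI, NLSMorawetz.integrableOn_Ioi_one_of_le (fun T hT => ?_) pr n0
      (fun s hs => ?_) hI⟩
    · simpa only [mul_assoc] using (lin 1 T one_pos hT).const_mul 2
    · rw [mul_assoc]
      exact mul_nonneg zero_le_two (l0 s hs)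
    · have h1 := l0 s hs
      have h2 := n0 s hs
      rw [NLSMorawetz.posRate]
      linarith
    · refine ((nonlin 1 T one_pos hT).const_mul ((p - 1) / (p + 1))).congr fun s _ => ?_
      ring
    · have h1 := l0 s hs
      have h2 := n0 s hs
      rw [NLSMorawetz.posRate]
      linarith
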